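/- Let $d\ge 0$ be an integer and let the state space be $\{0,\dots,d\}$. Eigenvalues are listed with algebraic multiplicity. **Discrete time.** Let $P=(p_{ij})$ be a stochastic matrix on $\{0,\dots,d\}$ of birth-and-death type ($p_{ij}=0$ if $|i-j|>1$) with $p_{i,i+1}>0$ for $0\le i\le d-1$ and $p_{dd}=1$. Then all eigenvalues of $P$ are real, and they are nonnegative if $p_{ii}\ge 1/2$ for all $i$. Suppose that the eigenvalues are nonnegative and list them as $0\le\theta_0\le\dots\le\theta_d$. Then $\theta_{d-1}<\theta_d=1$. Put $$Q_k=\prod_{r<k}(1-\theta_r)^{-1}(P-\theta_rI),\qquad \Lambda(i,j)=Q_i(0,j)\qquad(0\le i,j,k\le d),$$ and let $\widehat P$ be the pure-birth kernel with $\widehat P(i,i)=\theta_i$, $\widehat P(i,i+1)=1-\theta_i$. Then all $Q_k$ and $\Lambda$ are stochastic, $\Lambda$ is lower triangular with $\Lambda(d,d)=1$, and $\Lambda P^t=\widehat P^t\Lambda$ for $t=0,1,\dots$. Let $X=(X_t)_{t\ge0}$ be a Markov chain with kernel $P$ and $X_0=0$, and let $U_0,U_1,\dots$ be i.i.d. uniform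 on $[0,1]$ and independent of $X$. Define $\widehat X_0=0$ and, given $\widehat X_t=\hat x$ and $X_{t+1}=y$: if $y\le\hat x$, then $\widehat X_{t+1}=\hat x+1$ if $$U_t<\frac{(1-\theta_{\hat x})\Lambda(\hat x+1,y)}{\theta_{\hat x}\Lambda(\hat x,y)+(1-\theta_{\hat x})\Lambda(\hat x+1,y)}$$ (never, if $\hat x=d$) and $\widehat X_{t+1}=\hat x$ otherwise; if $y>\hat x$, then $\widehat X_{t+1}=\hat x+1$. Then: 1. $\widehat X$ is a Markov chain with kernel $\widehat P$ and $\widehat X_0=0$, and $\mathcal L(X_t\mid\widehat X_0,\dots,\widehat X_t)=\Lambda(\widehat X_t,\cdot)$ for all $t$. 2. Almost surely, $\Lambda(\widehat X_t,X_t)>0$ and $X_t\le\widehat X_t$ for all $t$, and $X$ and $\widehat X$ have the same hitting time $T$ of $d$. 3. The waiting times $W_k$ ($0\le k\le d-1$) between the hitting times of $k$ and $k+1$ by $\widehat X$ are independent, $\mathbf P(W_k=n+1)=\theta_k^n(1-\theta_k)$ for $n\ge0$, and $T=W_0+\dots+W_{d-1}$ almost surely. 4. $\widehat P$ is itself a birth-and-death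 kernel of the above type with eigenvalues $\theta_0,\dots,\theta_d$, and it is stochastically maximal among these at every epoch: $\sum_{i\ge j}P^t(0,i)\le\sum_{i\ge j}\widehat P^t(0,i)$ for all $t$ and $j$. **Continuous time.** Let $G=(g_{ij})$ be a birth-and-death generator on $\{0,\dots,d\}$ (nonnegative off-diagonal entries, zero row sums, $g_{ij}=0$ if $|i-j|>1$) with $g_{i,i+1}>0$ for $0\le i\le d-1$ and $g_{dd}=0$. Then all eigenvalues of $-G$ are real; list them as $\nu_0\ge\dots\ge\nu_d$. Then $\nu_{d-1}>\nu_d=0$. Let $\Lambda(i,j)$ be the $(0,j)$ entry of $\prod_{r<i}\nu_r^{-1}(G+\nu_rI)$, and let $\widehat G$ be the pure-birth generator with birth rate $\nu_i$ at state $i$. Then the matrices $(G+\nu_0I)\cdots(G+\nu_{k-1}I)$, $0\le k\le d$, are nonnegative, $\Lambda$ is stochastic and lower triangular with $\Lambda(d,d)=1$, and $\Lambda e^{tG}=e^{t\widehat G}\Lambda$ for all $t\ge0$. Let $X$ be a continuous-time Markov chain with generator $G$, $X_0=0$ and right-continuous paths with left limits, and let $E_0,E_1,\dots$ be i.i.d.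 standard exponential variables independent of $X$. Construct $\widehat X$ with $\widehat X_0=0$ as follows: at time $0$ and at each later jump time $s$ of the bivariate process $(\widehat X,X)$, if it is then in state $(\hat x,x)$, start a fresh clock which rings after time $E_n/r$, where $n$ is the number of clocks started before and $r=\nu_{\hat x}\Lambda(\hat x+1,x)/\Lambda(\hat x,x)$ (it never rings if $r=0$, in particular if $\hat x=d$). If the clock rings before the next jump of $X$, then $\widehat X$ jumps to $\hat x+1$ at that moment; otherwise, when $X$ jumps, $\widehat X$ holds unless $X$ jumps to $\hat x+1$, in which case $\widehat X$ also jumps to $\hat x+1$. Then: 1. $\widehat X$ is a Markov chain with generator $\widehat G$, $\widehat X_0=0$ a.s. and right-continuous paths with left limits, and $\mathcal L(X_t\mid\widehat X_s,\ s\le t)=\Lambda(\widehat X_t,\cdot)$ for all $t\ge0$. 2. Almost surely, $\Lambda(\widehat X_t,X_t)>0$ and $X_t\le\widehat X_t$ for all $t$, and $X$ and $\widehat X$ have the same hitting time $T$ of $d$. 3. The waiting times $W_k$ ($0\le k\le d-1$) between the hitting times of $k$ and $k+1$ by $\widehat X$ are independent, $W_k$ is exponential with rate $\nu_k$, and $T=W_0+\dots+W_{d-1}$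 almost surely. 4. $\widehat G$ is itself a birth-and-death generator of the above type, $-\widehat G$ has eigenvalues $\nu_0,\dots,\nu_d$, and $\widehat G$ is stochastically maximal among these at every epoch: $\sum_{i\ge j}e^{tG}(0,i)\le\sum_{i\ge j}e^{t\widehat G}(0,i)$ for all $t\ge0$ and $j$. -/

import Mathlib

open MeasureTheory ProbabilityTheory Filter Topology Polynomial
open scoped NNReal ENNReal

noncomputable section

namespace BirthDeath

/-- The state space `{0, …, d}`. -/
abbrev State (d : ℕ) : Type := Fin (d + 1)

/-- `x ↦ x + 1` on `{0, …, d}`, with `d ↦ d`. -/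
def up {d : ℕ} (x : State d) : State d := ⟨min (x.val + 1) d, by omega⟩

/-- Transition matrix of a discrete-time birth-and-death chain on `{0, …, d}` in which `d` is
absorbing and is accessible from every state. -/
structure IsKernel {d : ℕ} (P : Matrix (State d) (State d) ℝ) : Prop where
  stochastic : P ∈ Matrix.rowStochastic ℝ (State d)
  nearest : ∀ i j : State d, i.val + 1 < j.val ∨ j.val + 1 < i.val → P i j = 0
  birth_pos : ∀ i : Fin d, 0 < P i.castSucc i.succ
  absorbing : P (Fin.last d) (Fin.last d) = 1

/-- Generator of a continuous-time birth-and-death chain on `{0, …, d}` in which `d` is absorbing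
and is accessible from every state. -/
structure IsGenerator {d : ℕ} (G : Matrix (State d) (State d) ℝ) : Prop where
  offDiag_nonneg : ∀ i j : State d, i ≠ j → 0 ≤ G i j
  row_sum : ∀ i : State d, ∑ j, G i j = 0
  nearest : ∀ i j : State d, i.val + 1 < j.val ∨ j.val + 1 < i.val → G i j = 0
  birth_pos : ∀ i : Fin d, 0 < G i.castSucc i.succ
  absorbing : G (Fin.last d) (Fin.last d) = 0

/-- `θ` lists the eigenvalues of `A`, with algebraic multiplicity. -/
def HasEigenvalues {d : ℕ} (A : Matrix (State d) (State d) ℝ) (θ : State d → ℝ) : Prop :=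
  A.charpoly = ∏ i, (X - C (θ i))

/-! ### Discrete time: spectral polynomials, link, spectral kernel -/

/-- `Q_k = (1 - θ_0)⁻¹ ⋯ (1 - θ_{k-1})⁻¹ (P - θ_0 I) ⋯ (P - θ_{k-1} I)`. -/
def specQ {d : ℕ} (P : Matrix (State d) (State d) ℝ) (θ : State d → ℝ) (k : State d) :
    Matrix (State d) (State d) ℝ :=
  (∏ r ∈ Finset.Iio k, (1 - θ r))⁻¹ • aeval P (∏ r ∈ Finset.Iio k, (X - C (θ r)))

/-- `Λ(i, j) = Q_i(0, j)`. -/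
def link {d : ℕ} (P : Matrix (State d) (State d) ℝ) (θ : State d → ℝ) :
    Matrix (State d) (State d) ℝ :=
  Matrix.of fun i j => specQ P θ i 0 j

/-- The pure-birth spectral kernel: hold at `i` with probability `θ_i`, else move to `i + 1`. -/
def spectralKernel {d : ℕ} (θ : State d → ℝ) : Matrix (State d) (State d) ℝ :=
  Matrix.of fun i j =>
    if j = i then θ i else if j.val = i.val + 1 then 1 - θ i else 0

/-! ### Continuous time: spectral polynomials, link, spectral generator -/

/-- `(G + ν_0 I) ⋯ (G + ν_{k-1} I)`. -/
def specPolyGen {d : ℕ} (G : Matrix (State d) (State d) ℝ) (ν : State d → ℝ) (k : State d) :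
    Matrix (State d) (State d) ℝ :=
  aeval G (∏ r ∈ Finset.Iio k, (X + C (ν r)))

/-- `Λ(i, j)` is the `(0, j)` entry of `ν_0⁻¹ ⋯ ν_{i-1}⁻¹ (G + ν_0 I) ⋯ (G + ν_{i-1} I)`. -/
def linkGen {d : ℕ} (G : Matrix (State d) (State d) ℝ) (ν : State d → ℝ) :
    Matrix (State d) (State d) ℝ :=
  Matrix.of fun i j => (∏ r ∈ Finset.Iio i, ν r)⁻¹ * specPolyGen G ν i 0 j

/-- The generator of the pure-birth spectral chain, with birth rate `ν_i` at `i`. -/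
def spectralGenerator {d : ℕ} (ν : State d → ℝ) : Matrix (State d) (State d) ℝ :=
  Matrix.of fun i j =>
    if j = i then -ν i else if j.val = i.val + 1 then ν i else 0

/-! ### Markov chains -/

section Chains

variable {Ω : Type*} [MeasurableSpace Ω] {d : ℕ}

/-- `X` is a discrete-time Markov chain with transition matrix `P` and `X_0 = 0` a.s. -/
structure IsChain (μ : Measure Ω) (X : ℕ → Ω → State d)
    (P : Matrix (State d) (State d) ℝ) : Prop where
  measurable : ∀ t, Measurable (X t)
  fdd : ∀ (n : ℕ) (x : ℕ → State d),
    μ.real {ω | ∀ i ≤ n, X i ω = x i} =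
      (if x 0 = 0 then 1 else 0) * ∏ i ∈ Finset.range n, P (x i) (x (i + 1))

/-- `X` is a continuous-time Markov chain with generator `G`, `X_0 = 0` a.s., whose paths are
right-continuous with left limits (in the discrete state space). -/
structure IsContChain (μ : Measure Ω) (X : ℝ≥0 → Ω → State d)
    (G : Matrix (State d) (State d) ℝ) : Prop where
  measurable : ∀ t, Measurable (X t)
  right_cont : ∀ ω t, ∀ᶠ s in 𝓝[>] t, X s ω = X t ω
  left_lim : ∀ ω t, ∃ y, ∀ᶠ s in 𝓝[<] t, X s ω = y
  fdd : ∀ (n : ℕ) (t : ℕ → ℝ≥0) (x : ℕ → State d), Monotone t → t 0 = 0 →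
    μ.real {ω | ∀ i ≤ n, X (t i) ω = x i} =
      (if x 0 = 0 then 1 else 0) *
        ∏ i ∈ Finset.range n,
          NormedSpace.exp (((t (i + 1) : ℝ) - (t i : ℝ)) • G) (x i) (x (i + 1))

/-- `V 0, V 1, …` are i.i.d. with law `ρ`, and the sequence is independent of the process `X`. -/
structure IsIndependentNoise {ι : Type*} (μ : Measure Ω) (X : ι → Ω → State d)
    (V : ℕ → Ω → ℝ) (ρ : Measure ℝ) : Prop where
  measurable : ∀ n, Measurable (V n)
  law : ∀ n, HasLaw (V n) ρ μ
  iid : iIndepFun V μ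
  indep : IndepFun (fun ω t => X t ω) (fun ω n => V n ω) μ

/-- `ℒ(X_t | X̂_s, s ≤ t) = Λ(X̂_t, ·)` for all `t`. -/
def SamplePathIntertwined {ι : Type*} [LE ι] (μ : Measure Ω) (X Xh : ι → Ω → State d)
    (Λ : Matrix (State d) (State d) ℝ) : Prop :=
  ∀ (t : ι) (y : State d),
    μ[(X t ⁻¹' {y}).indicator (fun _ => (1 : ℝ)) |
        ⨆ s : ι, ⨆ _ : s ≤ t, MeasurableSpace.comap (Xh s) inferInstance]
      =ᵐ[μ] fun ω => Λ (Xh t ω) y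

/-- Hitting time of `k` in discrete time (`⊤` if `k` is never hit). -/
def hit (X : ℕ → Ω → State d) (k : State d) (ω : Ω) : ℕ∞ :=
  ⨅ (t : ℕ) (_ : X t ω = k), (t : ℕ∞)

/-- Hitting time of `k` in continuous time (`⊤` if `k` is never hit). -/
def hitCont (X : ℝ≥0 → Ω → State d) (k : State d) (ω : Ω) : ℝ≥0∞ :=
  ⨅ (t : ℝ≥0) (_ : X t ω = k), (t : ℝ≥0∞)

/-- Waiting time between the hitting times of `k` and `k + 1`, in discrete time. -/
def wait (X : ℕ → Ω → State d) (k : Fin d) (ω : Ω) : ℕ :=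
  (hit X k.succ ω).toNat - (hit X k.castSucc ω).toNat

/-- Waiting time between the hitting times of `k` and `k + 1`, in continuous time. -/
def waitCont (X : ℝ≥0 → Ω → State d) (k : Fin d) (ω : Ω) : ℝ :=
  (hitCont X k.succ ω).toReal - (hitCont X k.castSucc ω).toReal

end Chains

/-! ### The sample-path constructions -/

/-- The discrete-time construction, from a path `x` of `X` and a sequence `u` in `[0, 1]`.  Given
`X̂_t = x̂` and `X_{t+1} = y`: if `y ≤ x̂`, then `X̂` moves to `x̂ + 1` when `u_t` is less than
`(1 - θ_x̂) Λ(x̂ + 1, y) / (θ_x̂ Λ(x̂, y) + (1 - θ_x̂) Λ(x̂ + 1, y))` and holds otherwise;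
if `y > x̂`, then `X̂` moves to `x̂ + 1`. -/
def dualPath {d : ℕ} (Λ : Matrix (State d) (State d) ℝ) (θ : State d → ℝ)
    (x : ℕ → State d) (u : ℕ → ℝ) : ℕ → State d
  | 0 => 0
  | t + 1 =>
    let xh := dualPath Λ θ x u t
    let y := x (t + 1)
    if y ≤ xh then
      if u t < (1 - θ xh) * Λ (up xh) y / (θ xh * Λ xh y + (1 - θ xh) * Λ (up xh) y) then up xh
      else xh
    else up xh

/-- The first time after `s` at which the path `x` differs from `x s` (`⊤` if there is none). -/
def nextJump {d : ℕ} (x : ℝ≥0 → State d) (s : ℝ≥0) : ℝ≥0∞ :=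
  ⨅ (t : ℝ≥0) (_ : s < t ∧ x t ≠ x s), (t : ℝ≥0∞)

/-- One step of the continuous-time construction.  The input is a jump time of the bivariate
process `(X̂, X)` with the value `x̂` of `X̂` there (time `⊤`: no further jump), the output is the
next one.  With `s` the current time and `x = X_s`, a clock of rate
`r = ν_x̂ Λ(x̂ + 1, x) / Λ(x̂, x)` is started (it rings after time `e / r`, where `e` is a standard
exponential variable, and never if `r = 0`).  If it rings before the next jump of `X`, then `X̂`
moves to `x̂ + 1` when it rings; otherwise `X̂` holds when `X` jumps, unless `X` jumps to `x̂ + 1`,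
in which case so does `X̂`. -/
def dualStep {d : ℕ} (Λ : Matrix (State d) (State d) ℝ) (ν : State d → ℝ)
    (x : ℝ≥0 → State d) (e : ℝ) (z : ℝ≥0∞ × State d) : ℝ≥0∞ × State d :=
  if z.1 = ⊤ then z
  else
    let s : ℝ≥0 := z.1.toNNReal
    let xh := z.2
    let r : ℝ := ν xh * Λ (up xh) (x s) / Λ xh (x s)
    let ring : ℝ≥0∞ := if 0 < r then z.1 + ENNReal.ofReal (e / r) else ⊤
    let jump : ℝ≥0∞ := nextJump x s
    if ring < jump then (ring, up xh)
    else if jump = ⊤ then (⊤, xh)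
    else (jump, if (x jump.toNNReal).val = xh.val + 1 then up xh else xh)

/-- Jump times of the bivariate process, with the values of `X̂` there. -/
def dualSkeleton {d : ℕ} (Λ : Matrix (State d) (State d) ℝ) (ν : State d → ℝ)
    (x : ℝ≥0 → State d) (e : ℕ → ℝ) : ℕ → ℝ≥0∞ × State d
  | 0 => (0, 0)
  | n + 1 => dualStep Λ ν x (e n) (dualSkeleton Λ ν x e n)

open Classical in
/-- The continuous-time construction: `X̂_t` is the value at the last jump time up to `t`. -/
def dualPathCont {d : ℕ} (Λ : Matrix (State d) (State d) ℝ) (ν : State d → ℝ)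
    (x : ℝ≥0 → State d) (e : ℕ → ℝ) (t : ℝ≥0) : State d :=
  if h : ∃ n, (dualSkeleton Λ ν x e n).1 ≤ t ∧ (t : ℝ≥0∞) < (dualSkeleton Λ ν x e (n + 1)).1 then
    (dualSkeleton Λ ν x e (Nat.find h)).2
  else 0

end BirthDeath

end

/-! Kernels and generators are handled together as birth-and-death matrices `A` with constant row
sum `ρ` (`IsBirthDeath`): `ρ = 1` for kernels, and `ρ = 0` with `θ = -ν` for generators.

Nonnegativity. Put p_k = (X - θ_0)...(X - θ_{k-1}) with θ increasing, and let q_k be the quotient of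
p_k(X) - p_k(A) by X - A. Then q_{k+1} = p_k(A) + (X - θ_k) q_k, and by Cayley-Hamilton q_{d+1} is
the adjugate of X - A. Read backwards, this recursion says that p_k(A)_{ij} is the divided
difference of the (i, j) adjugate entry at the points θ_k, ..., θ_d (`specMat_tridiag_apply`). For i
≤ j that entry is a nonnegative constant times the characteristic polynomial of A with rows and
columns i, ..., j deleted. After symmetrization, Cauchy interlacing shows that its roots, in
decreasing order, are dominated by the eigenvalues of A (`exists_dominated_roots`), and under this
domination a Leibniz rule makes the divided difference nonnegative (`divDiff_rootPoly_nonneg`). The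
equality cases of the same argument show that zeros of the link persist down its columns
(`specMat_succ_eq_zero`). Diagonal dominance places the eigenvalues: ρ is the largest and is simple.

Intertwining and maximality. The recursion p_{i+1}(A) = p_i(A)(A - θ_i), together with
Cayley-Hamilton at i = d, is ΛA = ÂΛ. Row 0 of Λ is the unit mass at 0 and Λ is lower triangular, so
tails of the first rows compare (`tail_sum_le`).

Sample paths. In both settings the heart is the joint law P(X̂ past = z, X_t = y) = P̂(z) Λ(z_t, y).
It gives the Markov property on summing over y, the conditional law by a π-λ argument, and almost
sure membership in the support of Λ, which forces X ≤ X̂ and equal hitting times of d. In discrete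
time it is an induction on the one-step identity `mul_dualProb`. In continuous time the path of X is
frozen and the memoryless clocks are analysed on a fine grid: cells without a jump of X cost a
second-order error, the finitely many cells with a jump a first-order one (`grid_path_bound`).
Averaging over X, the grid scheme follows the dual chain up to second order per cell, because the
generators satisfy the infinitesimal identity `IsDualData.consistent` (`gridMean_bound`). The two
limits, as the mesh tends to 0, agree (`cont_joint_fdd`).

Waiting times. In discrete time the probability of each pure-birth path is explicit. In continuous
time X̂ is compared in law with the same construction over a constant path, where the clocks simply
run one after the other; for this reason the construction is studied for abstract data `IsDualData`.
-/

noncomputable section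

namespace BirthDeath

/-! ### Continuants and tridiagonal matrices -/

/-- The monic continuant: characteristic polynomial of the leading `n × n` block of a tridiagonal
matrix with diagonal `a` and products `w i` of the entries `(i, i + 1)` and `(i + 1, i)`. -/
def continuant (a w : ℕ → ℝ) : ℕ → ℝ[X]
  | 0 => 1
  | 1 => X - C (a 0)
  | n + 2 => (X - C (a (n + 1))) * continuant a w (n + 1) - C (w n) * continuant a w n

/-- The continuant of the block that starts at `s`. -/
def continuantFrom (a w : ℕ → ℝ) (s n : ℕ) : ℝ[X] :=
  continuant (fun i => a (s + i)) (fun i => w (s + i)) n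

lemma continuantFrom_zero (a w : ℕ → ℝ) (s : ℕ) : continuantFrom a w s 0 = 1 := rfl

lemma continuantFrom_one (a w : ℕ → ℝ) (s : ℕ) : continuantFrom a w s 1 = X - C (a s) := rfl

lemma continuantFrom_start (a w : ℕ → ℝ) (n : ℕ) : continuantFrom a w 0 n = continuant a w n := by
  simp [continuantFrom]

lemma continuantFrom_add_two_right (a w : ℕ → ℝ) (s n : ℕ) :
    continuantFrom a w s (n + 2) =
      (X - C (a (s + (n + 1)))) * continuantFrom a w s (n + 1)
        - C (w (s + n)) * continuantFrom a w s n := rfl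

/-- A continuant reads the same from both ends. The definition removes the last site, whereas
determinants expanded along the first row, and the trailing blocks in the adjugate, need the first
site removed; both sides obey the same right recursion in `n`. -/
lemma continuantFrom_add_two_left (a w : ℕ → ℝ) (n : ℕ) : ∀ s,
    continuantFrom a w s (n + 2) =
      (X - C (a s)) * continuantFrom a w (s + 1) (n + 1)
        - C (w s) * continuantFrom a w (s + 2) n := by
  induction n using Nat.strong_induction_on with
  | _ n ih =>
    intro s
    match n with
    | 0 =>
      rw [continuantFrom_add_two_right]
      simp only [continuantFrom_zero, zero_add, continuantFrom_one, add_zero]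
      ring
    | 1 =>
      rw [continuantFrom_add_two_right, ih 0 (by omega) s, continuantFrom_add_two_right]
      simp only [continuantFrom_zero, zero_add, continuantFrom_one, add_zero]
      rw [show s + 1 + 1 = s + (1 + 1) by ring, show s + 1 = s + 1 from rfl]
      ring
    | m + 2 =>
      rw [continuantFrom_add_two_right, ih (m + 1) (by omega) s, ih m (by omega) s,
        continuantFrom_add_two_right a w (s + 1) (m + 1), continuantFrom_add_two_right a w (s + 2) m,
        show s + 1 + (m + 1 + 1) = s + (m + 2 + 1) by ring, show s + 1 + (m + 1) = s + (m + 2) by ring,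
        show s + 2 + (m + 1) = s + (m + 2 + 1) by ring, show s + 2 + m = s + (m + 2) by ring]
      ring

/-- Cutting the block between sites `i` and `i + 1` costs one correction term, in which both sites
are deleted. Both sides satisfy the same three-term recursion in `m`. -/
lemma continuant_split (a w : ℕ → ℝ) (i m : ℕ) :
    continuant a w (i + m + 2) =
      continuant a w (i + 1) * continuantFrom a w (i + 1) (m + 1)
        - C (w i) * continuant a w i * continuantFrom a w (i + 2) m := by
  induction m using Nat.strong_induction_on with
  | _ m ih =>
    match m with
    | 0 =>
      simp only [continuantFrom_zero, zero_add, continuantFrom_one, continuant]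
      ring
    | 1 =>
      rw [show i + 1 + 2 = (i + 1) + 2 from rfl, continuant, ih 0 (by omega),
        continuantFrom_add_two_right]
      simp only [continuantFrom_zero, zero_add, continuantFrom_one, add_zero]
      rw [show i + 1 + 1 = i + (1 + 1) by ring]
      ring
    | k + 2 =>
      rw [show i + (k + 2) + 2 = (i + k + 2) + 2 by ring, continuant,
        show i + k + 2 + 1 = i + (k + 1) + 2 by ring, ih (k + 1) (by omega), ih k (by omega),
        continuantFrom_add_two_right a w (i + 1) (k + 1), continuantFrom_add_two_right a w (i + 2) k,
        show i + 1 + (k + 1 + 1) = i + (k + 1) + 2 by ring,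
        show i + 1 + (k + 1) = i + k + 2 by ring,
        show i + 2 + (k + 1) = i + (k + 1) + 2 by ring, show i + 2 + k = i + k + 2 by ring]
      ring

/-- The tridiagonal matrix with diagonal `a`, upper diagonal `b` and lower diagonal `c`. -/
def tridiag {R : Type*} [Zero R] (a b c : ℕ → R) (n : ℕ) : Matrix (Fin n) (Fin n) R :=
  Matrix.of fun i j =>
    if i.val = j.val then a i else if i.val + 1 = j.val then b i
    else if j.val + 1 = i.val then c j else 0

lemma sum_tridiag_mul {R : Type*} [CommRing R] (a b c : ℕ → R) (n : ℕ) (i : Fin n) (v : ℕ → R) :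
    ∑ l : Fin n, tridiag a b c n i l * v l =
      a i * v i + (if i.val + 1 < n then b i * v (i + 1) else 0)
        + (if 0 < i.val then c (i - 1) * v (i - 1) else 0) := by
  have h : ∀ l : Fin n, tridiag a b c n i l * v l =
      (if l = i then a i * v i else 0) +
      (if l.val = i.val + 1 then b i * v (i + 1) else 0) +
      (if l.val + 1 = i.val then c (i - 1) * v (i - 1) else 0) := by
    intro l
    simp only [tridiag, Matrix.of_apply, Fin.ext_iff]
    rcases lt_trichotomy i.val l.val with h | h | h
    · by_cases h1 : i.val + 1 = l.val
      · simp [h1, h.ne, h.ne', show ¬ (l.val + 1 = i.val) by omega]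
      · simp [h1, h.ne, show ¬ (l.val + 1 = i.val) by omega, show l.val ≠ i.val by omega,
          show ¬ (l.val = i.val + 1) by omega]
    · simp [h]
    · by_cases h1 : l.val + 1 = i.val
      · have : l.val = i.val - 1 := by omega
        simp [h1, h.ne', show ¬ (i.val + 1 = l.val) by omega, show l.val ≠ i.val by omega,
          show ¬ (l.val = i.val + 1) by omega, this.symm]
      · simp [h1, h.ne', show ¬ (i.val + 1 = l.val) by omega, show l.val ≠ i.val by omega,
          show ¬ (l.val = i.val + 1) by omega]
  rw [Finset.sum_congr rfl fun l _ => h l, Finset.sum_add_distrib, Finset.sum_add_distrib,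
    Finset.sum_ite_eq' Finset.univ i]
  congr 1
  · congr 1
    · simp
    split_ifs with hi
    · rw [Finset.sum_eq_single (⟨i.val + 1, hi⟩ : Fin n)]
      · simp
      · intro l _ hl
        rw [if_neg]
        intro hh
        exact hl (Fin.ext hh)
      · simp
    · apply Finset.sum_eq_zero
      intro l _
      rw [if_neg]
      omega
  · split_ifs with hi
    · rw [Finset.sum_eq_single (⟨i.val - 1, by omega⟩ : Fin n)]
      · simp only
        rw [if_pos (by omega)]
      · intro l _ hl
        rw [if_neg]
        intro hh
        exact hl (Fin.ext (by simp only; omega))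
      · simp
    · apply Finset.sum_eq_zero
      intro l _
      rw [if_neg]
      omega

/-- Laplace expansion along the first row, which has two nonzero entries; the second minor is
expanded once more, along its first column. -/
lemma det_tridiag_succ_succ {R : Type*} [CommRing R] (a b c : ℕ → R) (n : ℕ) :
    (tridiag a b c (n + 2)).det =
      a 0 * (tridiag (fun i => a (i + 1)) (fun i => b (i + 1)) (fun i => c (i + 1)) (n + 1)).det
        - b 0 * c 0 *
          (tridiag (fun i => a (i + 2)) (fun i => b (i + 2)) (fun i => c (i + 2)) n).det := by
  have e0 : (tridiag a b c (n + 2)).submatrix Fin.succ (Fin.succAbove 0) =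
      tridiag (fun i => a (i + 1)) (fun i => b (i + 1)) (fun i => c (i + 1)) (n + 1) := by
    ext i j
    simp [tridiag]
  have e1 : ((tridiag a b c (n + 2)).submatrix Fin.succ (Fin.succAbove 1)).submatrix
      (Fin.succAbove 0) Fin.succ =
      tridiag (fun i => a (i + 2)) (fun i => b (i + 2)) (fun i => c (i + 2)) n := by
    ext i j
    simp [tridiag, Fin.succAbove, Fin.lt_def, add_assoc]
  rw [Matrix.det_succ_row_zero, Fin.sum_univ_succ, Fin.sum_univ_succ]
  rw [Finset.sum_eq_zero]
  · rw [e0, Fin.succ_zero_eq_one, Matrix.det_succ_column_zero ((tridiag a b c (n + 2)).submatrix _ _),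
      Fin.sum_univ_succ, Finset.sum_eq_zero, e1]
    · simp [tridiag]
      ring
    · intro i _
      simp [tridiag, Fin.succAbove]
  · intro i _
    simp [tridiag]

lemma charmatrix_tridiag (a b c : ℕ → ℝ) (n : ℕ) :
    (tridiag a b c n).charmatrix =
      tridiag (fun i => X - C (a i)) (fun i => -C (b i)) (fun i => -C (c i)) n := by
  ext i j : 2
  by_cases h : i = j
  · subst h
    simp [tridiag]
  · rw [Matrix.charmatrix_apply_ne _ _ _ h]
    have : i.val ≠ j.val := fun h' => h (Fin.ext h')
    simp only [tridiag, Matrix.of_apply, if_neg this]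
    split_ifs <;> simp

lemma charpoly_tridiag (n : ℕ) : ∀ a b c : ℕ → ℝ,
    (tridiag a b c n).charpoly = continuant a (fun i => b i * c i) n := by
  induction n using Nat.strong_induction_on with
  | _ n ih =>
    intro a b c
    match n with
    | 0 => simp [continuant]
    | 1 => simp [Matrix.charpoly, continuant, tridiag]
    | n + 2 =>
      have h1 := ih (n + 1) (by omega) (fun i => a (i + 1)) (fun i => b (i + 1)) (fun i => c (i + 1))
      have h2 := ih n (by omega) (fun i => a (i + 2)) (fun i => b (i + 2)) (fun i => c (i + 2))
      rw [Matrix.charpoly, charmatrix_tridiag] at h1 h2 ⊢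
      rw [det_tridiag_succ_succ, h1, h2, ← continuantFrom_start a, continuantFrom_add_two_left]
      simp [continuantFrom, add_comm]

/-! ### Divided differences of products of linear factors -/

/-- Iterated quotient by `X - x`, with a final evaluation. -/
def divDiff : List ℝ → ℝ[X] → ℝ
  | [], _ => 0
  | [x], f => f.eval x
  | x :: y :: ys, f => divDiff (y :: ys) (f /ₘ (X - C x))

lemma divByMonic_X_sub_C_eq {f g : ℝ[X]} {x v : ℝ} (h : f = C v + (X - C x) * g) :
    f /ₘ (X - C x) = g :=
  (div_modByMonic_unique g (C v) (monic_X_sub_C x)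
    ⟨h.symm, by rw [degree_X_sub_C]; exact lt_of_le_of_lt degree_C_le (by norm_num)⟩).1

lemma eq_eval_add_mul_divByMonic (f : ℝ[X]) (x : ℝ) :
    f = C (f.eval x) + (X - C x) * (f /ₘ (X - C x)) := by
  conv_lhs => rw [← modByMonic_add_div f (X - C x), modByMonic_X_sub_C_eq_C_eval]

lemma divDiff_linear (xs : List ℝ) : ∀ (r : ℝ) (f g : ℝ[X]),
    divDiff xs (C r * f + g) = r * divDiff xs f + divDiff xs g := by
  match xs with
  | [] => simp [divDiff]
  | [x] => simp [divDiff]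
  | x :: y :: ys =>
    intro r f g
    have h : (C r * f + g) /ₘ (X - C x) = C r * (f /ₘ (X - C x)) + g /ₘ (X - C x) := by
      apply divByMonic_X_sub_C_eq (v := r * f.eval x + g.eval x)
      conv_lhs => rw [eq_eval_add_mul_divByMonic f x, eq_eval_add_mul_divByMonic g x]
      simp only [map_add, map_mul]
      ring
    simp only [divDiff, h]
    exact divDiff_linear (y :: ys) r _ _

lemma divDiff_zero (xs : List ℝ) : divDiff xs 0 = 0 := by
  have := divDiff_linear xs 1 0 0
  simpa using this

lemma divDiff_C_mul (xs : List ℝ) (r : ℝ) (f : ℝ[X]) :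
    divDiff xs (C r * f) = r * divDiff xs f := by
  have := divDiff_linear xs r f 0
  simpa [divDiff_zero] using this

/-- Leibniz rule: (X - a) g = (x - a) g + (X - x) g, so division by X - x leaves (x - a) times the
quotient of g, plus g itself. All positivity statements below rest on this formula with a ≤ x. -/
lemma divDiff_linear_factor (a x : ℝ) (xs : List ℝ) (g : ℝ[X]) :
    divDiff (x :: xs) ((X - C a) * g) = (x - a) * divDiff (x :: xs) g + divDiff xs g := by
  match xs with
  | [] => simp [divDiff]
  | y :: ys =>
    have h : ((X - C a) * g) /ₘ (X - C x) = C (x - a) * (g /ₘ (X - C x)) + g := by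
      apply divByMonic_X_sub_C_eq (v := (x - a) * g.eval x)
      have := eq_eval_add_mul_divByMonic g x
      calc (X - C a) * g = C (x - a) * g + (X - C x) * g := by rw [C_sub]; ring
        _ = C (x - a) * (C (g.eval x) + (X - C x) * (g /ₘ (X - C x))) + (X - C x) * g := by
            rw [← this]
        _ = _ := by simp only [map_mul]; ring
    simp only [divDiff, h]
    exact divDiff_linear (y :: ys) _ _ _

lemma divDiff_one (x : ℝ) (xs : List ℝ) :
    divDiff (x :: xs) 1 = if xs = [] then 1 else 0 := by
  match xs with
  | [] => simp [divDiff]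
  | y :: ys =>
    have h : (1 : ℝ[X]) /ₘ (X - C x) = 0 := divByMonic_X_sub_C_eq (v := 1) (by simp)
    simp [divDiff, h, divDiff_zero]

/-! ### Positivity of divided differences when the roots are dominated by the points -/

/-- The monic polynomial with roots `L`. -/
def rootPoly (L : List ℝ) : ℝ[X] := (L.map fun a => X - C a).prod

lemma rootPoly_cons (a : ℝ) (L : List ℝ) : rootPoly (a :: L) = (X - C a) * rootPoly L := by
  simp [rootPoly]

/-- `L` is dominated by `M`, entry by entry. -/
def Dominated : List ℝ → List ℝ → Prop
  | a :: L, x :: xs => a ≤ x ∧ Dominated L xs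
  -- The lists may differ in length; only their common initial segment is compared.
  | _, _ => True

/-- Dropping the largest root moves every other root one place forward, and in a decreasing list
this only makes the entries smaller. -/
lemma Dominated.of_cons {a : ℝ} : ∀ {L M : List ℝ}, (a :: L).Pairwise (· ≥ ·) →
    Dominated (a :: L) M → Dominated L M
  | [], _, _, _ => by unfold Dominated; trivial
  | _ :: _, [], _, _ => trivial
  | b :: L, x :: xs, hs, h => by
    obtain ⟨h1, h2⟩ := h
    have hab : b ≤ a := List.rel_of_pairwise_cons hs (by simp)
    refine ⟨hab.trans h1, ?_⟩
    exact Dominated.of_cons (List.Pairwise.of_cons hs) h2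

/-- Induction by the Leibniz rule: the coefficient x - a is nonnegative by domination, and both
remaining divided differences involve one root fewer and are again dominated. -/
lemma divDiff_rootPoly_nonneg : ∀ (L xs : List ℝ), L.Pairwise (· ≥ ·) → Dominated L xs →
    0 ≤ divDiff xs (rootPoly L)
  | _, [], _, _ => by simp [divDiff]
  | [], x :: xs, _, _ => by
    have : rootPoly [] = 1 := rfl
    rw [this, divDiff_one]
    split_ifs <;> norm_num
  | a :: L, x :: xs, hs, h => by
    rw [rootPoly_cons, divDiff_linear_factor]
    have h1 := divDiff_rootPoly_nonneg L (x :: xs) (List.Pairwise.of_cons hs) (h.of_cons hs)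
    have h2 := divDiff_rootPoly_nonneg L xs (List.Pairwise.of_cons hs) h.2
    have := mul_nonneg (sub_nonneg.2 h.1) h1
    linarith

/-- A polynomial of degree n has its leading coefficient as divided difference at n + 1 points, and
0 at more points. -/
lemma divDiff_rootPoly_of_length : ∀ (L xs : List ℝ),
    (xs.length = L.length + 1 → divDiff xs (rootPoly L) = 1) ∧
    (L.length + 1 < xs.length → divDiff xs (rootPoly L) = 0)
  | _, [] => by simp
  | [], x :: xs => by
    have : rootPoly [] = 1 := rfl
    rw [this, divDiff_one]
    constructor
    · intro h
      simp at h
      simp [h]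
    · intro h
      rw [if_neg]
      rintro rfl
      simp at h
  | a :: L, x :: xs => by
    have h1 := divDiff_rootPoly_of_length L (x :: xs)
    have h2 := divDiff_rootPoly_of_length L xs
    rw [rootPoly_cons, divDiff_linear_factor]
    constructor
    · intro h
      simp only [List.length_cons] at h h1
      rw [h1.2 (by omega), h2.1 (by omega)]
      ring
    · intro h
      simp only [List.length_cons] at h h1
      rw [h1.2 (by omega), h2.2 (by omega)]
      ring

/-- If a divided difference vanishes, so does the one with the last point removed. -/
lemma divDiff_rootPoly_eq_zero_of_concat : ∀ (L xs : List ℝ) (y : ℝ), L.Pairwise (· ≥ ·) →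
    Dominated L (xs ++ [y]) → xs.length ≤ L.length →
    divDiff (xs ++ [y]) (rootPoly L) = 0 → divDiff xs (rootPoly L) = 0
  | _, [], _, _, _, _, _ => by simp [divDiff]
  | [], x :: xs, _, _, _, h, _ => by simp at h
  | a :: L, x :: xs, y, hs, hd, hl, h0 => by
    have hs' := List.Pairwise.of_cons hs
    have hl' : xs.length ≤ L.length := by simpa using hl
    rw [List.cons_append] at hd h0
    have n1 := divDiff_rootPoly_nonneg L (x :: (xs ++ [y])) hs' (hd.of_cons hs)
    have n2 := divDiff_rootPoly_nonneg L (xs ++ [y]) hs' hd.2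
    rw [rootPoly_cons, divDiff_linear_factor] at h0 ⊢
    have n3 := mul_nonneg (sub_nonneg.2 hd.1) n1
    -- The Leibniz rule exhibits the vanishing quantity as a sum of two nonnegative terms, so each
    -- of them vanishes.
    have z2 : divDiff (xs ++ [y]) (rootPoly L) = 0 := by linarith
    have z1 : (x - a) * divDiff (x :: (xs ++ [y])) (rootPoly L) = 0 := by linarith
    rw [divDiff_rootPoly_eq_zero_of_concat L xs y hs' hd.2 hl' z2, add_zero]
    rcases mul_eq_zero.1 z1 with h | h
    · rw [h, zero_mul]
    -- Equality of the lengths is impossible: the divided difference in `z2` would then be a leading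
    -- coefficient, hence 1. In the strict case the list `x :: xs` is still short enough for the
    -- induction hypothesis.
    · rcases hl'.eq_or_lt with hlen | hlen
      · have := (divDiff_rootPoly_of_length L (xs ++ [y])).1 (by simp [hlen])
        rw [this] at z2
        exact absurd z2 one_ne_zero
      · rw [divDiff_rootPoly_eq_zero_of_concat L (x :: xs) y hs' (hd.of_cons hs) (by simpa using hlen) h,
          mul_zero]

/-- Testing the counts at z = head of `M`, above which `M` has nothing, compares the heads. Without
the heads the counts remain ordered: for z below both heads each side loses one, and otherwise the
tail of `L` has no entry above z. -/
lemma dominated_of_countP_le : ∀ (L M : List ℝ), L.Pairwise (· ≥ ·) → M.Pairwise (· ≥ ·) →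
    (∀ z : ℝ, L.countP (fun a => decide (z < a)) ≤ M.countP (fun a => decide (z < a))) →
    Dominated L M
  | [], M, _, _, _ => by unfold Dominated; trivial
  | _ :: _, [], _, _, _ => trivial
  | a :: L, x :: M, hL, hM, h => by
    have hL' := List.pairwise_cons.1 hL
    have hM' := List.pairwise_cons.1 hM
    have hax : a ≤ x := by
      by_contra! hlt
      have h1 := h x
      have h2 : (x :: M).countP (fun a => decide (x < a)) = 0 := by
        rw [List.countP_eq_zero]
        intro b hb
        rcases List.mem_cons.1 hb with rfl | hb
        · simp
        · simpa using hM'.1 b hb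
      rw [h2, List.countP_cons_of_pos (by simpa using hlt)] at h1
      omega
    refine ⟨hax, dominated_of_countP_le L M hL'.2 hM'.2 fun z => ?_⟩
    by_cases hz : z < a
    · have h1 := h z
      rw [List.countP_cons_of_pos (by simpa using hz),
        List.countP_cons_of_pos (by simpa using hz.trans_le hax)] at h1
      omega
    · have : L.countP (fun a => decide (z < a)) = 0 := by
        rw [List.countP_eq_zero]
        intro b hb
        have := hL'.1 b hb
        push Not at hz
        simpa using le_trans this hz
      omega

/-- `[θ (k + m - 1), …, θ k]`. -/
def topList (θ : ℕ → ℝ) (k : ℕ) : ℕ → List ℝ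
  | 0 => []
  | m + 1 => θ (k + m) :: topList θ k m

lemma topList_length (θ : ℕ → ℝ) (k m : ℕ) : (topList θ k m).length = m := by
  induction m with
  | zero => rfl
  | succ m ih => simp [topList, ih]

lemma topList_succ_concat (θ : ℕ → ℝ) (k m : ℕ) :
    topList θ k (m + 1) = topList θ (k + 1) m ++ [θ k] := by
  induction m with
  | zero => simp [topList]
  | succ m ih =>
    rw [topList, ih, topList, List.cons_append]
    congr 2
    omega

lemma Dominated.of_append : ∀ {L xs ys : List ℝ}, Dominated L (xs ++ ys) → Dominated L xs
  | [], _, _, _ => by unfold Dominated; trivial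
  | _ :: _, [], _, _ => trivial
  | _ :: _, _ :: _, _, h => ⟨h.1, Dominated.of_append h.2⟩

lemma topList_append (θ : ℕ → ℝ) (k m : ℕ) :
    topList θ 0 (k + m) = topList θ k m ++ topList θ 0 k := by
  induction m with
  | zero => simp [topList]
  | succ m ih => rw [← add_assoc, topList, ih, topList, zero_add]; rfl

/-- The recursion is a division with remainder by X - θ_m. Dividing by X - θ_{k+m}, ..., X - θ_{k+1}
peels down to f_{k+1}, whose value at θ_k is the remainder v_k. -/
lemma divDiff_topList (θ v : ℕ → ℝ) (f : ℕ → ℝ[X])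
    (hf : ∀ m, f (m + 1) = C (v m) + (X - C (θ m)) * f m) (k m : ℕ) :
    divDiff (topList θ k (m + 1)) (f (k + m + 1)) = v k := by
  induction m with
  | zero => simp [topList, divDiff, hf k]
  | succ m ih =>
    have : f (k + (m + 1) + 1) /ₘ (X - C (θ (k + (m + 1)))) = f (k + (m + 1)) :=
      divByMonic_X_sub_C_eq (hf _)
    rw [topList, topList, divDiff, this]
    exact ih

/-! ### Interlacing for real symmetric matrices -/

lemma exists_orthogonal_diagonalization {n : Type*} [Fintype n] [DecidableEq n]
    {A : Matrix n n ℝ} (hA : A.IsHermitian) :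
    ∃ U : Matrix n n ℝ, U.transpose * U = 1 ∧ U * U.transpose = 1 ∧
      U.transpose * A * U = Matrix.diagonal hA.eigenvalues := by
  refine ⟨hA.eigenvectorUnitary, ?_, ?_, ?_⟩
  · have := Unitary.coe_star_mul_self hA.eigenvectorUnitary
    rwa [Matrix.star_eq_conjTranspose, Matrix.conjTranspose_eq_transpose_of_trivial] at this
  · have := Unitary.coe_mul_star_self hA.eigenvectorUnitary
    rwa [Unitary.coe_star, Matrix.star_eq_conjTranspose, Matrix.conjTranspose_eq_transpose_of_trivial] at this
  · have := hA.conjStarAlgAut_star_eigenvectorUnitary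
    rw [Unitary.conjStarAlgAut_star_apply, Matrix.star_eq_conjTranspose,
      Matrix.conjTranspose_eq_transpose_of_trivial] at this
    rw [this]
    rfl

/-- Courant-Fischer dimension count. If more `kap` than `lam` exceeded z, some nonzero vector
supported on the coordinates with `kap > z` would be mapped by `W` to a vector without components
where `lam > z`. Its quadratic form minus z times its squared norm would be positive on one side of
the isometry and nonpositive on the other. -/
lemma card_filter_le_of_isometry {n ι : Type*} [Fintype n] [DecidableEq n] [Fintype ι]
    [DecidableEq ι] (W : Matrix n ι ℝ) (lam : n → ℝ) (kap : ι → ℝ)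
    (h1 : W.transpose * W = 1)
    (h2 : W.transpose * Matrix.diagonal lam * W = Matrix.diagonal kap) (z : ℝ) :
    (Finset.univ.filter fun i => z < kap i).card ≤ (Finset.univ.filter fun j => z < lam j).card := by
  by_contra! hlt
  let I := {i : ι // z < kap i}
  let J := {j : n // z < lam j}
  let ext : (I → ℝ) →ₗ[ℝ] (ι → ℝ) :=
    { toFun := fun c i => if h : z < kap i then c ⟨i, h⟩ else 0
      map_add' := by intro x y; ext i; by_cases h : z < kap i <;> simp [h]
      map_smul' := by intro r x; ext i; by_cases h : z < kap i <;> simp [h] }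
  let res : (n → ℝ) →ₗ[ℝ] (J → ℝ) := LinearMap.funLeft ℝ ℝ (fun j : J => j.1)
  let T := res ∘ₗ W.mulVecLin ∘ₗ ext
  have hfin : Module.finrank ℝ (J → ℝ) < Module.finrank ℝ (I → ℝ) := by
    rw [Module.finrank_fintype_fun_eq_card, Module.finrank_fintype_fun_eq_card,
      Fintype.card_subtype, Fintype.card_subtype]
    exact hlt
  obtain ⟨c, hc, hc0⟩ := Submodule.exists_mem_ne_zero_of_ne_bot
    (LinearMap.ker_ne_bot_of_finrank_lt (f := T) hfin)
  have hT : ∀ j, z < lam j → (W.mulVec (ext c)) j = 0 := by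
    intro j hj
    have := congrFun (LinearMap.mem_ker.1 hc) ⟨j, hj⟩
    simpa [T, res, LinearMap.funLeft] using this
  have e1 : ∑ j, (W.mulVec (ext c)) j * (W.mulVec (ext c)) j = ∑ i, ext c i * ext c i := by
    have : W.mulVec (ext c) ⬝ᵥ W.mulVec (ext c) = ext c ⬝ᵥ ext c := by
      rw [Matrix.dotProduct_mulVec, Matrix.vecMul_mulVec, ← Matrix.dotProduct_mulVec]
      rw [h1, Matrix.one_mulVec]
    exact this
  have e2 : ∑ j, lam j * ((W.mulVec (ext c)) j * (W.mulVec (ext c)) j)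
      = ∑ i, kap i * (ext c i * ext c i) := by
    have : W.mulVec (ext c) ⬝ᵥ (Matrix.diagonal lam).mulVec (W.mulVec (ext c)) =
        ext c ⬝ᵥ (Matrix.diagonal kap).mulVec (ext c) := by
      rw [← h2, Matrix.mulVec_mulVec, Matrix.dotProduct_mulVec, Matrix.vecMul_mulVec,
        ← Matrix.dotProduct_mulVec, Matrix.mul_assoc]
    simp only [dotProduct, Matrix.mulVec_diagonal] at this
    rw [show (∑ j, lam j * ((W.mulVec (ext c)) j * (W.mulVec (ext c)) j)) =
      ∑ j, (W.mulVec (ext c)) j * (lam j * (W.mulVec (ext c)) j) from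
        Finset.sum_congr rfl fun _ _ => by ring, this]
    exact Finset.sum_congr rfl fun _ _ => by ring
  have e3 : ∑ j, (lam j - z) * ((W.mulVec (ext c)) j * (W.mulVec (ext c)) j)
      = ∑ i, (kap i - z) * (ext c i * ext c i) := by
    simp only [sub_mul, Finset.sum_sub_distrib, ← Finset.mul_sum, e1, e2]
  have neg : ∑ j, (lam j - z) * ((W.mulVec (ext c)) j * (W.mulVec (ext c)) j) ≤ 0 := by
    apply Finset.sum_nonpos
    intro j _
    by_cases hj : z < lam j
    · simp [hT j hj]
    · push Not at hj
      exact mul_nonpos_of_nonpos_of_nonneg (by linarith) (mul_self_nonneg _)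
  have pos : 0 < ∑ i, (kap i - z) * (ext c i * ext c i) := by
    obtain ⟨i, hi⟩ := Function.ne_iff.1 hc0
    apply Finset.sum_pos'
    · intro k _
      by_cases hk : z < kap k
      · exact mul_nonneg (by linarith) (mul_self_nonneg _)
      · simp [ext, hk]
    · refine ⟨i.1, Finset.mem_univ _, ?_⟩
      have : ext c i.1 = c i := by simp [ext, i.2]
      rw [this]
      have hne : c i ≠ 0 := hi
      exact mul_pos (by linarith [i.2]) (mul_self_pos.2 hne)
  linarith

/-- One half of Cauchy interlacing. With `E` the coordinate embedding and `U`, `V` the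
diagonalizations, Uᵀ E V is an isometry that compresses one diagonal form to the other. -/
lemma card_filter_eigenvalues_submatrix_le {n ι : Type*} [Fintype n] [DecidableEq n] [Fintype ι]
    [DecidableEq ι] {A : Matrix n n ℝ} (hA : A.IsHermitian) (f : ι → n)
    (hf : Function.Injective f) (hB : (A.submatrix f f).IsHermitian) (z : ℝ) :
    (Finset.univ.filter fun i => z < hB.eigenvalues i).card ≤
      (Finset.univ.filter fun j => z < hA.eigenvalues j).card := by
  obtain ⟨U, hU1, hU2, hU3⟩ := exists_orthogonal_diagonalization hA
  obtain ⟨V, hV1, hV2, hV3⟩ := exists_orthogonal_diagonalization hB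
  let E : Matrix n ι ℝ := (1 : Matrix n n ℝ).submatrix id f
  have hE : E.transpose * E = 1 := by
    ext i j
    simp [E, Matrix.mul_apply, Matrix.one_apply, hf.eq_iff]
  have hEA : E.transpose * A * E = A.submatrix f f := by
    have h1 : E.transpose * A = A.submatrix f id := by
      ext i j
      simp [E, Matrix.mul_apply, Matrix.one_apply]
    rw [h1]
    ext i j
    simp [E, Matrix.mul_apply, Matrix.one_apply]
  apply card_filter_le_of_isometry (U.transpose * E * V)
  · calc (U.transpose * E * V).transpose * (U.transpose * E * V)
        = V.transpose * (E.transpose * (U * U.transpose) * E) * V := by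
          simp only [Matrix.transpose_mul, Matrix.transpose_transpose, Matrix.mul_assoc]
      _ = 1 := by rw [hU2, Matrix.mul_one, hE, Matrix.mul_one, hV1]
  · rw [← hU3, ← hV3, ← hEA]
    calc (U.transpose * E * V).transpose * (U.transpose * A * U) * (U.transpose * E * V)
        = V.transpose * (E.transpose * ((U * U.transpose) * A * (U * U.transpose)) * E) * V := by
          simp only [Matrix.transpose_mul, Matrix.transpose_transpose, Matrix.mul_assoc]
      _ = _ := by rw [hU2, Matrix.mul_one, Matrix.one_mul]

/-! ### The adjugate of a tridiagonal matrix -/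

/-- The `(i, j)` entry of the adjugate of `X - A`, for the tridiagonal matrix `A` of size `d + 1`. -/
def adjEntry (a b c : ℕ → ℝ) (d i j : ℕ) : ℝ[X] :=
  if i ≤ j then
    C (∏ l ∈ Finset.Ico i j, b l) *
      (continuant a (fun l => b l * c l) i * continuantFrom a (fun l => b l * c l) (j + 1) (d - j))
  else
    C (∏ l ∈ Finset.Ico j i, c l) *
      (continuant a (fun l => b l * c l) j * continuantFrom a (fun l => b l * c l) (i + 1) (d - i))

/-- This is the (i, j) entry of (X - A) times the candidate adjugate. Off the diagonal one of the
two continuant factors is common to all terms and the other cancels by its three-term recursion; on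
the diagonal, what remains is `continuant_split`. -/
lemma adjEntry_row (a b c : ℕ → ℝ) (d i j : ℕ) (hi : i ≤ d) (hj : j ≤ d) :
    (X - C (a i)) * adjEntry a b c d i j
      + (if i + 1 < d + 1 then -C (b i) * adjEntry a b c d (i + 1) j else 0)
      + (if 0 < i then -C (c (i - 1)) * adjEntry a b c d (i - 1) j else 0)
      = if i = j then continuant a (fun l => b l * c l) (d + 1) else 0 := by
  set w : ℕ → ℝ := fun l => b l * c l with hw
  have hwl : ∀ l, C (w l) = C (b l) * C (c l) := fun l => by simp [hw]
  rcases lt_trichotomy i j with h | h | h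
  · -- above the diagonal: recursion of the leading continuant
    rw [if_pos (by omega), if_neg h.ne, adjEntry, adjEntry, if_pos h.le, if_pos (by omega : i + 1 ≤ j),
      Finset.prod_eq_prod_Ico_succ_bot h]
    match i with
    | 0 =>
      simp only [lt_irrefl, if_false, continuant, map_mul]
      ring
    | i + 1 =>
      rw [if_pos (by omega), adjEntry, if_pos (by omega), Nat.add_sub_cancel,
        Finset.prod_eq_prod_Ico_succ_bot (by omega : i < j),
        Finset.prod_eq_prod_Ico_succ_bot (by omega : i + 1 < j)]
      simp only [continuant, map_mul, ← hw]
      ring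
  · subst h
    rw [if_pos rfl, adjEntry, if_pos le_rfl, Finset.Ico_self, Finset.prod_empty, map_one, one_mul]
    by_cases hid : i + 1 < d + 1
    · obtain ⟨m, rfl⟩ : ∃ m, d = i + 1 + m := ⟨d - i - 1, by omega⟩
      rw [if_pos hid, adjEntry, if_neg (by omega), show i + 1 + m - i = m + 1 by omega,
        show i + 1 + m - (i + 1) = m by omega, Nat.Ico_succ_singleton, Finset.prod_singleton]
      rw [show i + 1 + m + 1 = i + m + 2 by ring, continuant_split]
      match i with
      | 0 =>
        simp only [lt_irrefl, if_false, continuant, ← hw, hwl]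
        ring
      | i + 1 =>
        rw [if_pos (by omega), adjEntry, if_pos (by omega), Nat.add_sub_cancel,
          show i + 1 + 1 + m - (i + 1) = m + 1 by omega, Nat.Ico_succ_singleton,
          Finset.prod_singleton]
        simp only [continuant, ← hw, hwl]
        ring
    · obtain rfl : i = d := by omega
      rw [if_neg hid, Nat.sub_self, continuantFrom_zero]
      match i with
      | 0 => simp [continuant]
      | i + 1 =>
        rw [if_pos (by omega), adjEntry, if_pos (by omega), Nat.add_sub_cancel, Nat.sub_self,
          continuantFrom_zero, Nat.Ico_succ_singleton, Finset.prod_singleton]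
        simp only [continuant, ← hw, hwl]
        ring
  · -- below the diagonal: recursion of the trailing continuant
    obtain ⟨i, rfl⟩ : ∃ k, i = k + 1 := ⟨i - 1, by omega⟩
    rw [if_neg h.ne', if_pos (by omega : 0 < i + 1), Nat.add_sub_cancel]
    have e2 : adjEntry a b c d i j = C (∏ l ∈ Finset.Ico j i, c l) *
        (continuant a w j * continuantFrom a w (i + 1) (d - i)) := by
      rw [adjEntry]
      split_ifs with hij
      · obtain rfl : i = j := by omega
        simp [hw]
      · rfl
    rw [e2, adjEntry, if_neg (by omega), Finset.prod_Ico_succ_top (by omega)]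
    by_cases hid : i + 1 + 1 < d + 1
    · obtain ⟨m, rfl⟩ : ∃ m, d = i + 2 + m := ⟨d - i - 2, by omega⟩
      rw [if_pos hid, adjEntry, if_neg (by omega), Finset.prod_Ico_succ_top (by omega),
        Finset.prod_Ico_succ_top (by omega), show i + 2 + m - (i + 1) = m + 1 by omega,
        show i + 2 + m - (i + 1 + 1) = m by omega, show i + 2 + m - i = m + 2 by omega,
        continuantFrom_add_two_left]
      simp only [map_mul, ← hw, hwl]
      ring
    · obtain rfl : d = i + 1 := by omega
      rw [if_neg hid, Nat.sub_self, show i + 1 - i = 1 by omega, continuantFrom_zero,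
        continuantFrom_one]
      simp only [map_mul, ← hw]
      ring

lemma charmatrix_mul_adjEntry (a b c : ℕ → ℝ) (d : ℕ) :
    (tridiag a b c (d + 1)).charmatrix *
        Matrix.of (fun i j : Fin (d + 1) => adjEntry a b c d i j) =
      Matrix.scalar (Fin (d + 1)) (continuant a (fun l => b l * c l) (d + 1)) := by
  ext i j : 2
  rw [charmatrix_tridiag, Matrix.mul_apply]
  simp only [Matrix.of_apply]
  rw [sum_tridiag_mul _ _ _ _ i (fun l => adjEntry a b c d l j),
    adjEntry_row a b c d i j (by omega) (by omega)]
  simp [Matrix.diagonal_apply, Fin.ext_iff]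

/-! ### Spectral polynomials as divided differences -/

/-- `(A - θ_0) ⋯ (A - θ_{k-1})`. -/
def specMat {d : ℕ} (A : Matrix (State d) (State d) ℝ) (θ : ℕ → ℝ) (k : ℕ) :
    Matrix (State d) (State d) ℝ :=
  aeval A (∏ r ∈ Finset.range k, (X - C (θ r)))

lemma specMat_succ {d : ℕ} (A : Matrix (State d) (State d) ℝ) (θ : ℕ → ℝ) (k : ℕ) :
    specMat A θ (k + 1) = specMat A θ k * A - θ k • specMat A θ k := by
  rw [specMat, Finset.prod_range_succ, map_mul, map_sub, aeval_X, aeval_C, mul_sub, ← specMat,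
    Algebra.algebraMap_eq_smul_one, Matrix.mul_smul, Matrix.mul_one]

lemma specMat_succ' {d : ℕ} (A : Matrix (State d) (State d) ℝ) (θ : ℕ → ℝ) (k : ℕ) :
    specMat A θ (k + 1) = A * specMat A θ k - θ k • specMat A θ k := by
  rw [specMat, Finset.prod_range_succ, mul_comm, map_mul, map_sub, aeval_X, aeval_C, sub_mul,
    ← specMat, Algebra.algebraMap_eq_smul_one, Matrix.smul_mul, Matrix.one_mul]

/-- The quotient of `p_k(X) - p_k(A)` by `X - A`, where `p_k = (X - θ_0) ⋯ (X - θ_{k-1})`. -/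
def quotMat {d : ℕ} (A : Matrix (State d) (State d) ℝ) (θ : ℕ → ℝ) :
    ℕ → Matrix (State d) (State d) ℝ[X]
  | 0 => 0
  | k + 1 => (specMat A θ k).map C + (X - C (θ k)) • quotMat A θ k

lemma charmatrix_mul_quotMat {d : ℕ} (A : Matrix (State d) (State d) ℝ) (θ : ℕ → ℝ) (k : ℕ) :
    A.charmatrix * quotMat A θ k =
      Matrix.scalar (State d) (∏ r ∈ Finset.range k, (X - C (θ r))) - (specMat A θ k).map C := by
  induction k with
  | zero => simp [quotMat, specMat]
  | succ k ih =>
    have h1 : (specMat A θ (k + 1)).map (C : ℝ →+* ℝ[X]) =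
        A.map C * (specMat A θ k).map C - C (θ k) • (specMat A θ k).map C := by
      rw [specMat_succ', Matrix.map_sub _ (by simp), Matrix.map_mul]
      congr 1
      ext i j : 2
      simp
    have h2 : A.charmatrix = (X : ℝ[X]) • (1 : Matrix (State d) (State d) ℝ[X]) - A.map C := by
      rw [Matrix.charmatrix, Matrix.scalar_apply, ← Matrix.smul_one_eq_diagonal]
      rfl
    rw [quotMat, Matrix.mul_add, Matrix.mul_smul, ih, h1, h2, Finset.prod_range_succ,
      Matrix.sub_mul, Matrix.smul_mul, Matrix.one_mul]
    simp only [Matrix.scalar_apply, ← Matrix.smul_one_eq_diagonal]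
    rw [smul_sub, smul_smul, sub_smul, mul_comm]
    abel

/-- By Cayley-Hamilton p_{d+1}(A) = 0, so both matrices, multiplied by X - A, give the
characteristic polynomial times the identity. The determinant of X - A is a nonzero polynomial, so X
- A cancels. -/
lemma quotMat_eq_adjEntry (a b c : ℕ → ℝ) (d : ℕ) (θ : ℕ → ℝ)
    (h : (tridiag a b c (d + 1)).charpoly = ∏ r ∈ Finset.range (d + 1), (X - C (θ r)))
    (i j : Fin (d + 1)) :
    quotMat (d := d) (tridiag a b c (d + 1)) θ (d + 1) i j = adjEntry a b c d i j := by
  have h0 : specMat (d := d) (tridiag a b c (d + 1)) θ (d + 1) = 0 := by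
    rw [specMat, ← h, Matrix.aeval_self_charpoly]
  have h1 := charmatrix_mul_quotMat (d := d) (tridiag a b c (d + 1)) θ (d + 1)
  rw [h0, ← h, charpoly_tridiag] at h1
  have h2 := charmatrix_mul_adjEntry a b c d
  have h3 : (tridiag a b c (d + 1)).charmatrix * quotMat (d := d) (tridiag a b c (d + 1)) θ (d + 1)
      = (tridiag a b c (d + 1)).charmatrix *
        Matrix.of (fun i j : Fin (d + 1) => adjEntry a b c d i j) := by
    rw [h2, h1]
    simp
  have hdet : (tridiag a b c (d + 1)).charmatrix.det ≠ 0 := (Matrix.charpoly_monic _).ne_zero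
  have h4 : ∀ M : Matrix (Fin (d + 1)) (Fin (d + 1)) ℝ[X],
      (tridiag a b c (d + 1)).charmatrix.adjugate * ((tridiag a b c (d + 1)).charmatrix * M) =
        (tridiag a b c (d + 1)).charmatrix.det • M := by
    intro M
    rw [← Matrix.mul_assoc, Matrix.adjugate_mul, Matrix.smul_mul, Matrix.one_mul]
  have h5 := congrFun (congrFun ((h4 _).symm.trans
    ((congrArg (fun M => (tridiag a b c (d + 1)).charmatrix.adjugate * M) h3).trans (h4 _))) i) j
  simp only [Matrix.smul_apply, smul_eq_mul] at h5
  exact mul_left_cancel₀ hdet h5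

/-- The matrices p_k(A) are the successive remainders when the adjugate q_{d+1} is divided by X -
θ_d, X - θ_{d-1}, and so on. -/
lemma specMat_tridiag_apply (a b c : ℕ → ℝ) (d : ℕ) (θ : ℕ → ℝ)
    (h : (tridiag a b c (d + 1)).charpoly = ∏ r ∈ Finset.range (d + 1), (X - C (θ r)))
    (i j : Fin (d + 1)) (k m : ℕ) (hk : k + m = d) :
    specMat (d := d) (tridiag a b c (d + 1)) θ k i j =
      divDiff (topList θ k (m + 1)) (adjEntry a b c d i j) := by
  have := divDiff_topList θ (fun k => specMat (d := d) (tridiag a b c (d + 1)) θ k i j)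
    (fun k => quotMat (d := d) (tridiag a b c (d + 1)) θ k i j) (by intro m; simp [quotMat]) k m
  rw [hk] at this
  rw [← quotMat_eq_adjEntry a b c d θ h i j, ← this]

lemma isHermitian_tridiag (a s : ℕ → ℝ) (n : ℕ) : (tridiag a s s n).IsHermitian := by
  ext i j
  simp only [Matrix.conjTranspose_apply, tridiag, Matrix.of_apply, star_trivial]
  rcases lt_trichotomy i.val j.val with h | h | h
  · simp [h.ne, h.ne', show ¬ (j.val + 1 = i.val) by omega]
  · simp [h]
  · simp [h.ne, h.ne', show ¬ (i.val + 1 = j.val) by omega]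

/-- A continuant sees the off-diagonal entries only through the products `w i`, so the matrix may be
replaced by a symmetric one. This holds also when some of the products vanish, where conjugation by
a diagonal matrix would fail. -/
lemma continuant_eq_charpoly (a w : ℕ → ℝ) (hw : ∀ i, 0 ≤ w i) (n : ℕ) :
    continuant a w n = (tridiag a (fun i => √(w i)) (fun i => √(w i)) n).charpoly := by
  rw [charpoly_tridiag]
  congr 1
  ext i
  rw [Real.mul_self_sqrt (hw i)]

lemma coe_topList (θ : ℕ → ℝ) (n : ℕ) : (topList θ 0 n : Multiset ℝ) = (Multiset.range n).map θ := by
  induction n with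
  | zero => rfl
  | succ n ih =>
    rw [topList, zero_add, Multiset.range_succ, Multiset.map_cons, ← ih]
    rfl

lemma pairwise_topList {θ : ℕ → ℝ} (hθ : Monotone θ) (n : ℕ) :
    (topList θ 0 n).Pairwise (· ≥ ·) := by
  have hmem : ∀ n x, x ∈ topList θ 0 n → ∃ k < n, x = θ k := by
    intro n x hx
    have : x ∈ (topList θ 0 n : Multiset ℝ) := hx
    rw [coe_topList] at this
    obtain ⟨k, hk, rfl⟩ := Multiset.mem_map.1 this
    exact ⟨k, Multiset.mem_range.1 hk, rfl⟩
  induction n with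
  | zero => exact List.Pairwise.nil
  | succ n ih =>
    rw [topList, List.pairwise_cons]
    refine ⟨fun x hx => ?_, ih⟩
    obtain ⟨k, hk, rfl⟩ := hmem n x hx
    exact hθ (by omega)

lemma rootPoly_eq_multiset (L : List ℝ) :
    rootPoly L = ((L : Multiset ℝ).map fun a => X - C a).prod := by
  simp [rootPoly]

/-- The roots of the continuants of the two blocks that are left when the rows and columns
`i, …, j` are deleted are dominated by the eigenvalues. -/
lemma exists_dominated_roots (a w : ℕ → ℝ) (hw : ∀ i, 0 ≤ w i) (d : ℕ) (θ : ℕ → ℝ)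
    (hθ : Monotone θ) (h : continuant a w (d + 1) = ∏ r ∈ Finset.range (d + 1), (X - C (θ r)))
    (i j : ℕ) (hij : i ≤ j) (hj : j ≤ d) :
    ∃ L : List ℝ, L.Pairwise (· ≥ ·) ∧ L.length = i + (d - j) ∧
      rootPoly L = continuant a w i * continuantFrom a w (j + 1) (d - j) ∧
      Dominated L (topList θ 0 (d + 1)) := by
  set s : ℕ → ℝ := fun i => √(w i) with hs
  have hA := isHermitian_tridiag a s (d + 1)
  -- The states outside {i, ..., j}: states below i and above j are not neighbours, so the principal
  -- submatrix is block diagonal.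
  let f : Fin i ⊕ Fin (d - j) → Fin (d + 1) :=
    Sum.elim (fun l => ⟨l.val, by omega⟩) (fun l => ⟨j + 1 + l.val, by omega⟩)
  have hf : Function.Injective f := by
    rintro (x | x) (y | y) hxy <;> simp only [f, Sum.elim_inl, Sum.elim_inr, Fin.mk.injEq] at hxy
    · rw [Fin.ext hxy]
    · omega
    · omega
    · rw [show x = y from Fin.ext (by omega)]
  have hB : ((tridiag a s s (d + 1)).submatrix f f).IsHermitian := hA.submatrix f
  have hblock : (tridiag a s s (d + 1)).submatrix f f = Matrix.fromBlocks (tridiag a s s i) 0 0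
      (tridiag (fun l => a (j + 1 + l)) (fun l => s (j + 1 + l)) (fun l => s (j + 1 + l))
        (d - j)) := by
    ext (x | x) (y | y)
    · simp [f, tridiag]
    · have h1 : ¬ (x.val = j + 1 + y.val) := by omega
      have h2 : ¬ (x.val = j + y.val) := by omega
      have h3 : ¬ (j + 1 + y.val + 1 = x.val) := by omega
      simp only [f, tridiag, Matrix.submatrix_apply, Sum.elim_inl, Sum.elim_inr, Matrix.of_apply,
        Matrix.fromBlocks_apply₁₂, Matrix.zero_apply]
      rw [if_neg h1, if_neg (by omega), if_neg h3]
    · simp only [f, tridiag, Matrix.submatrix_apply, Sum.elim_inl, Sum.elim_inr, Matrix.of_apply,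
        Matrix.fromBlocks_apply₂₁, Matrix.zero_apply]
      rw [if_neg (by omega), if_neg (by omega), if_neg (by omega)]
    · simp [f, tridiag, add_assoc]
  have hcharB : ((tridiag a s s (d + 1)).submatrix f f).charpoly =
      continuant a w i * continuantFrom a w (j + 1) (d - j) := by
    rw [hblock, Matrix.charpoly_fromBlocks_zero₁₂, ← continuant_eq_charpoly a w hw i,
      continuantFrom, continuant_eq_charpoly _ _ (fun l => hw (j + 1 + l)) (d - j)]
  refine ⟨(Finset.univ.val.map hB.eigenvalues).sort (· ≥ ·), ?_, ?_, ?_, ?_⟩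
  · exact Multiset.pairwise_sort _ _
  · simp
  · rw [rootPoly_eq_multiset, Multiset.sort_eq, ← hcharB, hB.charpoly_eq]
    simp
  · apply dominated_of_countP_le _ _ (Multiset.pairwise_sort _ _) (pairwise_topList hθ _)
    intro z
    have key := card_filter_eigenvalues_submatrix_le hA f hf hB z
    have hroots : (topList θ 0 (d + 1) : Multiset ℝ) = Finset.univ.val.map hA.eigenvalues := by
      have h1 := hA.roots_charpoly_eq_eigenvalues
      rw [← continuant_eq_charpoly a w hw, h, Polynomial.roots_prod _ _
        (Finset.prod_ne_zero_iff.2 fun r _ => X_sub_C_ne_zero _)] at h1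
      rw [coe_topList]
      simpa [Function.comp_def] using h1
    have c1 : ∀ (l : List ℝ), l.countP (fun a => decide (z < a)) =
        (l : Multiset ℝ).countP (fun a => z < a) := by
      intro l
      rw [Multiset.coe_countP]
    rw [c1, c1, hroots, Multiset.sort_eq, Multiset.countP_map, Multiset.countP_map]
    exact key

/-! ### Nonnegativity of the spectral polynomials, and their zeros -/

/-- The diagonal, upper diagonal and lower diagonal of a matrix, as sequences. -/
def diagSeq {d : ℕ} (A : Matrix (State d) (State d) ℝ) (i : ℕ) : ℝ :=
  if h : i < d + 1 then A ⟨i, h⟩ ⟨i, h⟩ else 0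

/-- The entries `(i, i + 1)`. -/
def upSeq {d : ℕ} (A : Matrix (State d) (State d) ℝ) (i : ℕ) : ℝ :=
  if h : i < d then A ⟨i, by omega⟩ ⟨i + 1, by omega⟩ else 0

/-- The entries `(i + 1, i)`. -/
def downSeq {d : ℕ} (A : Matrix (State d) (State d) ℝ) (i : ℕ) : ℝ :=
  if h : i < d then A ⟨i + 1, by omega⟩ ⟨i, by omega⟩ else 0

/-- Tridiagonal with nonnegative off-diagonal entries. -/
structure IsTridiagNonneg {d : ℕ} (A : Matrix (State d) (State d) ℝ) : Prop where
  nearest : ∀ i j : State d, i.val + 1 < j.val ∨ j.val + 1 < i.val → A i j = 0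
  offDiag_nonneg : ∀ i j : State d, i ≠ j → 0 ≤ A i j

lemma eq_tridiag {d : ℕ} {A : Matrix (State d) (State d) ℝ} (hA : IsTridiagNonneg A) :
    A = tridiag (diagSeq A) (upSeq A) (downSeq A) (d + 1) := by
  ext i j
  simp only [tridiag, Matrix.of_apply, diagSeq, upSeq, downSeq]
  split_ifs with h1 h2 h3 h4 h5 h6
  · congr 1
    exact Fin.ext h1.symm
  · omega
  · congr 1
    exact Fin.ext h3.symm
  · omega
  · congr 1
    exact Fin.ext h5.symm
  · omega
  · exact hA.nearest i j (by omega)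

lemma upSeq_nonneg {d : ℕ} {A : Matrix (State d) (State d) ℝ} (hA : IsTridiagNonneg A) (i : ℕ) :
    0 ≤ upSeq A i := by
  unfold upSeq
  split_ifs with h
  · exact hA.offDiag_nonneg _ _ (by simp)
  · exact le_rfl

lemma downSeq_nonneg {d : ℕ} {A : Matrix (State d) (State d) ℝ} (hA : IsTridiagNonneg A) (i : ℕ) :
    0 ≤ downSeq A i := by
  unfold downSeq
  split_ifs with h
  · exact hA.offDiag_nonneg _ _ (by simp)
  · exact le_rfl

lemma IsTridiagNonneg.transpose {d : ℕ} {A : Matrix (State d) (State d) ℝ}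
    (hA : IsTridiagNonneg A) : IsTridiagNonneg A.transpose :=
  ⟨fun i j h => hA.nearest j i h.symm, fun i j h => hA.offDiag_nonneg j i h.symm⟩

lemma specMat_transpose {d : ℕ} (A : Matrix (State d) (State d) ℝ) (θ : ℕ → ℝ) (k : ℕ) :
    specMat A.transpose θ k = (specMat A θ k).transpose := by
  induction k with
  | zero => simp [specMat]
  | succ k ih => rw [specMat_succ, specMat_succ', ih]; simp

/-- `p_k(A)_{ij}` as a nonnegative multiple of a divided difference, for `i ≤ j`. -/
lemma specMat_apply_eq {d : ℕ} {A : Matrix (State d) (State d) ℝ} (hA : IsTridiagNonneg A)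
    (θ : ℕ → ℝ) (hθ : Monotone θ) (h : A.charpoly = ∏ r ∈ Finset.range (d + 1), (X - C (θ r)))
    (i j : State d) (hij : i ≤ j) :
    ∃ L : List ℝ, L.Pairwise (· ≥ ·) ∧ L.length = i.val + (d - j.val) ∧
      Dominated L (topList θ 0 (d + 1)) ∧
      rootPoly L = continuant (diagSeq A) (fun l => upSeq A l * downSeq A l) i *
        continuantFrom (diagSeq A) (fun l => upSeq A l * downSeq A l) (j + 1) (d - j) ∧
      ∀ k m, k + m = d → specMat A θ k i j =
        (∏ l ∈ Finset.Ico i.val j.val, upSeq A l) * divDiff (topList θ k (m + 1)) (rootPoly L) := by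
  have hw : ∀ l, 0 ≤ upSeq A l * downSeq A l := fun l =>
    mul_nonneg (upSeq_nonneg hA l) (downSeq_nonneg hA l)
  have hAt := eq_tridiag hA
  have hc : continuant (diagSeq A) (fun l => upSeq A l * downSeq A l) (d + 1) =
      ∏ r ∈ Finset.range (d + 1), (X - C (θ r)) := by
    rw [← charpoly_tridiag, ← hAt, h]
  obtain ⟨L, h1, h2, h3, h4⟩ := exists_dominated_roots (diagSeq A) _ hw d θ hθ hc i j hij (by omega)
  refine ⟨L, h1, h2, h4, h3, fun k m hkm => ?_⟩
  have := specMat_tridiag_apply (diagSeq A) (upSeq A) (downSeq A) d θ (by rw [← hAt, h]) i j k m hkm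
  rw [← hAt] at this
  rw [this, adjEntry, if_pos (by exact_mod_cast hij), divDiff_C_mul, h3]

/-- The points θ_d, ..., θ_k form an initial segment of the full decreasing list of eigenvalues. -/
lemma dominated_topList {L : List ℝ} {θ : ℕ → ℝ} {d k m : ℕ} (hkm : k + m = d)
    (h : Dominated L (topList θ 0 (d + 1))) : Dominated L (topList θ k (m + 1)) := by
  rw [← hkm, add_assoc, topList_append] at h
  exact h.of_append

theorem specMat_nonneg {d : ℕ} {A : Matrix (State d) (State d) ℝ} (hA : IsTridiagNonneg A)
    (θ : ℕ → ℝ) (hθ : Monotone θ) (h : A.charpoly = ∏ r ∈ Finset.range (d + 1), (X - C (θ r)))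
    (k : ℕ) (hk : k ≤ d) (i j : State d) : 0 ≤ specMat A θ k i j := by
  wlog hij : i ≤ j generalizing A i j
  · have := this hA.transpose (by rw [Matrix.charpoly_transpose, h]) j i (le_of_not_ge hij)
    rwa [specMat_transpose] at this
  obtain ⟨L, h1, -, h3, -, h4⟩ := specMat_apply_eq hA θ hθ h i j hij
  rw [h4 k (d - k) (by omega)]
  exact mul_nonneg (Finset.prod_nonneg fun l _ => upSeq_nonneg hA l)
    (divDiff_rootPoly_nonneg _ _ h1 (dominated_topList (by omega) h3))

/-- Once an entry of the first row of `p_k(A)` vanishes (on or left of the `k`-th column), it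
stays zero. -/
theorem specMat_succ_eq_zero {d : ℕ} {A : Matrix (State d) (State d) ℝ} (hA : IsTridiagNonneg A)
    (hb : ∀ i : Fin d, 0 < A i.castSucc i.succ)
    (θ : ℕ → ℝ) (hθ : Monotone θ) (h : A.charpoly = ∏ r ∈ Finset.range (d + 1), (X - C (θ r)))
    (k : ℕ) (hk : k < d) (j : State d) (hj : j.val ≤ k) (h0 : specMat A θ k 0 j = 0) :
    specMat A θ (k + 1) 0 j = 0 := by
  obtain ⟨L, h1, h2, h3, -, h4⟩ := specMat_apply_eq hA θ hθ h 0 j (Fin.zero_le _)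
  obtain ⟨m, rfl⟩ : ∃ m, d = k + 1 + m := ⟨d - k - 1, by omega⟩
  rw [h4 k (m + 1) (by omega)] at h0
  rw [h4 (k + 1) m (by omega)]
  have hne : (∏ l ∈ Finset.Ico (0 : State (k + 1 + m)).val j.val, upSeq A l) ≠ 0 := by
    refine Finset.prod_ne_zero_iff.2 fun l hl => ?_
    have hl' : l < k + 1 + m := by
      have := (Finset.mem_Ico.1 hl).2
      omega
    rw [upSeq, dif_pos hl']
    exact (hb ⟨l, hl'⟩).ne'
  have h5 := (mul_eq_zero.1 h0).resolve_left hne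
  have hd := dominated_topList (k := k) (m := m + 1) (by omega) h3
  -- Passing from `k` to `k + 1` deletes the point θ_k, which is the last of the list. The condition
  -- j ≤ k is what gives at least as many roots, d - j, as remaining points, d - k.
  rw [topList_succ_concat] at h5 hd
  rw [divDiff_rootPoly_eq_zero_of_concat _ _ _ h1 hd
    (by rw [topList_length, h2, Fin.val_zero]; omega) h5, mul_zero]

/-- The first row of `p_d(A)` vanishes off the absorbing state. -/
theorem specMat_top_eq_zero {d : ℕ} {A : Matrix (State d) (State d) ℝ} (hA : IsTridiagNonneg A)
    (θ : ℕ → ℝ) (hθ : Monotone θ) (h : A.charpoly = ∏ r ∈ Finset.range (d + 1), (X - C (θ r)))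
    (hlast : ∀ j, A (Fin.last d) j = if j = Fin.last d then θ d else 0)
    (j : State d) (hj : j.val < d) : specMat A θ d 0 j = 0 := by
  obtain ⟨L, -, -, -, h3, h4⟩ := specMat_apply_eq hA θ hθ h 0 j (Fin.zero_le _)
  rw [h4 d 0 (by omega), h3]
  -- For k = d a single point is left and the divided difference is the value at θ_d. For j < d the
  -- trailing block contains the absorbing state, which decouples because the entry (d, d - 1)
  -- vanishes, so θ_d is a root.
  simp only [topList, divDiff, add_zero, eval_mul]
  obtain ⟨m, hm⟩ : ∃ m, d - j.val = m + 1 := ⟨d - j.val - 1, by omega⟩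
  have : (continuantFrom (diagSeq A) (fun l => upSeq A l * downSeq A l) (j + 1) (d - j)).eval
      (θ d) = 0 := by
    have hdd : diagSeq A d = θ d := by
      rw [diagSeq, dif_pos (by omega)]
      have := hlast (Fin.last d)
      rw [if_pos rfl] at this
      exact this
    rw [hm]
    match m, hm with
    | 0, hm =>
      rw [continuantFrom_one, show j.val + 1 = d by omega, hdd]
      simp
    | m + 1, hm =>
      rw [continuantFrom_add_two_right, show j.val + 1 + (m + 1) = d by omega, hdd,
        show j.val + 1 + m = d - 1 by omega]
      have : downSeq A (d - 1) = 0 := by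
        rw [downSeq, dif_pos (by omega)]
        have h1 : (⟨d - 1 + 1, by omega⟩ : State d) = Fin.last d := Fin.ext (by simp; omega)
        rw [h1, hlast, if_neg]
        intro h
        have := congrArg Fin.val h
        simp at this
        omega
      simp [this]
  rw [this, mul_zero, mul_zero]

/-! ### Location of the eigenvalues -/

/-- Diagonal dominance makes the continuants positive. -/
lemma continuant_eval_pos (a b c : ℕ → ℝ) (hb : ∀ i, 0 ≤ b i) (hc : ∀ i, 0 ≤ c i) (x : ℝ)
    (n : ℕ) (h0 : b 0 ≤ x - a 0) (h : ∀ i, i + 1 < n → b (i + 1) + c i ≤ x - a (i + 1))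
    (hpos : ∀ i < n, 0 < b i ∨ (i = 0 ∧ b 0 < x - a 0) ∨
      (0 < i ∧ b i + c (i - 1) < x - a i)) :
    ∀ m ≤ n, 0 < (continuant a (fun l => b l * c l) m).eval x ∧
      (0 < m → b (m - 1) * (continuant a (fun l => b l * c l) (m - 1)).eval x ≤
        (continuant a (fun l => b l * c l) m).eval x) := by
  intro m
  induction m with
  | zero => simp [continuant]
  | succ m ih =>
    intro hm
    obtain ⟨i1, i2⟩ := ih (by omega)
    rw [Nat.add_sub_cancel]
    set f := continuant a (fun l => b l * c l) with hf
    match m with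
    | 0 =>
      have e : (f (0 + 1)).eval x = x - a 0 := by simp [hf, continuant]
      have e0 : (f 0).eval x = 1 := by simp [hf, continuant]
      rw [e, e0, mul_one]
      refine ⟨?_, fun _ => h0⟩
      rcases hpos 0 (by omega) with h1 | ⟨-, h1⟩ | ⟨h2, -⟩
      · linarith
      · linarith [hb 0]
      · omega
    | k + 1 =>
      have hrec : (f (k + 1 + 1)).eval x =
          (x - a (k + 1)) * (f (k + 1)).eval x - b k * c k * (f k).eval x := by
        simp [hf, continuant]
      -- The second half of the induction hypothesis, b_{m-1} f_{m-1} ≤ f_m at x, bounds the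
      -- subtracted term of the recursion by c_k f_{k+1}. Dominance then leaves at least b_{k+1}
      -- f_{k+1}.
      have hlow := mul_le_mul_of_nonneg_left (i2 (by omega)) (hc k)
      rw [Nat.add_sub_cancel] at hlow
      have hk := mul_le_mul_of_nonneg_right (h k (by omega)) i1.le
      rw [hrec]
      refine ⟨?_, fun _ => by linarith⟩
      rcases hpos (k + 1) (by omega) with h1 | ⟨h2, -⟩ | ⟨-, h1⟩
      · linarith [mul_pos h1 i1]
      · omega
      · rw [Nat.add_sub_cancel] at h1
        linarith [mul_lt_mul_of_pos_right h1 i1, mul_nonneg (hb (k + 1)) i1.le]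

/-! ### Birth-and-death matrices with constant row sums -/

/-- A birth-and-death matrix with row sums `ρ` and absorbing state `d`: kernels are the case
`ρ = 1`, generators the case `ρ = 0`. -/
structure IsBirthDeath {d : ℕ} (A : Matrix (State d) (State d) ℝ) (ρ : ℝ) : Prop
    extends IsTridiagNonneg A where
  row_sum : ∀ i, ∑ j, A i j = ρ
  birth_pos : ∀ i : Fin d, 0 < A i.castSucc i.succ
  absorbing : A (Fin.last d) (Fin.last d) = ρ

lemma IsKernel.isBirthDeath {d : ℕ} {P : Matrix (State d) (State d) ℝ} (h : IsKernel P) :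
    IsBirthDeath P 1 where
  nearest := h.nearest
  offDiag_nonneg i j _ := h.stochastic.1 i j
  row_sum i := Matrix.sum_row_of_mem_rowStochastic h.stochastic i
  birth_pos := h.birth_pos
  absorbing := h.absorbing

lemma IsGenerator.isBirthDeath {d : ℕ} {G : Matrix (State d) (State d) ℝ} (h : IsGenerator G) :
    IsBirthDeath G 0 where
  nearest := h.nearest
  offDiag_nonneg := h.offDiag_nonneg
  row_sum := h.row_sum
  birth_pos := h.birth_pos
  absorbing := h.absorbing

lemma IsBirthDeath.last_row {d : ℕ} {A : Matrix (State d) (State d) ℝ} {ρ : ℝ}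
    (hA : IsBirthDeath A ρ) (j : State d) :
    A (Fin.last d) j = if j = Fin.last d then ρ else 0 := by
  split_ifs with h
  · rw [h, hA.absorbing]
  · have h1 := hA.row_sum (Fin.last d)
    rw [← Finset.add_sum_erase _ _ (Finset.mem_univ (Fin.last d)), hA.absorbing] at h1
    have h2 : ∑ x ∈ Finset.univ.erase (Fin.last d), A (Fin.last d) x = 0 := by linarith
    exact (Finset.sum_eq_zero_iff_of_nonneg fun x hx => hA.offDiag_nonneg _ _
      (Finset.ne_of_mem_erase hx).symm).1 h2 j (Finset.mem_erase.2 ⟨h, Finset.mem_univ _⟩)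

lemma IsBirthDeath.seq_row_sum {d : ℕ} {A : Matrix (State d) (State d) ℝ} {ρ : ℝ}
    (hA : IsBirthDeath A ρ) (i : ℕ) (hi : i ≤ d) :
    diagSeq A i + upSeq A i + (if 0 < i then downSeq A (i - 1) else 0) = ρ := by
  have h := sum_tridiag_mul (diagSeq A) (upSeq A) (downSeq A) (d + 1) ⟨i, by omega⟩ (fun _ => 1)
  rw [← eq_tridiag hA.toIsTridiagNonneg] at h
  simp only [mul_one] at h
  rw [hA.row_sum] at h
  rw [h]
  congr 2
  split_ifs with h1
  · rfl
  · rw [upSeq, dif_neg (by omega)]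

/-- A list of eigenvalues, continued by its last value. -/
def natExt {d : ℕ} (θ : State d → ℝ) (n : ℕ) : ℝ := θ ⟨min n d, by omega⟩

lemma natExt_monotone {d : ℕ} {θ : State d → ℝ} (h : Monotone θ) : Monotone (natExt θ) := by
  intro m n hmn
  apply h
  simp only [Fin.mk_le_mk]
  omega

lemma natExt_val {d : ℕ} (θ : State d → ℝ) (i : State d) : natExt θ i.val = θ i := by
  unfold natExt
  congr 1
  ext
  simp only
  omega

lemma natExt_last {d : ℕ} (θ : State d → ℝ) : natExt θ d = θ (Fin.last d) := by
  rw [← natExt_val θ (Fin.last d), Fin.val_last]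

lemma prod_univ_eq_range {d : ℕ} {M : Type*} [CommMonoid M] (θ : State d → ℝ) (g : ℝ → M) :
    ∏ i, g (θ i) = ∏ r ∈ Finset.range (d + 1), g (natExt θ r) := by
  rw [← Fin.prod_univ_eq_prod_range]
  exact Finset.prod_congr rfl fun i _ => by rw [natExt_val]

lemma prod_Iio_eq_range {d : ℕ} {M : Type*} [CommMonoid M] (θ : State d → ℝ) (g : ℝ → M)
    (k : State d) : ∏ r ∈ Finset.Iio k, g (θ r) = ∏ r ∈ Finset.range k, g (natExt θ r) := by
  rw [← Nat.Iio_eq_range, ← Fin.map_valEmbedding_Iio, Finset.prod_map]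
  exact Finset.prod_congr rfl fun i _ => by rw [Fin.valEmbedding_apply, natExt_val]

lemma HasEigenvalues.range {d : ℕ} {A : Matrix (State d) (State d) ℝ} {θ : State d → ℝ}
    (h : HasEigenvalues A θ) :
    A.charpoly = ∏ r ∈ Finset.range (d + 1), (X - C (natExt θ r)) := by
  rw [h, prod_univ_eq_range θ (fun x => X - C x)]

lemma IsTridiagNonneg.charpoly_eq {d : ℕ} {A : Matrix (State d) (State d) ℝ}
    (hA : IsTridiagNonneg A) :
    A.charpoly = continuant (diagSeq A) (fun l => upSeq A l * downSeq A l) (d + 1) := by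
  rw [← charpoly_tridiag, ← eq_tridiag hA]

/-- The symmetrized matrix has the same characteristic polynomial, and its eigenvalues are real. -/
theorem IsTridiagNonneg.exists_eigenvalues {d : ℕ} {A : Matrix (State d) (State d) ℝ}
    (hA : IsTridiagNonneg A) : ∃ θ : State d → ℝ, Monotone θ ∧ HasEigenvalues A θ := by
  have hH := isHermitian_tridiag (diagSeq A) (fun i => √(upSeq A i * downSeq A i)) (d + 1)
  refine ⟨hH.eigenvalues ∘ Tuple.sort hH.eigenvalues, Tuple.monotone_sort _, ?_⟩
  rw [HasEigenvalues, hA.charpoly_eq, continuant_eq_charpoly _ _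
    (fun l => mul_nonneg (upSeq_nonneg hA l) (downSeq_nonneg hA l)), hH.charpoly_eq]
  exact (Equiv.prod_comp (Tuple.sort hH.eigenvalues) fun i => X - C (hH.eigenvalues i)).symm

/-- The absorbing row has no off-diagonal entries, so the last coupling product vanishes and d
splits off as a factor. -/
lemma IsBirthDeath.continuant_succ {d : ℕ} {A : Matrix (State d) (State d) ℝ} {ρ : ℝ}
    (hA : IsBirthDeath A ρ) :
    continuant (diagSeq A) (fun l => upSeq A l * downSeq A l) (d + 1) =
      continuant (diagSeq A) (fun l => upSeq A l * downSeq A l) d * (X - C ρ) := by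
  have hd : diagSeq A d = ρ := by
    rw [diagSeq, dif_pos (by omega)]
    exact hA.absorbing
  match d, A, hA, hd with
  | 0, A, hA, hd => simp [continuant, hd]
  | d + 1, A, hA, hd =>
    have h : downSeq A d = 0 := by
      rw [downSeq, dif_pos (by omega)]
      have := hA.last_row ⟨d, by omega⟩
      rw [if_neg (by simp [Fin.ext_iff])] at this
      exact this
    simp [continuant, hd, h, mul_comm]

/-- For ρ ≤ x the row sums give weak diagonal dominance of the block of transient states; positivity
of the birth rates makes the conclusion strict, even at x = ρ. -/
lemma IsBirthDeath.continuant_pos {d : ℕ} {A : Matrix (State d) (State d) ℝ} {ρ : ℝ}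
    (hA : IsBirthDeath A ρ) (x : ℝ) (hx : ρ ≤ x) :
    0 < (continuant (diagSeq A) (fun l => upSeq A l * downSeq A l) d).eval x := by
  have h0 := hA.seq_row_sum 0 (Nat.zero_le _)
  simp only [lt_irrefl, if_false, add_zero] at h0
  refine (continuant_eval_pos (diagSeq A) (upSeq A) (downSeq A)
    (upSeq_nonneg hA.toIsTridiagNonneg) (downSeq_nonneg hA.toIsTridiagNonneg) x d (by linarith)
    (fun i hi => ?_) (fun i hi => Or.inl ?_) d le_rfl).1
  · have h := hA.seq_row_sum (i + 1) (by omega)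
    simp only [Nat.zero_lt_succ, if_true, Nat.add_sub_cancel] at h
    linarith
  · rw [upSeq, dif_pos hi]
    exact hA.birth_pos ⟨i, hi⟩

/-- The characteristic polynomial is X - ρ times a factor without roots in [ρ, ∞). Hence ρ is an
eigenvalue and none is larger. -/
theorem IsBirthDeath.eigenvalue_last {d : ℕ} {A : Matrix (State d) (State d) ℝ} {ρ : ℝ}
    (hA : IsBirthDeath A ρ) {θ : State d → ℝ} (hm : Monotone θ) (h : HasEigenvalues A θ) :
    θ (Fin.last d) = ρ := by
  have hc := hA.charpoly_eq
  rw [hA.continuant_succ] at hc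
  have key : ∀ x, ∏ i, (x - θ i) =
      (continuant (diagSeq A) (fun l => upSeq A l * downSeq A l) d).eval x * (x - ρ) := by
    intro x
    rw [h] at hc
    have := congrArg (eval x) hc
    simpa [eval_prod] using this
  have h1 := key ρ
  rw [sub_self, mul_zero, Finset.prod_eq_zero_iff] at h1
  obtain ⟨i, -, hi⟩ := h1
  have h2 : ρ ≤ θ (Fin.last d) := by
    have := hm (Fin.le_last i)
    linarith
  have h3 := key (θ (Fin.last d))
  rw [Finset.prod_eq_zero (Finset.mem_univ (Fin.last d)) (sub_self _)] at h3
  rcases mul_eq_zero.1 h3.symm with h4 | h4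
  · exact absurd h4 (hA.continuant_pos _ h2).ne'
  · linarith

/-- Cancelling one factor X - ρ leaves θ_0, ..., θ_{d-1} as roots of a continuant that is positive
on [ρ, ∞); so ρ is a simple eigenvalue. -/
theorem IsBirthDeath.eigenvalue_lt {d : ℕ} {A : Matrix (State d) (State d) ℝ} {ρ : ℝ}
    (hA : IsBirthDeath A ρ) {θ : State d → ℝ} (hm : Monotone θ) (h : HasEigenvalues A θ)
    (i : State d) (hi : i.val < d) : θ i < ρ := by
  have hc := hA.charpoly_eq
  rw [hA.continuant_succ, h.range, Finset.prod_range_succ, natExt_last, hA.eigenvalue_last hm h] at hc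
  have h1 := mul_right_cancel₀ (X_sub_C_ne_zero ρ) hc
  by_contra! hge
  have h2 := hA.continuant_pos _ hge
  rw [← h1, eval_prod, Finset.prod_eq_zero (Finset.mem_range.2 hi)] at h2
  · exact lt_irrefl _ h2
  · simp [natExt_val]

lemma continuant_neg (a w : ℕ → ℝ) (x : ℝ) (n : ℕ) :
    (continuant (fun i => -a i) w n).eval (-x) = (-1) ^ n * (continuant a w n).eval x := by
  induction n using Nat.strong_induction_on with
  | _ n ih =>
    match n with
    | 0 => simp [continuant]
    | 1 => simp [continuant]; ring
    | n + 2 =>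
      simp only [continuant, eval_sub, eval_mul, eval_X, eval_C, ih (n + 1) (by omega),
        ih n (by omega)]
      ring

/-- Diagonal entries of at least 1/2 dominate the rest of their row. If θ_i < 0, then -P is strictly
dominated at the point -θ_i, and the characteristic polynomial cannot vanish at θ_i. -/
theorem IsKernel.eigenvalue_nonneg {d : ℕ} {P : Matrix (State d) (State d) ℝ} (hP : IsKernel P)
    (hhalf : ∀ i, 1 / 2 ≤ P i i) {θ : State d → ℝ} (h : HasEigenvalues P θ) (i : State d) :
    0 ≤ θ i := by
  have hA := hP.isBirthDeath
  by_contra! hlt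
  have hb := upSeq_nonneg hA.toIsTridiagNonneg
  have hc := downSeq_nonneg hA.toIsTridiagNonneg
  have hdiag : ∀ k ≤ d, 1 / 2 ≤ diagSeq P k := by
    intro k hk
    rw [diagSeq, dif_pos (by omega)]
    exact hhalf _
  have hd0 := hdiag 0 (Nat.zero_le _)
  have h0 := hA.seq_row_sum 0 (Nat.zero_le _)
  simp only [lt_irrefl, if_false, add_zero] at h0
  have hpos := (continuant_eval_pos (fun k => -diagSeq P k) (upSeq P) (downSeq P) hb hc (-θ i)
    (d + 1) (by linarith) (fun k hk => ?_) (fun k hk => ?_) (d + 1) le_rfl).1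
  · rw [continuant_neg] at hpos
    have hz : (continuant (diagSeq P) (fun l => upSeq P l * downSeq P l) (d + 1)).eval (θ i)
        = 0 := by
      rw [← hA.charpoly_eq, h, eval_prod]
      exact Finset.prod_eq_zero (Finset.mem_univ i) (by simp)
    rw [hz, mul_zero] at hpos
    exact lt_irrefl _ hpos
  · have h1 := hA.seq_row_sum (k + 1) (by omega)
    simp only [Nat.zero_lt_succ, if_true, Nat.add_sub_cancel] at h1
    linarith [hdiag (k + 1) (by omega)]
  · right
    rcases Nat.eq_zero_or_pos k with rfl | hk0
    · exact Or.inl ⟨rfl, by linarith⟩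
    · refine Or.inr ⟨hk0, ?_⟩
      have h1 := hA.seq_row_sum k (by omega)
      rw [if_pos hk0] at h1
      linarith [hdiag k (by omega)]

/-! ### The link and the spectral matrix -/

/-- The link: first rows of the normalized spectral polynomials. -/
def genLink {d : ℕ} (A : Matrix (State d) (State d) ℝ) (ρ : ℝ) (θ : State d → ℝ) :
    Matrix (State d) (State d) ℝ :=
  Matrix.of fun i j => (∏ r ∈ Finset.range i, (ρ - natExt θ r))⁻¹ * specMat A (natExt θ) i 0 j

/-- The pure-birth matrix with diagonal `θ` and row sums `ρ`. -/
def genSpectral {d : ℕ} (ρ : ℝ) (θ : State d → ℝ) : Matrix (State d) (State d) ℝ :=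
  Matrix.of fun i j => if j = i then θ i else if j.val = i.val + 1 then ρ - θ i else 0

lemma specQ_eq {d : ℕ} (P : Matrix (State d) (State d) ℝ) (θ : State d → ℝ) (k : State d) :
    specQ P θ k =
      (∏ r ∈ Finset.range k, (1 - natExt θ r))⁻¹ • specMat P (natExt θ) k := by
  rw [specQ, prod_Iio_eq_range θ (fun x => 1 - x), prod_Iio_eq_range θ (fun x => X - C x), specMat]

lemma link_eq {d : ℕ} (P : Matrix (State d) (State d) ℝ) (θ : State d → ℝ) :
    link P θ = genLink P 1 θ := by
  ext i j
  simp [link, genLink, specQ_eq]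

lemma spectralKernel_eq {d : ℕ} (θ : State d → ℝ) : spectralKernel θ = genSpectral 1 θ := rfl

lemma natExt_neg {d : ℕ} (ν : State d → ℝ) (r : ℕ) :
    natExt (fun i => -ν i) r = -natExt ν r := rfl

lemma specPolyGen_eq {d : ℕ} (G : Matrix (State d) (State d) ℝ) (ν : State d → ℝ) (k : State d) :
    specPolyGen G ν k = specMat G (natExt fun i => -ν i) k := by
  rw [specPolyGen, prod_Iio_eq_range ν (fun x => X + C x), specMat]
  simp [natExt_neg]

lemma linkGen_eq {d : ℕ} (G : Matrix (State d) (State d) ℝ) (ν : State d → ℝ) :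
    linkGen G ν = genLink G 0 (fun i => -ν i) := by
  ext i j
  rw [linkGen, Matrix.of_apply, specPolyGen_eq, prod_Iio_eq_range ν (fun x => x)]
  simp [genLink, natExt_neg]

lemma spectralGenerator_eq {d : ℕ} (ν : State d → ℝ) :
    spectralGenerator ν = genSpectral 0 (fun i => -ν i) := by
  ext i j
  simp [spectralGenerator, genSpectral]

lemma HasEigenvalues.neg {d : ℕ} {G : Matrix (State d) (State d) ℝ} {ν : State d → ℝ}
    (h : HasEigenvalues G ν) : HasEigenvalues (-G) (fun i => -ν i) := by
  rw [HasEigenvalues] at h ⊢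
  have key : (-G).charpoly = (-1) ^ (d + 1) * G.charpoly.comp (-X) := by
    have h1 : (-G).charmatrix = -((compRingHom (-X : ℝ[X])).mapMatrix G.charmatrix) := by
      ext i j : 2
      by_cases hij : i = j
      · subst hij
        simp
        ring
      · simp [Matrix.charmatrix_apply_ne _ _ _ hij]
    rw [Matrix.charpoly, h1, Matrix.det_neg, ← RingHom.map_det]
    simp [Matrix.charpoly, coe_compRingHom_apply]
  rw [key, h, prod_comp]
  have : ∀ i, (X - C (-ν i)) = (-1) * (X - C (ν i)).comp (-X) := by
    intro i
    simp
    ring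
  rw [Finset.prod_congr rfl fun i _ => this i, Finset.prod_mul_distrib]
  simp

section Link

variable {d : ℕ} {A : Matrix (State d) (State d) ℝ} {ρ : ℝ} {θ : State d → ℝ}

/-- The constant vector is a right eigenvector of A with eigenvalue ρ, hence of p_k(A) with
eigenvalue p_k(ρ). This explains the normalizing constants of the link. -/
lemma specMat_row_sum (hA : IsBirthDeath A ρ) (θ : ℕ → ℝ) (k : ℕ) (i : State d) :
    ∑ j, specMat A θ k i j = ∏ r ∈ Finset.range k, (ρ - θ r) := by
  induction k with
  | zero => simp [specMat, Matrix.one_apply]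
  | succ k ih =>
    rw [specMat_succ, Finset.prod_range_succ, ← ih]
    simp only [Matrix.sub_apply, Matrix.smul_apply, smul_eq_mul, Finset.sum_sub_distrib,
      ← Finset.mul_sum, Matrix.mul_apply]
    rw [Finset.sum_comm]
    simp only [← Finset.mul_sum, hA.row_sum]
    rw [← Finset.sum_mul]
    ring

lemma specMat_eq_zero_of_lt (hA : IsTridiagNonneg A) (θ : ℕ → ℝ) (k : ℕ) :
    ∀ j : State d, k < j.val → specMat A θ k 0 j = 0 := by
  induction k with
  | zero =>
    intro j hj
    have : (0 : State d) ≠ j := by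
      rintro rfl
      simp at hj
    simp [specMat, this]
  | succ k ih =>
    intro j hj
    rw [specMat_succ, Matrix.sub_apply, Matrix.smul_apply, ih j (by omega), Matrix.mul_apply,
      smul_zero, sub_zero]
    refine Finset.sum_eq_zero fun l _ => ?_
    by_cases hl : k < l.val
    · rw [ih l hl, zero_mul]
    · rw [hA.nearest l j (by omega), mul_zero]

lemma prod_gap_pos (hA : IsBirthDeath A ρ) (hm : Monotone θ) (h : HasEigenvalues A θ) (k : ℕ)
    (hk : k ≤ d) : 0 < ∏ r ∈ Finset.range k, (ρ - natExt θ r) := by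
  refine Finset.prod_pos fun r hr => ?_
  have hr' : r < d := lt_of_lt_of_le (Finset.mem_range.1 hr) hk
  have := hA.eigenvalue_lt hm h ⟨r, by omega⟩ hr'
  rw [← natExt_val θ] at this
  exact sub_pos.2 this

theorem normalized_specMat_stochastic (hA : IsBirthDeath A ρ) (hm : Monotone θ)
    (h : HasEigenvalues A θ) (k : ℕ) (hk : k ≤ d) :
    (∏ r ∈ Finset.range k, (ρ - natExt θ r))⁻¹ • specMat A (natExt θ) k ∈
      Matrix.rowStochastic ℝ (State d) := by
  have hp := prod_gap_pos hA hm h k hk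
  rw [Matrix.mem_rowStochastic_iff_sum]
  refine ⟨fun i j => ?_, fun i => ?_⟩
  · exact mul_nonneg (inv_nonneg.2 hp.le)
      (specMat_nonneg hA.toIsTridiagNonneg _ (natExt_monotone hm) h.range k hk i j)
  · simp only [Matrix.smul_apply, smul_eq_mul, ← Finset.mul_sum]
    rw [specMat_row_sum hA, inv_mul_cancel₀ hp.ne']

theorem genLink_stochastic (hA : IsBirthDeath A ρ) (hm : Monotone θ) (h : HasEigenvalues A θ) :
    genLink A ρ θ ∈ Matrix.rowStochastic ℝ (State d) := by
  rw [Matrix.mem_rowStochastic_iff_sum]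
  have hk : ∀ i : State d, i.val ≤ d := fun i => by omega
  exact ⟨fun i j => (normalized_specMat_stochastic hA hm h i (hk i)).1 0 j,
    fun i => Matrix.sum_row_of_mem_rowStochastic (normalized_specMat_stochastic hA hm h i (hk i)) 0⟩

theorem genLink_triangular (hA : IsBirthDeath A ρ) (i j : State d) (hij : i < j) :
    genLink A ρ θ i j = 0 := by
  rw [genLink, Matrix.of_apply, specMat_eq_zero_of_lt hA.toIsTridiagNonneg _ _ _ hij, mul_zero]

theorem genLink_last (hA : IsBirthDeath A ρ) (hm : Monotone θ) (h : HasEigenvalues A θ) :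
    genLink A ρ θ (Fin.last d) (Fin.last d) = 1 := by
  have hs := Matrix.sum_row_of_mem_rowStochastic (genLink_stochastic hA hm h) (Fin.last d)
  rw [Finset.sum_eq_single (Fin.last d)] at hs
  · exact hs
  · intro j _ hj
    rw [genLink, Matrix.of_apply, Fin.val_last, specMat_top_eq_zero hA.toIsTridiagNonneg _
      (natExt_monotone hm) h.range, mul_zero]
    · intro j
      rw [natExt_last, hA.eigenvalue_last hm h]
      exact hA.last_row j
    · exact Fin.val_lt_last hj
  · simp

theorem genLink_zero_row (j : State d) : genLink A ρ θ 0 j = if j = 0 then 1 else 0 := by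
  simp [genLink, specMat, Matrix.one_apply, eq_comm]

/-- One formula covers all rows: at d, where `up` is the identity, the coefficient ρ - θ_d is 0. -/
lemma sum_genSpectral_mul (ρ : ℝ) (θ : State d → ℝ) (hlast : θ (Fin.last d) = ρ) (i : State d)
    (v : State d → ℝ) :
    ∑ l, genSpectral ρ θ i l * v l = θ i * v i + (ρ - θ i) * v (up i) := by
  by_cases hi : i.val < d
  · have hne : i ≠ up i := by
      intro h
      have := congrArg Fin.val h
      simp only [up] at this
      omega
    rw [Fintype.sum_eq_add i (up i) hne]
    · have h1 : (up i).val = i.val + 1 := by simp only [up]; omega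
      simp [genSpectral, hne.symm, h1]
    · rintro l ⟨h1, h2⟩
      have : l.val ≠ i.val + 1 := by
        intro h
        apply h2
        ext
        simp only [up]
        omega
      simp [genSpectral, h1, this]
  · have hil : i = Fin.last d := by
      ext
      simp only [Fin.val_last]
      omega
    rw [Finset.sum_eq_single i]
    · simp [genSpectral, hil, hlast]
    · intro l _ hl
      have : l.val ≠ i.val + 1 := by omega
      simp [genSpectral, hl, this]
    · simp

/-- Row i is the first row of p_i(A) A = p_{i+1}(A) + θ_i p_i(A), and consecutive normalizations
differ by the factor ρ - θ_i. At i = d the term p_{d+1}(A) vanishes by Cayley-Hamilton. -/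
theorem genLink_intertwine (hA : IsBirthDeath A ρ) (hm : Monotone θ) (h : HasEigenvalues A θ) :
    genLink A ρ θ * A = genSpectral ρ θ * genLink A ρ θ := by
  ext i j
  rw [Matrix.mul_apply, Matrix.mul_apply, sum_genSpectral_mul ρ θ (hA.eigenvalue_last hm h) i
    (fun l => genLink A ρ θ l j)]
  have hA1 : ∑ l, genLink A ρ θ i l * A l j =
      (∏ r ∈ Finset.range i, (ρ - natExt θ r))⁻¹ * (specMat A (natExt θ) i * A) 0 j := by
    rw [Matrix.mul_apply, Finset.mul_sum]
    exact Finset.sum_congr rfl fun l _ => by rw [genLink, Matrix.of_apply, mul_assoc]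
  have hstep : specMat A (natExt θ) i * A =
      specMat A (natExt θ) (i + 1) + θ i • specMat A (natExt θ) i := by
    rw [specMat_succ, natExt_val]
    abel
  rw [hA1, hstep]
  by_cases hi : i.val < d
  · have h1 : (up i).val = i.val + 1 := by simp only [up]; omega
    have hp : ρ - θ i ≠ 0 := (sub_pos.2 (hA.eigenvalue_lt hm h i hi)).ne'
    simp only [genLink, Matrix.of_apply, h1, Finset.prod_range_succ, natExt_val, Matrix.add_apply,
      Matrix.smul_apply, smul_eq_mul, mul_inv]
    field_simp
    ring
  · have hil : i = Fin.last d := by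
      ext
      simp only [Fin.val_last]
      omega
    have h0 : specMat A (natExt θ) (d + 1) = 0 := by
      rw [specMat, ← h.range, Matrix.aeval_self_charpoly]
    rw [hil, Fin.val_last, h0, hA.eigenvalue_last hm h]
    simp [genLink]
    ring

theorem genSpectral_isBirthDeath (hA : IsBirthDeath A ρ) (hm : Monotone θ)
    (h : HasEigenvalues A θ) : IsBirthDeath (genSpectral ρ θ) ρ := by
  have hl := hA.eigenvalue_last hm h
  refine ⟨⟨?_, ?_⟩, ?_, ?_, ?_⟩
  · intro i j hij
    have h1 : j ≠ i := by rintro rfl; omega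
    have h2 : j.val ≠ i.val + 1 := by omega
    simp [genSpectral, h1, h2]
  · intro i j hij
    simp only [genSpectral, Matrix.of_apply, if_neg hij.symm]
    split_ifs
    · have := hm (Fin.le_last i)
      linarith
    · exact le_rfl
  · intro i
    have := sum_genSpectral_mul ρ θ hl i (fun _ => 1)
    simp only [mul_one] at this
    rw [this]
    ring
  · intro i
    have := hA.eigenvalue_lt hm h i.castSucc (by simp)
    have hne : i.succ ≠ i.castSucc := by simp [Fin.ext_iff]
    simp [genSpectral, hne, this]
  · simp [genSpectral, hl]

theorem genSpectral_hasEigenvalues (ρ : ℝ) (θ : State d → ℝ) :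
    HasEigenvalues (genSpectral ρ θ) θ := by
  have hT : (genSpectral ρ θ).BlockTriangular id := by
    intro i j hij
    have hij' : j < i := hij
    have h1 : j ≠ i := hij'.ne
    have h2 : j.val ≠ i.val + 1 := by
      have : j.val < i.val := hij'
      omega
    simp [genSpectral, h1, h2]
  rw [HasEigenvalues, Matrix.charpoly_of_isUpperTriangular _ hT]
  simp [genSpectral]

/-- On and below the diagonal, a zero of the link persists down its column. -/
theorem genLink_up_eq_zero (hA : IsBirthDeath A ρ) (hm : Monotone θ) (h : HasEigenvalues A θ)
    (i j : State d) (hi : i.val < d) (hji : j ≤ i) (h0 : genLink A ρ θ i j = 0) :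
    genLink A ρ θ (up i) j = 0 := by
  have hp := prod_gap_pos hA hm h i hi.le
  have h1 : specMat A (natExt θ) i 0 j = 0 := by
    rw [genLink, Matrix.of_apply] at h0
    exact (mul_eq_zero.1 h0).resolve_left (inv_ne_zero hp.ne')
  have h2 : (up i).val = i.val + 1 := by simp only [up]; omega
  rw [genLink, Matrix.of_apply, h2, specMat_succ_eq_zero hA.toIsTridiagNonneg hA.birth_pos _
    (natExt_monotone hm) h.range i hi j hji h1, mul_zero]

/-- Stochastic domination from an intertwining with a lower triangular link. -/
theorem tail_sum_le {L M N : Matrix (State d) (State d) ℝ}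
    (hL : L ∈ Matrix.rowStochastic ℝ (State d)) (hL0 : ∀ j, L 0 j = if j = 0 then 1 else 0)
    (hT : ∀ i j, i < j → L i j = 0) (hN : ∀ i j, 0 ≤ N i j) (hLM : L * M = N * L) (j : State d) :
    ∑ i ∈ Finset.Ici j, M 0 i ≤ ∑ i ∈ Finset.Ici j, N 0 i := by
  -- Since row 0 of `L` is the unit mass at 0, the first row of `M` is the first row of `N` pushed
  -- through `L`, which moves mass only downwards.
  have h1 : ∀ i, M 0 i = ∑ k, N 0 k * L k i := by
    intro i
    rw [← Matrix.mul_apply, ← hLM, Matrix.mul_apply]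
    simp [hL0]
  simp only [h1]
  rw [Finset.sum_comm, ← Finset.sum_filter_add_sum_filter_not Finset.univ (fun k => j ≤ k)]
  have h2 : ∑ k ∈ Finset.univ.filter (fun k => ¬ j ≤ k), ∑ i ∈ Finset.Ici j, N 0 k * L k i = 0 := by
    refine Finset.sum_eq_zero fun k hk => Finset.sum_eq_zero fun i hi => ?_
    have hk' := (Finset.mem_filter.1 hk).2
    rw [hT k i (lt_of_lt_of_le (not_le.1 hk') (Finset.mem_Ici.1 hi)), mul_zero]
  rw [h2, add_zero, show Finset.univ.filter (fun k => j ≤ k) = Finset.Ici j by ext; simp]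
  refine Finset.sum_le_sum fun k _ => ?_
  rw [← Finset.mul_sum]
  refine mul_le_of_le_one_right (hN 0 k) ?_
  rw [← Matrix.sum_row_of_mem_rowStochastic hL k]
  exact Finset.sum_le_sum_of_subset_of_nonneg (Finset.subset_univ _) fun _ _ _ => hL.1 k _

end Link

/-! ### Matrix exponentials of generators -/

section Exp

attribute [local instance] Matrix.linftyOpNormedRing Matrix.linftyOpNormedAlgebra

variable {n : Type*} [Fintype n] [DecidableEq n]

lemma hasSum_matrix_exp (A : Matrix n n ℝ) :
    HasSum (fun k : ℕ => ((k.factorial : ℝ)⁻¹) • A ^ k) (NormedSpace.exp A) :=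
  NormedSpace.exp_series_hasSum_exp' (𝕂 := ℝ) A

lemma matrix_exp_intertwine {L A B : Matrix n n ℝ} (h : L * A = B * L) (t : ℝ) :
    L * NormedSpace.exp (t • A) = NormedSpace.exp (t • B) * L := by
  have hpow : ∀ k : ℕ, L * (t • A) ^ k = (t • B) ^ k * L := by
    intro k
    have : SemiconjBy L (t • A) (t • B) := by
      rw [SemiconjBy, Matrix.mul_smul, h, Matrix.smul_mul]
    exact (this.pow_right k).eq
  have h1 := (hasSum_matrix_exp (t • A)).mul_left L
  have h2 := (hasSum_matrix_exp (t • B)).mul_right L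
  refine h1.unique ?_
  convert! h2 using 2 with k
  rw [Matrix.mul_smul, Matrix.smul_mul, hpow]

lemma matrix_exp_nonneg_of_nonneg {A : Matrix n n ℝ} (h : ∀ i j, 0 ≤ A i j) (i j : n) :
    0 ≤ NormedSpace.exp A i j := by
  have hpow : ∀ (k : ℕ) i j, 0 ≤ (A ^ k) i j := by
    intro k
    induction k with
    | zero =>
      intro i j
      rw [pow_zero, Matrix.one_apply]
      split_ifs <;> norm_num
    | succ k ih =>
      intro i j
      rw [pow_succ, Matrix.mul_apply]
      exact Finset.sum_nonneg fun l _ => mul_nonneg (ih i l) (h l j)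
  have h1 : HasSum (fun k : ℕ => (((k.factorial : ℝ)⁻¹) • A ^ k) i j) (NormedSpace.exp A i j) :=
    (hasSum_matrix_exp A).map (Matrix.entryAddMonoidHom ℝ i j)
      ((continuous_apply j).comp (continuous_apply i))
  refine h1.nonneg fun k => ?_
  exact mul_nonneg (by positivity) (hpow k i j)

/-- Uniformization: adding a large multiple of the identity makes the generator entrywise
nonnegative and changes the exponential only by a positive scalar. -/
lemma matrix_exp_nonneg {G : Matrix n n ℝ} (h : ∀ i j, i ≠ j → 0 ≤ G i j) {t : ℝ} (ht : 0 ≤ t)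
    (i j : n) : 0 ≤ NormedSpace.exp (t • G) i j := by
  set c : ℝ := ∑ k, |G k k| with hc
  have hle : ∀ k, -c ≤ G k k := fun k => by
    have h1 := neg_abs_le (G k k)
    have h2 : |G k k| ≤ c := Finset.single_le_sum (f := fun k => |G k k|)
      (fun k _ => abs_nonneg _) (Finset.mem_univ k)
    linarith
  have hsplit : t • G = t • (G + c • (1 : Matrix n n ℝ)) + (-(t * c)) • (1 : Matrix n n ℝ) := by
    rw [smul_add, smul_smul, add_assoc, ← add_smul]
    simp
  rw [hsplit, Matrix.exp_add_of_commute]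
  · have : NormedSpace.exp ((-(t * c)) • (1 : Matrix n n ℝ)) =
        Real.exp (-(t * c)) • (1 : Matrix n n ℝ) := by
      rw [← Algebra.algebraMap_eq_smul_one, ← Algebra.algebraMap_eq_smul_one,
        Real.exp_eq_exp_ℝ]
      exact (NormedSpace.algebraMap_exp_comm (𝕂 := ℝ) (𝔸 := Matrix n n ℝ) (-(t * c))).symm
    rw [this, Matrix.mul_smul, Matrix.mul_one]
    refine mul_nonneg (Real.exp_pos _).le (matrix_exp_nonneg_of_nonneg (fun k l => ?_) i j)
    refine mul_nonneg ht ?_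
    by_cases hkl : k = l
    · subst hkl
      have := hle k
      simp only [Matrix.add_apply, Matrix.smul_apply, Matrix.one_apply_eq, smul_eq_mul, mul_one]
      linarith
    · simpa [hkl] using h k l hkl
  · exact (Commute.one_right _).smul_right _

lemma hasDerivAt_matrix_exp (G : Matrix n n ℝ) (t : ℝ) (i j : n) (M : Matrix n n ℝ) :
    HasDerivAt (fun s : ℝ => (M * NormedSpace.exp (s • G)) i j)
      ((M * G * NormedSpace.exp (t • G)) i j) t := by
  have h := (hasDerivAt_exp_smul_const' (𝕂 := ℝ) G t)
  have h2 := h.const_mul M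
  rw [← mul_assoc] at h2
  let L : Matrix n n ℝ →L[ℝ] ℝ :=
    LinearMap.toContinuousLinearMap (Matrix.entryLinearMap ℝ ℝ i j)
  exact L.hasFDerivAt.comp_hasDerivAt t h2

/-- The all-ones matrix J satisfies G J = J 0, so it intertwines the exponential of tG with the
identity. -/
lemma matrix_exp_row_sum {G : Matrix n n ℝ} (h : ∀ i, ∑ j, G i j = 0) (t : ℝ) (i : n) :
    ∑ j, NormedSpace.exp (t • G) i j = 1 := by
  let J : Matrix n n ℝ := Matrix.of fun _ _ => 1
  have hJ : G * J = J * 0 := by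
    ext i j
    simp [Matrix.mul_apply, J, h]
  have h1 := matrix_exp_intertwine (L := J) (A := 0) (B := G) hJ.symm t
  rw [smul_zero, NormedSpace.exp_zero, Matrix.mul_one] at h1
  have h2 := congrFun (congrFun h1 i) i
  simpa [Matrix.mul_apply, J] using h2.symm

lemma matrix_exp_mem_rowStochastic {G : Matrix n n ℝ} (h1 : ∀ i j, i ≠ j → 0 ≤ G i j)
    (h2 : ∀ i, ∑ j, G i j = 0) {t : ℝ} (ht : 0 ≤ t) :
    NormedSpace.exp (t • G) ∈ Matrix.rowStochastic ℝ n :=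
  Matrix.mem_rowStochastic_iff_sum.2
    ⟨fun i j => matrix_exp_nonneg h1 ht i j, fun i => matrix_exp_row_sum h2 t i⟩

/-- Second-order expansion of a stochastic semigroup. -/
lemma matrix_exp_second_order {G : Matrix n n ℝ} (h1 : ∀ i j, i ≠ j → 0 ≤ G i j)
    (h2 : ∀ i, ∑ j, G i j = 0) :
    ∃ K : ℝ, 0 ≤ K ∧ ∀ (t : ℝ), 0 ≤ t → ∀ i j,
      |NormedSpace.exp (t • G) i j - (1 : Matrix n n ℝ) i j - t * G i j| ≤ K * t ^ 2 := by
  set K : ℝ := ∑ i, ∑ j, |(G * G) i j| with hK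
  have hK0 : 0 ≤ K := Finset.sum_nonneg fun _ _ => Finset.sum_nonneg fun _ _ => abs_nonneg _
  refine ⟨K, hK0, fun t ht i j => ?_⟩
  -- The second derivative G² exp(sG) is bounded uniformly in s because exp(sG) is stochastic; two
  -- applications of the mean value inequality follow.
  have bound : ∀ s : ℝ, 0 ≤ s → |(G * G * NormedSpace.exp (s • G)) i j| ≤ K := by
    intro s hs
    have hst := matrix_exp_mem_rowStochastic h1 h2 hs
    rw [Matrix.mul_apply]
    calc |∑ l, (G * G) i l * NormedSpace.exp (s • G) l j|
        ≤ ∑ l, |(G * G) i l * NormedSpace.exp (s • G) l j| := Finset.abs_sum_le_sum_abs _ _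
      _ ≤ ∑ l, |(G * G) i l| := by
          refine Finset.sum_le_sum fun l _ => ?_
          rw [abs_mul]
          refine mul_le_of_le_one_right (abs_nonneg _) ?_
          rw [abs_of_nonneg (hst.1 l j)]
          exact Matrix.le_one_of_mem_rowStochastic hst
      _ ≤ K := Finset.single_le_sum (f := fun i => ∑ l, |(G * G) i l|)
          (fun _ _ => Finset.sum_nonneg fun _ _ => abs_nonneg _) (Finset.mem_univ i)
  have first : ∀ s : ℝ, 0 ≤ s → |(G * NormedSpace.exp (s • G)) i j - G i j| ≤ K * s := by
    intro s hs
    have := (convex_Icc 0 s).norm_image_sub_le_of_norm_hasDerivWithin_le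
      (f := fun s : ℝ => (G * NormedSpace.exp (s • G)) i j)
      (f' := fun r => (G * G * NormedSpace.exp (r • G)) i j) (C := K)
      (fun r _ => (hasDerivAt_matrix_exp G r i j G).hasDerivWithinAt)
      (fun r hr => bound r hr.1) (Set.left_mem_Icc.2 hs) (Set.right_mem_Icc.2 hs)
    simpa [abs_of_nonneg hs] using this
  have := (convex_Icc 0 t).norm_image_sub_le_of_norm_hasDerivWithin_le
    (f := fun s : ℝ => ((1 : Matrix n n ℝ) * NormedSpace.exp (s • G)) i j - s * G i j)
    (f' := fun r => ((1 : Matrix n n ℝ) * G * NormedSpace.exp (r • G)) i j - 1 * G i j) (C := K * t)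
    (fun r _ => ((hasDerivAt_matrix_exp G r i j 1).sub
      ((hasDerivAt_id r).mul_const _)).hasDerivWithinAt)
    (fun r hr => by
      rw [one_mul, one_mul]
      exact (first r hr.1).trans (mul_le_mul_of_nonneg_left hr.2 hK0))
    (Set.left_mem_Icc.2 ht) (Set.right_mem_Icc.2 ht)
  simp only [one_mul, zero_smul, NormedSpace.exp_zero, zero_mul, sub_zero, Real.norm_eq_abs,
    abs_of_nonneg ht] at this
  calc _ = |NormedSpace.exp (t • G) i j - t * G i j - (1 : Matrix n n ℝ) i j| := by
        congr 1; ring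
    _ ≤ K * t * t := this
    _ = K * t ^ 2 := by ring

lemma matrix_exp_add (G : Matrix n n ℝ) (s t : ℝ) :
    NormedSpace.exp ((s + t) • G) = NormedSpace.exp (s • G) * NormedSpace.exp (t • G) := by
  rw [add_smul, Matrix.exp_add_of_commute]
  exact ((Commute.refl G).smul_left s).smul_right t

end Exp

/-! ### Finite-dimensional distributions -/

/-- Multiplicative functionals of a chain: the Markov property for functions of finitely many
values. -/
lemma integral_markov_step {Ω : Type*} [MeasurableSpace Ω] {d : ℕ} (μ : Measure Ω)
    [IsProbabilityMeasure μ] (Y : ℕ → Ω → State d) (hY : ∀ k, Measurable (Y k))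
    (P : ℕ → Matrix (State d) (State d) ℝ)
    (fdd : ∀ (n : ℕ) (x : ℕ → State d), μ.real {ω | ∀ i ≤ n, Y i ω = x i} =
      (if x 0 = 0 then 1 else 0) * ∏ i ∈ Finset.range n, P i (x i) (x (i + 1)))
    (F : (ℕ → State d) → ℝ) (k : ℕ) (hF : ∀ x y : ℕ → State d, (∀ i ≤ k, x i = y i) → F x = F y)
    (x y : State d) :
    ∫ ω, (if Y k ω = x ∧ Y (k + 1) ω = y then F (fun i => Y i ω) else 0) ∂μ =
      (∫ ω, (if Y k ω = x then F (fun i => Y i ω) else 0) ∂μ) * P k x y := by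
  classical
  -- The events are decomposed by the word of values up to time k. Continuing the word by the
  -- constant y makes it also describe the required value at time k + 1.
  let ext : (Fin (k + 1) → State d) → ℕ → State d := fun w i =>
    if h : i ≤ k then w ⟨i, by omega⟩ else y
  have hms : ∀ (n : ℕ) (z : ℕ → State d), MeasurableSet {ω | ∀ i ≤ n, Y i ω = z i} := by
    intro n z
    simp only [Set.ofPred_forall]
    exact MeasurableSet.iInter fun i => MeasurableSet.iInter fun _ =>
      hY i (measurableSet_singleton _)
  have hiff : ∀ ω w, (∀ i ≤ k, Y i ω = ext w i) ↔ w = fun i : Fin (k + 1) => Y i ω := by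
    intro ω w
    constructor
    · intro h
      ext1 i
      have := h i (by omega)
      simp only [ext, dif_pos (show i.val ≤ k by omega)] at this
      exact this.symm
    · rintro rfl i hi
      simp [ext, hi]
  have hFext : ∀ ω w, (∀ i ≤ k, Y i ω = ext w i) → F (fun i => Y i ω) = F (ext w) :=
    fun ω w h => hF _ _ h
  have e1 : ∀ ω, (if Y k ω = x then F (fun i => Y i ω) else 0) =
      ∑ w, (if w (Fin.last k) = x then F (ext w) else 0) *
        Set.indicator {ω | ∀ i ≤ k, Y i ω = ext w i} (fun _ => (1 : ℝ)) ω := by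
    intro ω
    rw [Finset.sum_eq_single (fun i : Fin (k + 1) => Y i ω)]
    · have h := (hiff ω _).2 rfl
      rw [Set.indicator_of_mem (by exact h), mul_one, hFext ω (fun i : Fin (k + 1) => Y i ω) h]
      simp
    · intro w _ hw
      rw [Set.indicator_of_notMem, mul_zero]
      exact fun h => hw ((hiff ω w).1 h)
    · simp
  have e2 : ∀ ω, (if Y k ω = x ∧ Y (k + 1) ω = y then F (fun i => Y i ω) else 0) =
      ∑ w, (if w (Fin.last k) = x then F (ext w) else 0) *
        Set.indicator {ω | ∀ i ≤ k + 1, Y i ω = ext w i} (fun _ => (1 : ℝ)) ω := by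
    intro ω
    rw [Finset.sum_eq_single (fun i : Fin (k + 1) => Y i ω)]
    · have h := (hiff ω _).2 rfl
      by_cases hy : Y (k + 1) ω = y
      · rw [Set.indicator_of_mem, mul_one, hFext ω (fun i : Fin (k + 1) => Y i ω) h]
        · simp [hy]
        · intro i hi
          rcases Nat.lt_or_ge k i with h1 | h1
          · obtain rfl : i = k + 1 := by omega
            simp [ext, hy]
          · exact h i h1
      · rw [Set.indicator_of_notMem, mul_zero, if_neg (by tauto)]
        intro h'
        have := h' (k + 1) le_rfl
        simp [ext] at this
        exact hy this
    · intro w _ hw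
      rw [Set.indicator_of_notMem, mul_zero]
      exact fun h => hw ((hiff ω w).1 fun i hi => h i (by omega))
    · simp
  have hintegrable : ∀ (n : ℕ) (z : ℕ → State d) (c : ℝ), Integrable (fun ω => c *
      Set.indicator {ω | ∀ i ≤ n, Y i ω = z i} (fun _ => (1 : ℝ)) ω) μ := fun n z c =>
    ((integrable_const (1 : ℝ)).indicator (hms n z)).const_mul c
  simp only [e1, e2]
  rw [integral_finsetSum _ fun w _ => hintegrable _ _ _, integral_finsetSum _ fun w _ => hintegrable _ _ _,
    Finset.sum_mul]
  refine Finset.sum_congr rfl fun w _ => ?_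
  rw [integral_const_mul, integral_const_mul, integral_indicator_const _ (hms _ _),
    integral_indicator_const _ (hms _ _), fdd, fdd, Finset.prod_range_succ]
  by_cases hw : w (Fin.last k) = x
  · have h1 : ext w k = x := by
      rw [← hw]
      simp [ext]
      rfl
    have h2 : ext w (k + 1) = y := by simp [ext]
    rw [h1, h2]
    simp only [smul_eq_mul]
    ring
  · simp [hw]

/-- A finite set of times, as an increasing sequence of times that starts at the bottom. -/
lemma exists_time_sequence {ι : Type*} [LinearOrder ι] [OrderBot ι] (S : Finset ι) (T : ι)
    (hT : ∀ s ∈ S, s ≤ T) :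
    ∃ (n : ℕ) (t : ℕ → ι), Monotone t ∧ t 0 = ⊥ ∧ t n = T ∧ (∀ i, t i ≤ T) ∧
      ∀ s ∈ S, ∃ i : Fin (n + 1), t i = s := by
  set S' := insert ⊥ (insert T S) with hS'
  have hne : S'.Nonempty := ⟨⊥, by simp [hS']⟩
  have hcard : 0 < S'.card := Finset.card_pos.2 hne
  let e := S'.orderEmbOfFin rfl
  have hmem : ∀ i, e i ∈ S' := fun i => Finset.orderEmbOfFin_mem _ _ _
  have hle : ∀ s ∈ S', s ≤ T := by
    intro s hs
    simp only [hS', Finset.mem_insert] at hs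
    rcases hs with rfl | rfl | hs
    · exact bot_le
    · exact le_rfl
    · exact hT s hs
  have hsurj : ∀ s ∈ S', ∃ i, e i = s := by
    intro s hs
    have : s ∈ Set.range e := by
      rw [Finset.range_orderEmbOfFin]
      exact hs
    exact this
  let t : ℕ → ι := fun i => e ⟨min i (S'.card - 1), by omega⟩
  have htmono : Monotone t := by
    intro i j hij
    apply e.monotone
    simp only [Fin.mk_le_mk]
    omega
  have hts : ∀ s ∈ S', ∃ i : Fin (S'.card - 1 + 1), t i = s := by
    intro s hs
    obtain ⟨i, rfl⟩ := hsurj s hs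
    refine ⟨⟨i.val, by omega⟩, ?_⟩
    simp only [t]
    congr 1
    ext
    simp only
    omega
  refine ⟨S'.card - 1, t, htmono, ?_, ?_, fun i => hle _ (hmem _),
    fun s hs => hts s (by simp [hS', hs])⟩
  · obtain ⟨i, hi⟩ := hts ⊥ (by simp [hS'])
    exact le_bot_iff.1 (hi ▸ htmono (Nat.zero_le i))
  · obtain ⟨i, hi⟩ := hts T (by simp [hS'])
    refine le_antisymm (hle _ (hmem _)) ?_
    rw [← hi]
    exact htmono (by omega)

lemma preimage_singleton_eq_fdd {Ω : Type*} {d : ℕ} (Z : ℕ → Ω → State d) (n : ℕ)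
    (w : Fin (n + 1) → State d) :
    (fun ω (i : Fin (n + 1)) => Z i ω) ⁻¹' {w} =
      {ω | ∀ i ≤ n, Z i ω = w ⟨min i n, by omega⟩} := by
  ext ω
  simp only [Set.mem_preimage, Set.mem_singleton_iff, Set.mem_ofPred_eq, funext_iff]
  constructor
  · intro h' i hi
    have := h' ⟨i, by omega⟩
    simp only [this]
    congr 1
    ext
    simp only
    omega
  · intro h' i
    have := h' i (by omega)
    rw [this]
    congr 1
    ext
    simp only
    omega

/-- The `σ`-algebra of the past of a process. -/
abbrev pastSigma {Ω : Type*} {d : ℕ} {ι : Type*} [LE ι] (X : ι → Ω → State d) (T : ι) :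
    MeasurableSpace Ω :=
  ⨆ s : ι, ⨆ _ : s ≤ T, MeasurableSpace.comap (X s) inferInstance

/-- Two finite measures that agree on finite cylinders agree on the past. -/
lemma measure_eq_on_past {Ω : Type*} [mΩ : MeasurableSpace Ω] {d : ℕ} {ι : Type*}
    [LinearOrder ι] [OrderBot ι] (μ₁ μ₂ : Measure Ω) [IsFiniteMeasure μ₁]
    (Xh : ι → Ω → State d) (hXh : ∀ t, Measurable (Xh t)) (T : ι)
    (h : ∀ (n : ℕ) (t : ℕ → ι) (x : ℕ → State d), Monotone t → t 0 = ⊥ → t n = T →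
      μ₁ {ω | ∀ i ≤ n, Xh (t i) ω = x i} = μ₂ {ω | ∀ i ≤ n, Xh (t i) ω = x i})
    (A : Set Ω) (hA : MeasurableSet[pastSigma Xh T] A) : μ₁ A = μ₂ A := by
  have hmeas : ∀ (n : ℕ) (t : ℕ → ι), Measurable fun ω (i : Fin (n + 1)) => Xh (t i) ω :=
    fun n t => measurable_pi_lambda _ fun i => hXh _
  have key : ∀ (n : ℕ) (t : ℕ → ι), Monotone t → t 0 = ⊥ → t n = T →
      μ₁.map (fun ω (i : Fin (n + 1)) => Xh (t i) ω) =
        μ₂.map (fun ω (i : Fin (n + 1)) => Xh (t i) ω) := by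
    intro n t ht ht0 htn
    refine Measure.ext_of_singleton fun w => ?_
    rw [Measure.map_apply (hmeas n t) (measurableSet_singleton w),
      Measure.map_apply (hmeas n t) (measurableSet_singleton w),
      preimage_singleton_eq_fdd (fun i => Xh (t i)) n w]
    exact h n t _ ht ht0 htn
  -- Finite intersections of events at single times up to T form a π-system that generates the past,
  -- and each of them is an event about some vector covered by `key`.
  have hgen := (generateFrom_piiUnionInter_measurableSet
    (fun s : ι => MeasurableSpace.comap (Xh s) inferInstance) (Set.Iic T)).symm
  have hpi := isPiSystem_piiUnionInter
    (fun s : ι => {u | MeasurableSet[MeasurableSpace.comap (Xh s) inferInstance] u})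
    (fun s => @MeasurableSpace.isPiSystem_measurableSet _
      (MeasurableSpace.comap (Xh s) inferInstance)) (Set.Iic T)
  have hcyl : ∀ A ∈ piiUnionInter
      (fun s : ι => {u | MeasurableSet[MeasurableSpace.comap (Xh s) inferInstance] u}) (Set.Iic T),
      μ₁ A = μ₂ A := by
    rintro A ⟨S, hS, f, hf, rfl⟩
    obtain ⟨n, t, ht, ht0, htn, -, hts⟩ := exists_time_sequence S T fun s hs => hS hs
    choose B hB using hf
    have hB2 : ∀ s (hs : s ∈ S), Xh s ⁻¹' (B s hs) = f s := fun s hs => (hB s hs).2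
    choose idx hidx using hts
    have hset : (⋂ s ∈ S, f s) = (fun ω (i : Fin (n + 1)) => Xh (t i) ω) ⁻¹'
        {w | ∀ s (hs : s ∈ S), w (idx s hs) ∈ B s hs} := by
      ext ω
      simp only [Set.mem_iInter, Set.mem_preimage, Set.mem_ofPred_eq]
      refine forall₂_congr fun s hs => ?_
      rw [← hB2 s hs, hidx s hs]
      rfl
    rw [hset, ← Measure.map_apply (hmeas n t) (Set.toFinite _).measurableSet,
      ← Measure.map_apply (hmeas n t) (Set.toFinite _).measurableSet, key n t ht ht0 htn]
  have huniv : μ₁ Set.univ = μ₂ Set.univ := by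
    obtain ⟨n, t, ht, ht0, htn, -, -⟩ := exists_time_sequence (∅ : Finset ι) T (by simp)
    have := congrArg (fun ν : Measure _ => ν Set.univ) (key n t ht ht0 htn)
    simpa [Measure.map_apply (hmeas n t) MeasurableSet.univ] using this
  exact ext_on_measurableSpace_of_generate_finite mΩ _ hcyl
    (iSup₂_le fun s _ => (hXh s).comap_le) hgen hpi huniv hA

/-- The conditional law of `X_t` given the past of `Xh`, from the joint distributions of finitely
many values. -/
theorem samplePathIntertwined_of_fdd {Ω : Type*} [mΩ : MeasurableSpace Ω] {d : ℕ} {ι : Type*}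
    [LinearOrder ι] [OrderBot ι] (μ : Measure Ω) [IsProbabilityMeasure μ]
    (X Xh : ι → Ω → State d) (hX : ∀ t, Measurable (X t)) (hXh : ∀ t, Measurable (Xh t))
    (L : Matrix (State d) (State d) ℝ) (hL : ∀ i j, 0 ≤ L i j)
    (h : ∀ (n : ℕ) (t : ℕ → ι) (x : ℕ → State d) (y : State d), Monotone t → t 0 = ⊥ →
      μ.real {ω | (∀ i ≤ n, Xh (t i) ω = x i) ∧ X (t n) ω = y} =
        μ.real {ω | ∀ i ≤ n, Xh (t i) ω = x i} * L (x n) y) :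
    SamplePathIntertwined μ X Xh L := by
  intro T y
  have hmle : pastSigma Xh T ≤ mΩ := iSup₂_le fun s _ => (hXh s).comap_le
  have hA : MeasurableSet (X T ⁻¹' {y}) := hX T (measurableSet_singleton y)
  have hgm : Measurable fun ω => L (Xh T ω) y :=
    (measurable_of_finite (fun z => L z y)).comp (hXh T)
  have hgbd : ∃ c, ∀ z, L z y ≤ c := (Set.finite_range fun z => L z y).bddAbove.imp
    fun c hc z => hc ⟨z, rfl⟩
  have hgint : Integrable (fun ω => L (Xh T ω) y) μ := by
    obtain ⟨c, hc⟩ := hgbd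
    refine Integrable.of_bound hgm.aestronglyMeasurable c (Eventually.of_forall fun ω => ?_)
    rw [Real.norm_eq_abs, abs_of_nonneg (hL _ _)]
    exact hc _
  -- The defining property of the conditional expectation, as equality on the past of two finite
  -- measures: the restriction of μ to {X_T = y}, and μ with density Λ(X̂_T, y).
  have hall : ∀ A, MeasurableSet[pastSigma Xh T] A → μ.restrict (X T ⁻¹' {y}) A =
      μ.withDensity (fun ω => ENNReal.ofReal (L (Xh T ω) y)) A := by
    refine measure_eq_on_past _ _ Xh hXh T fun n t x ht ht0 htn => ?_
    have hms : MeasurableSet {ω | ∀ i ≤ n, Xh (t i) ω = x i} := by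
      simp only [Set.ofPred_forall]
      exact MeasurableSet.iInter fun i => MeasurableSet.iInter fun _ =>
        hXh _ (measurableSet_singleton _)
    have h1 := h n t x y ht ht0
    have e1 : μ.restrict (X T ⁻¹' {y}) {ω | ∀ i ≤ n, Xh (t i) ω = x i} =
        ENNReal.ofReal (μ.real {ω | (∀ i ≤ n, Xh (t i) ω = x i) ∧ X (t n) ω = y}) := by
      rw [Measure.restrict_apply hms, ofReal_measureReal, htn]
      rfl
    have e2 : μ.withDensity (fun ω => ENNReal.ofReal (L (Xh T ω) y))
        {ω | ∀ i ≤ n, Xh (t i) ω = x i} =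
        ENNReal.ofReal (μ.real {ω | ∀ i ≤ n, Xh (t i) ω = x i} * L (x n) y) := by
      rw [withDensity_apply _ hms, ENNReal.ofReal_mul measureReal_nonneg, ofReal_measureReal,
        setLIntegral_congr_fun (g := fun _ => ENNReal.ofReal (L (x n) y)) hms, setLIntegral_const,
        mul_comm]
      intro ω hω
      have := hω n le_rfl
      rw [htn] at this
      simp only [this]
    rw [e1, e2, h1]
  symm
  refine ae_eq_condExp_of_forall_setIntegral_eq hmle ((integrable_const (1 : ℝ)).indicator hA)
    (fun s _ _ => hgint.integrableOn) (fun s hs _ => ?_) ?_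
  · have hs' : MeasurableSet s := hmle s hs
    have h1 := hall s hs
    rw [Measure.restrict_apply hs', withDensity_apply _ hs',
      ← ofReal_integral_eq_lintegral_ofReal hgint.integrableOn
        (Eventually.of_forall fun ω => hL _ _)] at h1
    rw [integral_indicator_const _ hA, smul_eq_mul, mul_one, measureReal_def,
      Measure.restrict_apply hA, Set.inter_comm, h1,
      ENNReal.toReal_ofReal (integral_nonneg fun ω => hL _ _)]
  · have : Measurable[pastSigma Xh T] (Xh T) :=
      Measurable.of_comap_le (le_iSup₂_of_le T le_rfl le_rfl)
    exact ((measurable_of_finite (fun z => L z y)).comp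
      this).stronglyMeasurable.aestronglyMeasurable

/-- Two processes with the same finite-dimensional distributions have the same law. -/
theorem map_eq_of_fdd {Ω Ω' : Type*} [MeasurableSpace Ω] [MeasurableSpace Ω'] {d : ℕ} {ι : Type*}
    [LinearOrder ι] [OrderBot ι] (μ : Measure Ω) [IsProbabilityMeasure μ] (μ' : Measure Ω')
    [IsProbabilityMeasure μ'] (X : ι → Ω → State d) (X' : ι → Ω' → State d)
    (hX : ∀ t, Measurable (X t)) (hX' : ∀ t, Measurable (X' t))
    (h : ∀ (n : ℕ) (t : ℕ → ι) (x : ℕ → State d), Monotone t → t 0 = ⊥ →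
      μ.real {ω | ∀ i ≤ n, X (t i) ω = x i} = μ'.real {ω | ∀ i ≤ n, X' (t i) ω = x i}) :
    μ.map (fun ω t => X t ω) = μ'.map (fun ω t => X' t ω) := by
  have hmX : Measurable fun ω t => X t ω := measurable_pi_lambda _ hX
  have hmX' : Measurable fun ω t => X' t ω := measurable_pi_lambda _ hX'
  have key : ∀ (n : ℕ) (t : ℕ → ι), Monotone t → t 0 = ⊥ →
      μ.map (fun ω (i : Fin (n + 1)) => X (t i) ω) =
        μ'.map (fun ω (i : Fin (n + 1)) => X' (t i) ω) := by
    intro n t ht ht0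
    refine Measure.ext_of_singleton fun w => ?_
    rw [Measure.map_apply (measurable_pi_lambda _ fun i => hX _) (measurableSet_singleton w),
      Measure.map_apply (measurable_pi_lambda _ fun i => hX' _) (measurableSet_singleton w),
      preimage_singleton_eq_fdd (fun i => X (t i)) n w,
      preimage_singleton_eq_fdd (fun i => X' (t i)) n w, ← ofReal_measureReal,
      ← ofReal_measureReal, h n t _ ht ht0]
  have : IsProbabilityMeasure (μ.map (fun ω t => X t ω)) :=
    Measure.isProbabilityMeasure_map hmX.aemeasurable
  -- A finite measure on the product is determined by its finite-dimensional marginals. A nonempty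
  -- finite set of times is embedded in an increasing sequence that starts at the bottom.
  refine IsProjectiveLimit.unique (P := fun I : Finset ι => (μ'.map (fun ω t => X' t ω)).map
    I.restrict) (fun I => ?_) (fun I => rfl)
  rcases I.eq_empty_or_nonempty with rfl | hne
  · have : IsProbabilityMeasure (μ'.map (fun ω t => X' t ω)) :=
      Measure.isProbabilityMeasure_map hmX'.aemeasurable
    refine Measure.ext_of_singleton fun w => ?_
    have hu : ({w} : Set ((i : (∅ : Finset ι)) → State d)) = Set.univ := by
      ext v
      simp [Subsingleton.elim v w]
    rw [hu, Measure.map_apply (Finset.measurable_restrict _) MeasurableSet.univ,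
      Measure.map_apply (Finset.measurable_restrict _) MeasurableSet.univ]
    simp
  · obtain ⟨n, t, ht, ht0, -, -, hts⟩ := exists_time_sequence I (I.max' hne)
      fun s hs => I.le_max' s hs
    choose idx hidx using hts
    let proj : (Fin (n + 1) → State d) → ((i : I) → State d) := fun w i => w (idx i.1 i.2)
    have hproj : Measurable proj := measurable_of_finite _
    show _ = Measure.map I.restrict (Measure.map (fun ω t => X' t ω) μ')
    rw [Measure.map_map (Finset.measurable_restrict _) hmX,
      Measure.map_map (Finset.measurable_restrict _) hmX']
    have e : (I.restrict ∘ fun ω t => X t ω) = proj ∘ fun ω (i : Fin (n + 1)) => X (t i) ω := by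
      ext ω i
      simp [proj, hidx]
    have e' : (I.restrict ∘ fun ω t => X' t ω) = proj ∘ fun ω (i : Fin (n + 1)) => X' (t i) ω := by
      ext ω i
      simp [proj, hidx]
    rw [e, e', ← Measure.map_map hproj (measurable_pi_lambda _ fun i => hX _),
      ← Measure.map_map hproj (measurable_pi_lambda _ fun i => hX' _), key n t ht ht0]

/-- The joint law of a process and an independent noise sequence. -/
theorem map_prod_noise {Ω S : Type*} [MeasurableSpace Ω] [MeasurableSpace S] (μ : Measure Ω)
    [IsProbabilityMeasure μ] (p : Ω → S) (hp : Measurable p) (V : ℕ → Ω → ℝ)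
    (hV : ∀ n, Measurable (V n)) (ρ : Measure ℝ) (hlaw : ∀ n, HasLaw (V n) ρ μ)
    (hiid : iIndepFun V μ) (hind : IndepFun p (fun ω n => V n ω) μ) :
    μ.map (fun ω => (p ω, fun n => V n ω)) =
      (μ.map p).prod (Measure.infinitePi fun _ : ℕ => ρ) := by
  have hmV : Measurable fun ω n => V n ω := measurable_pi_lambda _ hV
  rw [(indepFun_iff_map_prod_eq_prod_map_map hp.aemeasurable hmV.aemeasurable).1 hind,
    hiid.map_fun_eq_infinitePi_map hV]
  congr 2
  ext1 n
  exact (hlaw n).map_eq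

/-! ### The discrete-time construction -/

lemma up_val {d : ℕ} {x : State d} (h : x.val < d) : (up x).val = x.val + 1 := by
  simp only [up]
  omega

lemma up_ne {d : ℕ} {x : State d} (h : x.val < d) : up x ≠ x := by
  intro h'
  have := congrArg Fin.val h'
  rw [up_val h] at this
  omega

lemma up_last {d : ℕ} : up (Fin.last d) = Fin.last d := by
  ext
  simp [up]

lemma eq_last_of_not_lt {d : ℕ} {x : State d} (h : ¬ x.val < d) : x = Fin.last d := by
  ext
  simp only [Fin.val_last]
  omega

lemma genSpectral_self {d : ℕ} (ρ : ℝ) (θ : State d → ℝ) (i : State d) :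
    genSpectral ρ θ i i = θ i := by
  simp [genSpectral]

lemma genSpectral_up {d : ℕ} (ρ : ℝ) (θ : State d → ℝ) {i : State d} (hi : i.val < d) :
    genSpectral ρ θ i (up i) = ρ - θ i := by
  simp [genSpectral, up_ne hi, up_val hi]

lemma genSpectral_other {d : ℕ} (ρ : ℝ) (θ : State d → ℝ) {i j : State d} (h1 : j ≠ i)
    (h2 : j ≠ up i) : genSpectral ρ θ i j = 0 := by
  have : j.val ≠ i.val + 1 := by
    intro h
    apply h2
    ext
    rw [h, up_val (by omega)]
  simp [genSpectral, h1, this]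

/-- One step of `dualPath`. -/
def dualNext {d : ℕ} (Λ : Matrix (State d) (State d) ℝ) (θ : State d → ℝ) (xh y : State d)
    (u : ℝ) : State d :=
  if y ≤ xh then
    if u < (1 - θ xh) * Λ (up xh) y / (θ xh * Λ xh y + (1 - θ xh) * Λ (up xh) y) then up xh
    else xh
  else up xh

lemma dualPath_succ {d : ℕ} (Λ : Matrix (State d) (State d) ℝ) (θ : State d → ℝ)
    (x : ℕ → State d) (u : ℕ → ℝ) (t : ℕ) :
    dualPath Λ θ x u (t + 1) = dualNext Λ θ (dualPath Λ θ x u t) (x (t + 1)) (u t) := rfl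

/-- Uniform distribution on `[0, 1]`. -/
abbrev unifMeasure : Measure ℝ := volume.restrict (Set.Icc 0 1)

instance : IsProbabilityMeasure unifMeasure := ⟨by simp⟩

lemma unifMeasure_real_Iio {q : ℝ} (h0 : 0 ≤ q) (h1 : q ≤ 1) : unifMeasure.real {u | u < q} = q := by
  have : {u : ℝ | u < q} ∩ Set.Icc 0 1 = Set.Ico 0 q := by
    ext u
    simp only [Set.mem_inter_iff, Set.mem_ofPred_eq, Set.mem_Icc, Set.mem_Ico]
    constructor
    · rintro ⟨h, h', -⟩
      exact ⟨h', h⟩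
    · rintro ⟨h, h'⟩
      exact ⟨h', h, by linarith⟩
  have hms : MeasurableSet {u : ℝ | u < q} := measurableSet_Iio
  rw [measureReal_def, Measure.restrict_apply hms, this, Real.volume_Ico]
  simp [h0]

/-- Conditional probability of the next value of `X̂`. -/
def dualProb {d : ℕ} (Λ : Matrix (State d) (State d) ℝ) (θ : State d → ℝ) (xh y z : State d) : ℝ :=
  unifMeasure.real {u | dualNext Λ θ xh y u = z}

lemma measurable_dualNext {d : ℕ} (Λ : Matrix (State d) (State d) ℝ) (θ : State d → ℝ)
    (xh y : State d) : Measurable (dualNext Λ θ xh y) := by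
  unfold dualNext
  split_ifs
  · exact Measurable.ite measurableSet_Iio measurable_const measurable_const
  · exact measurable_const

/-- The factor on the left is the entry (x̂, y) of P̂Λ, and the threshold divides it in the
proportion of its two terms. If it is 0, both terms are 0 and the value of the quotient is
immaterial. For y > x̂ the holding term vanishes by triangularity, which is why moving is then
forced; at d both terms refer to d itself. -/
lemma mul_dualProb {d : ℕ} {Λ : Matrix (State d) (State d) ℝ} {θ : State d → ℝ}
    (hΛ : ∀ i j, 0 ≤ Λ i j) (hT : ∀ i j, i < j → Λ i j = 0) (h0 : ∀ i, 0 ≤ θ i)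
    (h1 : ∀ i, θ i ≤ 1) (hlast : θ (Fin.last d) = 1) (xh y z : State d) :
    (θ xh * Λ xh y + (1 - θ xh) * Λ (up xh) y) * dualProb Λ θ xh y z =
      genSpectral 1 θ xh z * Λ z y := by
  set D := θ xh * Λ xh y + (1 - θ xh) * Λ (up xh) y with hD
  have hD1 : 0 ≤ θ xh * Λ xh y := mul_nonneg (h0 _) (hΛ _ _)
  have hD2 : 0 ≤ (1 - θ xh) * Λ (up xh) y := mul_nonneg (by linarith [h1 xh]) (hΛ _ _)
  have hD0 : 0 ≤ D := by linarith
  have hconst : ∀ w, (∀ u, dualNext Λ θ xh y u = w) →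
      dualProb Λ θ xh y z = if z = w then 1 else 0 := by
    intro w hw
    unfold dualProb
    split_ifs with hz
    · have : {u | dualNext Λ θ xh y u = z} = Set.univ := by
        ext u
        simp [hw, hz]
      rw [this]
      simp
    · have : {u | dualNext Λ θ xh y u = z} = ∅ := by
        ext u
        simp [hw, Ne.symm hz]
      rw [this]
      simp
  by_cases hx : xh.val < d
  · by_cases hy : y ≤ xh
    · set q := (1 - θ xh) * Λ (up xh) y / D with hq
      have hq0 : 0 ≤ q := div_nonneg hD2 hD0
      have hq1 : q ≤ 1 := div_le_one_of_le₀ (by linarith) hD0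
      have hDq : D * q = (1 - θ xh) * Λ (up xh) y := by
        rcases hD0.eq_or_lt with h | h
        · rw [← h, zero_mul]
          linarith
        · rw [hq, mul_div_cancel₀ _ h.ne']
      have hnext : ∀ u, dualNext Λ θ xh y u = if u < q then up xh else xh := by
        intro u
        rw [dualNext, if_pos hy]
      by_cases hz1 : z = up xh
      · subst hz1
        have : {u | dualNext Λ θ xh y u = up xh} = {u | u < q} := by
          ext u
          simp only [Set.mem_ofPred_eq, hnext]
          split_ifs with h
          · simp [h]
          · simp [h, (up_ne hx).symm]
        rw [dualProb, this, unifMeasure_real_Iio hq0 hq1, hDq, genSpectral_up 1 θ hx]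
      · by_cases hz2 : z = xh
        · subst hz2
          have : {u | dualNext Λ θ z y u = z} = {u | u < q}ᶜ := by
            ext u
            simp only [Set.mem_ofPred_eq, hnext, Set.mem_compl_iff]
            split_ifs with h
            · simp [h, up_ne hx]
            · simp [h]
          have hms : MeasurableSet {u : ℝ | u < q} := measurableSet_Iio
          rw [dualProb, this, measureReal_compl hms,
            unifMeasure_real_Iio hq0 hq1, genSpectral_self]
          simp only [probReal_univ]
          linarith
        · have : {u | dualNext Λ θ xh y u = z} = ∅ := by
            ext u
            simp only [Set.mem_ofPred_eq, hnext, Set.mem_empty_iff_false, iff_false]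
            split_ifs
            · exact Ne.symm hz1
            · exact Ne.symm hz2
          rw [dualProb, this, genSpectral_other 1 θ hz2 hz1]
          simp
    · rw [hconst (up xh) fun u => by rw [dualNext, if_neg hy]]
      have h0' : Λ xh y = 0 := hT _ _ (not_le.1 hy)
      split_ifs with hz
      · rw [hz, genSpectral_up 1 θ hx, hD, h0']
        ring
      · by_cases hz2 : z = xh
        · rw [hz2, h0', mul_zero, mul_zero]
        · rw [genSpectral_other 1 θ hz2 hz]
          ring
  · have hx' := eq_last_of_not_lt hx
    have hup : up xh = xh := by rw [hx', up_last]
    rw [hconst xh fun u => by simp [dualNext, hup]]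
    split_ifs with hz
    · rw [hz, genSpectral_self, hD, hup, hx', hlast]
      ring
    · rw [genSpectral_other 1 θ hz (by rwa [hup])]
      ring

/-- Given the path of `X`, the values of `X̂` form an inhomogeneous chain. -/
lemma infinitePi_dualPath {d : ℕ} (Λ : Matrix (State d) (State d) ℝ) (θ : State d → ℝ)
    (x : ℕ → State d) (n : ℕ) (z : ℕ → State d) :
    (Measure.infinitePi fun _ : ℕ => unifMeasure).real
        {u | ∀ i ≤ n, dualPath Λ θ x u i = z i} =
      (if z 0 = 0 then 1 else 0) *
        ∏ i ∈ Finset.range n, dualProb Λ θ (z i) (x (i + 1)) (z (i + 1)) := by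
  by_cases h0 : z 0 = 0
  -- Along a prescribed word z the event splits into one condition on each uniform variable, hence
  -- into a product.
  · have hset : {u | ∀ i ≤ n, dualPath Λ θ x u i = z i} =
        Set.pi (Finset.range n : Set ℕ)
          (fun i => {u | dualNext Λ θ (z i) (x (i + 1)) u = z (i + 1)}) := by
      ext u
      simp only [Set.mem_ofPred_eq, Set.mem_pi, Finset.coe_range, Set.mem_Iio]
      constructor
      · intro h i hi
        have h2 := h (i + 1) (by omega)
        rwa [dualPath_succ, h i (by omega)] at h2
      · intro h i
        induction i with
        | zero => intro _; rw [h0]; rfl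
        | succ i ih =>
          intro hi
          rw [dualPath_succ, ih (by omega)]
          exact h i (by omega)
    rw [if_pos h0, one_mul, hset, measureReal_def, Measure.infinitePi_pi, ENNReal.toReal_prod]
    · rfl
    · exact fun i _ => measurable_dualNext _ _ _ _ (measurableSet_singleton _)
  · have hset : {u | ∀ i ≤ n, dualPath Λ θ x u i = z i} = ∅ := by
      ext u
      simp only [Set.mem_ofPred_eq, Set.mem_empty_iff_false, iff_false, not_forall]
      exact ⟨0, Nat.zero_le _, fun h => h0 h.symm⟩
    rw [hset, if_neg h0]
    simp

lemma measurable_dualPath {d : ℕ} (Λ : Matrix (State d) (State d) ℝ) (θ : State d → ℝ) (t : ℕ) :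
    Measurable fun q : (ℕ → State d) × (ℕ → ℝ) => dualPath Λ θ q.1 q.2 t := by
  induction t with
  | zero => exact measurable_const
  | succ t ih =>
    have h1 : Measurable fun r : (State d × State d) × ℝ => dualNext Λ θ r.1.1 r.1.2 r.2 :=
      measurable_from_prod_countable_right fun s => measurable_dualNext Λ θ s.1 s.2
    exact h1.comp ((ih.prodMk ((measurable_pi_apply (t + 1)).comp measurable_fst)).prodMk
      ((measurable_pi_apply t).comp measurable_snd))

lemma measurableSet_fdd {Ω : Type*} [MeasurableSpace Ω] {d : ℕ} {Y : ℕ → Ω → State d}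
    (hY : ∀ k, Measurable (Y k)) (n : ℕ) (z : ℕ → State d) :
    MeasurableSet {ω | ∀ i ≤ n, Y i ω = z i} := by
  simp only [Set.ofPred_forall]
  exact MeasurableSet.iInter fun i => MeasurableSet.iInter fun _ => hY i (measurableSet_singleton _)

lemma prod_real_eq_integral {α β : Type*} [MeasurableSpace α] [MeasurableSpace β] (κ : Measure α)
    (ρ : Measure β) [IsProbabilityMeasure κ] [IsProbabilityMeasure ρ] {S : Set (α × β)}
    (hS : MeasurableSet S) : (κ.prod ρ).real S = ∫ a, ρ.real (Prod.mk a ⁻¹' S) ∂κ := by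
  rw [measureReal_def, Measure.prod_apply hS]
  exact (integral_toReal (measurable_measure_prodMk_left hS).aemeasurable
    (Eventually.of_forall fun a => measure_lt_top _ _)).symm

section DiscreteChain

variable {d : ℕ} {P : Matrix (State d) (State d) ℝ} {θ : State d → ℝ}
  {Ω : Type*} [MeasurableSpace Ω] {μ : Measure Ω} [IsProbabilityMeasure μ]
  {X : ℕ → Ω → State d} {U : ℕ → Ω → ℝ} {Xh : ℕ → Ω → State d}

/-- The joint distribution of the past of `X̂` and the present of `X`. -/
theorem discrete_joint_fdd (hP : IsKernel P) (hm : Monotone θ) (he : HasEigenvalues P θ)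
    (hθ : ∀ i, 0 ≤ θ i) (hX : IsChain μ X P) (hU : IsIndependentNoise μ X U unifMeasure)
    (hXh : ∀ t ω, Xh t ω = dualPath (genLink P 1 θ) θ (fun s => X s ω) (fun n => U n ω) t)
    (n : ℕ) (z : ℕ → State d) (y : State d) :
    μ.real {ω | (∀ i ≤ n, Xh i ω = z i) ∧ X n ω = y} =
      (if z 0 = 0 then 1 else 0) * (∏ i ∈ Finset.range n, genSpectral 1 θ (z i) (z (i + 1))) *
        genLink P 1 θ (z n) y := by
  have hA := hP.isBirthDeath
  set Λ := genLink P 1 θ with hΛdef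
  have hΛs := genLink_stochastic hA hm he
  have hmX : Measurable fun ω s => X s ω := measurable_pi_lambda _ hX.measurable
  have hmU : Measurable fun ω n => U n ω := measurable_pi_lambda _ hU.measurable
  have hlaw := map_prod_noise μ (fun ω s => X s ω) hmX U hU.measurable unifMeasure hU.law hU.iid
    hU.indep
  set S : Set ((ℕ → State d) × (ℕ → ℝ)) :=
    {q | (∀ i ≤ n, dualPath Λ θ q.1 q.2 i = z i) ∧ q.1 n = y} with hS
  have hqn : Measurable fun q : (ℕ → State d) × (ℕ → ℝ) => q.1 n :=
    (measurable_pi_apply n).comp measurable_fst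
  have hSm : MeasurableSet S :=
    (measurableSet_fdd (Y := fun i (q : (ℕ → State d) × (ℕ → ℝ)) => dualPath Λ θ q.1 q.2 i)
      (fun i => measurable_dualPath Λ θ i) n z).inter (hqn (measurableSet_singleton y))
  have h1 : μ.real {ω | (∀ i ≤ n, Xh i ω = z i) ∧ X n ω = y} =
      ((μ.map fun ω s => X s ω).prod (Measure.infinitePi fun _ : ℕ => unifMeasure)).real S := by
    rw [← hlaw, map_measureReal_apply (hmX.prodMk hmU) hSm]
    congr 1
    ext ω
    simp only [hS, Set.mem_ofPred_eq, Set.mem_preimage, hXh]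
  have h2 : ((μ.map fun ω s => X s ω).prod (Measure.infinitePi fun _ : ℕ => unifMeasure)).real S =
      ∫ ω, (if X n ω = y then (if z 0 = 0 then 1 else 0) *
        ∏ i ∈ Finset.range n, dualProb Λ θ (z i) (X (i + 1) ω) (z (i + 1)) else 0) ∂μ := by
    have : IsProbabilityMeasure (μ.map fun ω s => X s ω) :=
      Measure.isProbabilityMeasure_map hmX.aemeasurable
    rw [prod_real_eq_integral _ _ hSm, integral_map hmX.aemeasurable]
    · congr 1
      ext ω
      by_cases hy : X n ω = y
      · rw [if_pos hy, ← infinitePi_dualPath Λ θ (fun s => X s ω)]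
        congr 1
        ext u
        simp [hS, hy]
      · have : Prod.mk (fun s => X s ω) ⁻¹' S = ∅ := by
          ext u
          simp [hS, hy]
        rw [this, measureReal_empty, if_neg hy]
    · exact (measurable_measure_prodMk_left hSm).ennreal_toReal.aestronglyMeasurable
  rw [h1, h2]
  clear h1 h2 hSm hS S hqn
  induction n generalizing y with
  | zero =>
    have h0 := hX.fdd 0 (fun _ => y)
    have hms : MeasurableSet {ω | X 0 ω = y} := hX.measurable 0 (measurableSet_singleton y)
    have h1 : ∀ ω, (if X 0 ω = y then (if z 0 = 0 then 1 else 0) *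
        ∏ i ∈ Finset.range 0, dualProb Λ θ (z i) (X (i + 1) ω) (z (i + 1)) else 0) =
        Set.indicator {ω | X 0 ω = y} (fun _ => (if z 0 = 0 then (1 : ℝ) else 0)) ω := by
      intro ω
      simp [Set.indicator_apply]
    simp only [h1]
    rw [integral_indicator_const _ hms]
    simp only [nonpos_iff_eq_zero, forall_eq, Finset.range_zero, Finset.prod_empty, mul_one] at h0
    rw [h0]
    by_cases hz : z 0 = 0
    · simp [hz, hΛdef, genLink_zero_row]
    · simp [hz]
  | succ n ih =>
    -- The probability of the word z up to time n depends on X only up to time n, so the Markov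
    -- property of X applies to the step from n to n + 1.
    set F : (ℕ → State d) → ℝ := fun x => (if z 0 = 0 then 1 else 0) *
        ∏ i ∈ Finset.range n, dualProb Λ θ (z i) (x (i + 1)) (z (i + 1)) with hF
    have hFd : ∀ x y : ℕ → State d, (∀ i ≤ n, x i = y i) → F x = F y := by
      intro x y h
      simp only [hF]
      congr 1
      exact Finset.prod_congr rfl fun i hi => by rw [h (i + 1) (Finset.mem_range.1 hi)]
    have hintegrable : ∀ x : State d, Integrable
        (fun ω => if X n ω = x ∧ X (n + 1) ω = y then F (fun i => X i ω) else 0) μ := by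
      intro x
      have hFm : Measurable F := by
        refine measurable_const.mul (Finset.measurable_prod _ fun i _ => ?_)
        exact (measurable_of_finite fun w => dualProb Λ θ (z i) w (z (i + 1))).comp
          (measurable_pi_apply _)
      refine Integrable.of_bound (C := 1) ((Measurable.ite
        ((hX.measurable n (measurableSet_singleton x)).inter
          (hX.measurable (n + 1) (measurableSet_singleton y))) (hFm.comp hmX)
            measurable_const).aestronglyMeasurable) (Eventually.of_forall fun ω => ?_)
      have h1 : |F (fun i => X i ω)| ≤ 1 := by
        simp only [hF]
        rw [abs_mul, Finset.abs_prod]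
        refine mul_le_one₀ (by split_ifs <;> simp) (Finset.prod_nonneg fun i _ => abs_nonneg _)
          (Finset.prod_le_one (fun i _ => abs_nonneg _) fun i _ => ?_)
        rw [dualProb, abs_of_nonneg measureReal_nonneg]
        exact measureReal_le_one
      split_ifs
      · exact h1
      · simp
    have h1 : ∀ ω, (if X (n + 1) ω = y then (if z 0 = 0 then 1 else 0) *
        ∏ i ∈ Finset.range (n + 1), dualProb Λ θ (z i) (X (i + 1) ω) (z (i + 1)) else 0) =
        dualProb Λ θ (z n) y (z (n + 1)) *
          ∑ x, if X n ω = x ∧ X (n + 1) ω = y then F (fun i => X i ω) else 0 := by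
      intro ω
      by_cases hy : X (n + 1) ω = y
      · simp only [hy, if_true, and_true, Finset.sum_ite_eq, Finset.mem_univ]
        rw [Finset.prod_range_succ, hy]
        simp only [hF]
        ring
      · simp [hy]
    simp only [h1]
    rw [integral_const_mul, integral_finsetSum _ fun x _ => hintegrable x]
    have h2 := fun x => integral_markov_step μ X hX.measurable (fun _ => P) hX.fdd F n hFd x y
    have h3 : ∀ x, ∫ ω, (if X n ω = x then F (fun i => X i ω) else 0) ∂μ =
        (if z 0 = 0 then 1 else 0) * (∏ i ∈ Finset.range n, genSpectral 1 θ (z i) (z (i + 1))) *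
          Λ (z n) x := ih
    rw [Finset.sum_congr rfl fun x _ => (h2 x).trans (by rw [h3 x])]
    -- The intertwining collapses the sum over the state of X at time n to exactly the denominator
    -- in the transition rule, and `mul_dualProb` removes it.
    have h4 : ∑ x, Λ (z n) x * P x y =
        θ (z n) * Λ (z n) y + (1 - θ (z n)) * Λ (up (z n)) y := by
      rw [← Matrix.mul_apply, genLink_intertwine hA hm he, Matrix.mul_apply,
        sum_genSpectral_mul 1 θ (hA.eigenvalue_last hm he) (z n) (fun l => Λ l y)]
    have h5 := mul_dualProb (Λ := Λ) hΛs.1 (genLink_triangular hA) hθ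
      (fun i => (hm (Fin.le_last i)).trans_eq (hA.eigenvalue_last hm he))
      (hA.eigenvalue_last hm he) (z n) y (z (n + 1))
    rw [Finset.prod_range_succ]
    simp only [mul_assoc, ← Finset.mul_sum]
    rw [h4, mul_left_comm, mul_left_comm (dualProb _ _ _ _ _), ← h5]
    ring

end DiscreteChain

/-! ### Consequences of the joint distributions -/

lemma measureReal_eq_sum_fiber {Ω β : Type*} [MeasurableSpace Ω] [Fintype β] [MeasurableSpace β]
    [MeasurableSingletonClass β] (μ : Measure Ω) [IsFiniteMeasure μ] {W : Ω → β}
    (hW : Measurable W) (A : Set Ω) : μ.real A = ∑ w, μ.real {ω | ω ∈ A ∧ W ω = w} := by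
  have h : ∀ w, MeasurableSet (W ⁻¹' {w}) := fun w => hW (measurableSet_singleton w)
  have h1 := sum_measureReal_preimage_singleton (μ := μ.restrict A) Finset.univ (f := W)
    (fun w _ => h w)
  simp only [Finset.coe_univ, Set.preimage_univ, measureReal_restrict_apply_univ] at h1
  rw [← h1]
  refine Finset.sum_congr rfl fun w _ => ?_
  rw [measureReal_restrict_apply (h w)]
  congr 1
  ext ω
  simp [and_comm]

/-- Each of the finitely many pairs with L x y = 0 has probability 0 at time T. Since the time
sequences start at ⊥, the value `x0` there is carried along. -/
lemma ae_link_pos_of_fdd {Ω : Type*} [MeasurableSpace Ω] {d : ℕ} {ι : Type*}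
    [LinearOrder ι] [OrderBot ι] (μ : Measure Ω) [IsProbabilityMeasure μ]
    (X Xh : ι → Ω → State d) (L : Matrix (State d) (State d) ℝ) (hL : ∀ i j, 0 ≤ L i j)
    (h : ∀ (n : ℕ) (t : ℕ → ι) (x : ℕ → State d) (y : State d), Monotone t → t 0 = ⊥ →
      μ.real {ω | (∀ i ≤ n, Xh (t i) ω = x i) ∧ X (t n) ω = y} =
        μ.real {ω | ∀ i ≤ n, Xh (t i) ω = x i} * L (x n) y) (T : ι) :
    ∀ᵐ ω ∂μ, 0 < L (Xh T ω) (X T ω) := by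
  have key : ∀ x0 x y : State d, L x y = 0 →
      ∀ᵐ ω ∂μ, ¬ (Xh ⊥ ω = x0 ∧ Xh T ω = x ∧ X T ω = y) := by
    intro x0 x y hxy
    have h1 := h 1 (fun i => if i = 0 then ⊥ else T) (fun i => if i = 0 then x0 else x) y
      (by
        intro i j hij
        by_cases hi : i = 0
        · simp [hi]
        · have : j ≠ 0 := by omega
          simp [hi, this]) (by simp)
    simp only [one_ne_zero, if_false, hxy, mul_zero] at h1
    rw [measureReal_eq_zero_iff] at h1
    rw [ae_iff]
    refine measure_mono_null ?_ h1
    intro ω hω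
    simp only [not_not, Set.mem_ofPred_eq] at hω ⊢
    refine ⟨fun i hi => ?_, hω.2.2⟩
    interval_cases i
    · simpa using hω.1
    · simpa using hω.2.1
  have key2 : ∀ᵐ ω ∂μ, ∀ x0 x y : State d, L x y = 0 →
      ¬ (Xh ⊥ ω = x0 ∧ Xh T ω = x ∧ X T ω = y) := by
    simp only [ae_all_iff]
    exact fun x0 x y hxy => key x0 x y hxy
  filter_upwards [key2] with ω hω
  refine lt_of_le_of_ne (hL _ _) fun h0 => hω _ _ _ h0.symm ⟨rfl, rfl, rfl⟩

lemma le_of_link_pos {d : ℕ} {L : Matrix (State d) (State d) ℝ} (hT : ∀ i j, i < j → L i j = 0)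
    {x y : State d} (h : 0 < L x y) : y ≤ x := by
  by_contra hlt
  exact h.ne' (hT _ _ (not_le.1 hlt))

/-- Triangularity gives y ≤ x, and row d of the link is the unit mass at d. Hence on the support of
the link both processes are at d at the same times, and the hitting times agree. -/
lemma eq_last_iff_of_link_pos {d : ℕ} {L : Matrix (State d) (State d) ℝ}
    (hL : L ∈ Matrix.rowStochastic ℝ (State d)) (hT : ∀ i j, i < j → L i j = 0)
    (hlast : L (Fin.last d) (Fin.last d) = 1) {x y : State d} (h : 0 < L x y) :
    y = Fin.last d ↔ x = Fin.last d := by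
  constructor
  · rintro rfl
    exact le_antisymm (Fin.le_last _) (le_of_link_pos hT h)
  · rintro rfl
    by_contra hy
    have hs := Matrix.sum_row_of_mem_rowStochastic hL (Fin.last d)
    rw [← Finset.add_sum_erase _ _ (Finset.mem_univ (Fin.last d)), hlast] at hs
    have h2 := Finset.single_le_sum (f := fun j => L (Fin.last d) j)
      (fun j _ => hL.1 (Fin.last d) j) (Finset.mem_erase.2 ⟨hy, Finset.mem_univ y⟩)
    linarith

/-! ### Waiting times of a discrete-time pure-birth chain -/

section Waits

/-- Hitting times of the path with holding times `n 0 + 1, n 1 + 1, …`. -/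
def birthTime (n : ℕ → ℕ) (k : ℕ) : ℕ := ∑ j ∈ Finset.range k, (n j + 1)

lemma birthTime_succ (n : ℕ → ℕ) (k : ℕ) : birthTime n (k + 1) = birthTime n k + (n k + 1) := by
  rw [birthTime, Finset.sum_range_succ]
  rfl

lemma birthTime_strictMono (n : ℕ → ℕ) : StrictMono (birthTime n) :=
  strictMono_nat_of_lt_succ fun k => by rw [birthTime_succ]; omega

/-- The path with holding times `n 0 + 1, n 1 + 1, …`. -/
def birthPath (d : ℕ) (n : ℕ → ℕ) (t : ℕ) : State d :=
  ⟨Nat.findGreatest (fun k => birthTime n k ≤ t) d, Nat.lt_succ_of_le (Nat.findGreatest_le d)⟩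

lemma birthPath_of_mem {d : ℕ} {n : ℕ → ℕ} {k t : ℕ} (hk : k < d) (h1 : birthTime n k ≤ t)
    (h2 : t < birthTime n (k + 1)) : (birthPath d n t).val = k := by
  simp only [birthPath]
  rw [Nat.findGreatest_eq_iff]
  refine ⟨hk.le, fun _ => h1, fun {j} hj _ => ?_⟩
  have := (birthTime_strictMono n).monotone (show k + 1 ≤ j by omega)
  omega

lemma birthPath_birthTime {d : ℕ} (n : ℕ → ℕ) {k : ℕ} (hk : k ≤ d) :
    (birthPath d n (birthTime n k)).val = k := by
  simp only [birthPath]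
  rw [Nat.findGreatest_eq_iff]
  refine ⟨hk, fun _ => le_rfl, fun {j} hj _ => ?_⟩
  have := birthTime_strictMono n hj
  omega

lemma birthPath_lt {d : ℕ} (n : ℕ → ℕ) {k t : ℕ} (h : t < birthTime n k) :
    (birthPath d n t).val < k := by
  by_contra hc
  have h0 : birthTime n 0 ≤ t := by simp [birthTime]
  have h1 : birthTime n (birthPath d n t).val ≤ t :=
    Nat.findGreatest_spec (P := fun k => birthTime n k ≤ t) (Nat.zero_le d) h0
  have := (birthTime_strictMono n).monotone (not_lt.1 hc)
  omega

lemma prod_birthPath {d : ℕ} (θ : State d → ℝ) (n : ℕ → ℕ) (k : ℕ) (hk : k ≤ d) :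
    ∏ i ∈ Finset.range (birthTime n k),
        genSpectral 1 θ (birthPath d n i) (birthPath d n (i + 1)) =
      ∏ j ∈ Finset.range k, (natExt θ j ^ n j * (1 - natExt θ j)) := by
  induction k with
  | zero => simp [birthTime]
  | succ k ih =>
    have hkd : k < d := hk
    have hst : ∀ i, birthTime n k ≤ i → i < birthTime n (k + 1) →
        birthPath d n i = ⟨k, by omega⟩ := fun i h1 h2 =>
      Fin.ext (birthPath_of_mem hkd h1 h2)
    have hup : birthPath d n (birthTime n (k + 1)) = up ⟨k, by omega⟩ :=
      Fin.ext (by rw [birthPath_birthTime n hk, up_val (by exact hkd)])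
    have hv : natExt θ k = θ ⟨k, by omega⟩ := natExt_val θ ⟨k, by omega⟩
    rw [birthTime_succ, ← add_assoc, Finset.prod_range_succ, Finset.prod_range_add, ih (by omega),
      Finset.prod_range_succ _ k]
    have hlast : birthTime n k + n k + 1 = birthTime n (k + 1) := by rw [birthTime_succ]; ring
    rw [hlast, hup, hst (birthTime n k + n k) (by omega) (by omega),
      genSpectral_up 1 θ (by exact hkd), mul_assoc, hv]
    congr 2
    rw [Finset.prod_congr rfl (g := fun _ => θ ⟨k, by omega⟩), Finset.prod_const,
      Finset.card_range]
    intro i hi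
    rw [Finset.mem_range] at hi
    rw [hst _ (by omega) (by omega), hst _ (by omega) (by omega), genSpectral_self]

lemma hit_eq_of_path {d : ℕ} {Ω : Type*} {Z : ℕ → Ω → State d} {n : ℕ → ℕ} {ω : Ω}
    (h : ∀ i ≤ birthTime n d, Z i ω = birthPath d n i)
    (k : State d) : hit Z k ω = birthTime n k.val := by
  have hmono := (birthTime_strictMono n).monotone
  have hkd : birthTime n k.val ≤ birthTime n d := hmono (by omega)
  refine le_antisymm ?_ ?_
  · refine iInf₂_le _ ?_
    rw [h _ hkd]
    exact Fin.ext (birthPath_birthTime n (by omega))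
  · refine le_iInf₂ fun t ht => ?_
    by_contra hlt
    have hlt' : t < birthTime n k.val := by exact_mod_cast not_le.1 hlt
    have h1 := birthPath_lt (d := d) n hlt'
    rw [← h t (by omega), ht] at h1
    omega

lemma wait_eq_of_path {d : ℕ} {Ω : Type*} {Z : ℕ → Ω → State d} {n : ℕ → ℕ} {ω : Ω}
    (h : ∀ i ≤ birthTime n d, Z i ω = birthPath d n i)
    (k : Fin d) : wait Z k ω = n k + 1 := by
  rw [wait, hit_eq_of_path h, hit_eq_of_path h]
  simp only [Fin.val_succ, Fin.val_castSucc, ENat.toNat_natCast, birthTime_succ]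
  omega

variable {d : ℕ} {Ω : Type*} [MeasurableSpace Ω] {μ : Measure Ω} [IsProbabilityMeasure μ]
  {Z : ℕ → Ω → State d} {θ : State d → ℝ}

lemma measurable_hit (hZ : ∀ t, Measurable (Z t)) (k : State d) : Measurable (hit Z k) := by
  refine measurable_to_countable' fun y => ?_
  induction y with
  | top =>
    have : hit Z k ⁻¹' {⊤} = ⋂ t, (Z t ⁻¹' {k})ᶜ := by
      ext ω
      simp [hit, iInf_eq_top]
    rw [this]
    exact MeasurableSet.iInter fun t => (hZ t (measurableSet_singleton k)).compl
  | coe m =>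
    have : hit Z k ⁻¹' {(m : ℕ∞)} = Z m ⁻¹' {k} ∩ ⋂ t, ⋂ _ : t < m, (Z t ⁻¹' {k})ᶜ := by
      ext ω
      simp only [Set.mem_preimage, Set.mem_singleton_iff, Set.mem_inter_iff, Set.mem_iInter,
        Set.mem_compl_iff]
      constructor
      · intro h
        have hlt : ∀ t < m, Z t ω ≠ k := by
          intro t ht hk
          have h1 : hit Z k ω ≤ t := iInf₂_le t hk
          rw [h] at h1
          have : m ≤ t := by exact_mod_cast h1
          omega
        refine ⟨?_, hlt⟩
        by_contra hm
        have h1 : ((m + 1 : ℕ) : ℕ∞) ≤ hit Z k ω := by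
          refine le_iInf₂ fun t ht => ?_
          have h2 : t ≠ m := by rintro rfl; exact hm ht
          have h3 : ¬ t < m := fun h3 => hlt t h3 ht
          exact_mod_cast (show m + 1 ≤ t by omega)
        rw [h] at h1
        have : m + 1 ≤ m := by exact_mod_cast h1
        omega
      · rintro ⟨h1, h2⟩
        refine le_antisymm (iInf₂_le m h1) (le_iInf₂ fun t ht => ?_)
        have : ¬ t < m := fun h3 => h2 t h3 ht
        exact_mod_cast not_lt.1 this
    rw [this]
    exact (hZ m (measurableSet_singleton k)).inter (MeasurableSet.iInter fun t =>
      MeasurableSet.iInter fun _ => (hZ t (measurableSet_singleton k)).compl)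

lemma measurable_wait (hZ : ∀ t, Measurable (Z t)) (k : Fin d) : Measurable (wait Z k) := by
  have h : Measurable (fun a : ℕ∞ × ℕ∞ => a.1.toNat - a.2.toNat) := Measurable.of_discrete
  exact h.comp ((measurable_hit hZ k.succ).prodMk (measurable_hit hZ k.castSucc))

/-- Law of a waiting time: geometric, starting from `1`. -/
def waitLaw (p : unitInterval) : Measure ℕ := (geometricMeasure p).map (· + 1)

instance (p : unitInterval) : IsProbabilityMeasure (waitLaw p) :=
  Measure.isProbabilityMeasure_map (by fun_prop)

lemma waitLaw_zero (p : unitInterval) : waitLaw p {0} = 0 := by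
  rw [waitLaw, Measure.map_apply (by fun_prop) (measurableSet_singleton 0)]
  have : (fun x : ℕ => x + 1) ⁻¹' {0} = ∅ := by
    ext x
    simp
  rw [this, measure_empty]

lemma waitLaw_succ {p : unitInterval} (hp : p ≠ 0) (n : ℕ) :
    waitLaw p {n + 1} = ENNReal.ofReal ((1 - p) ^ n * p) := by
  rw [waitLaw, Measure.map_apply (by fun_prop) (measurableSet_singleton _)]
  have : (fun x : ℕ => x + 1) ⁻¹' {n + 1} = {n} := by
    ext x
    simp
  rw [this, geometricMeasure_singleton hp]

/-- Following a prescribed pure-birth path up to d is a cylinder event, with probability a product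
of geometric weights, and on it the waiting times are the prescribed ones. So the product law is
below the law of the waiting times at each point; as both are probability measures, they are equal.
That d is hit need not be known beforehand and comes out of this equality. -/
theorem discrete_waits (hZ : IsChain μ Z (genSpectral 1 θ)) (h0 : ∀ i, 0 ≤ θ i)
    (h1 : ∀ i : Fin d, θ i.castSucc < 1) :
    (∀ᵐ ω ∂μ, hit Z (Fin.last d) ω = ((∑ k : Fin d, wait Z k ω : ℕ) : ℕ∞)) ∧
    iIndepFun (fun k : Fin d => wait Z k) μ ∧
    (∀ (k : Fin d) (n : ℕ), μ.real {ω | wait Z k ω = n + 1} =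
      θ k.castSucc ^ n * (1 - θ k.castSucc)) := by
  set p : Fin d → unitInterval := fun k =>
    ⟨1 - θ k.castSucc, by linarith [h1 k], by linarith [h0 k.castSucc]⟩ with hp
  have hp0 : ∀ k, p k ≠ 0 := by
    intro k h
    have := congrArg Subtype.val h
    simp only [hp, Set.Icc.coe_zero] at this
    linarith [h1 k]
  have hWm : Measurable fun ω k => wait Z k ω :=
    measurable_pi_lambda _ fun k => measurable_wait hZ.measurable k
  -- The value 0 beyond index d - 1 never enters: only the hitting times of 0, ..., d are used.
  let E : (Fin d → ℕ) → Set Ω := fun n =>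
    {ω | ∀ i ≤ birthTime (fun j => if h : j < d then n ⟨j, h⟩ else 0) d,
      Z i ω = birthPath d (fun j => if h : j < d then n ⟨j, h⟩ else 0) i}
  have hE : ∀ n ω, ω ∈ E n → (fun k => wait Z k ω) = fun k => n k + 1 := by
    intro n ω hω
    ext k
    rw [wait_eq_of_path hω k]
    simp
  have hEμ : ∀ n, μ (E n) = Measure.pi (fun k => waitLaw (p k)) {fun k => n k + 1} := by
    intro n
    rw [Measure.pi_singleton, ← ofReal_measureReal, hZ.fdd, prod_birthPath θ _ d le_rfl,
      if_pos (Fin.ext (by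
        have := birthPath_birthTime (d := d) (fun j => if h : j < d then n ⟨j, h⟩ else 0)
          (Nat.zero_le d)
        simpa [birthTime] using this)), one_mul, Finset.prod_range,
      ENNReal.ofReal_prod_of_nonneg]
    · refine Finset.prod_congr rfl fun k _ => ?_
      rw [waitLaw_succ (hp0 k)]
      have hv : natExt θ k.val = θ k.castSucc := natExt_val θ k.castSucc
      simp [hv, hp]
    · intro k _
      have hv : natExt θ k.val = θ k.castSucc := natExt_val θ k.castSucc
      rw [hv]
      exact mul_nonneg (pow_nonneg (h0 _) _) (by linarith [h1 k])
  have hprob : IsProbabilityMeasure (μ.map fun ω k => wait Z k ω) :=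
    Measure.isProbabilityMeasure_map hWm.aemeasurable
  have hsing : ∀ w, Measure.pi (fun k => waitLaw (p k)) {w} ≤
      (μ.map fun ω k => wait Z k ω) {w} := by
    intro w
    by_cases hw : ∀ k, w k ≠ 0
    · have : w = fun k => (w k - 1) + 1 := by
        ext k
        have := hw k
        omega
      rw [this, ← hEμ, Measure.map_apply hWm (measurableSet_singleton _)]
      exact measure_mono fun ω hω => hE _ ω hω
    · push Not at hw
      obtain ⟨k, hk⟩ := hw
      rw [Measure.pi_singleton, Finset.prod_eq_zero (Finset.mem_univ k)]
      · exact zero_le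
      · rw [hk, waitLaw_zero]
  have hlaw : Measure.pi (fun k => waitLaw (p k)) = μ.map fun ω k => wait Z k ω := by
    refine Measure.eq_of_le_of_isProbabilityMeasure ?_
    refine Measure.le_iff.2 fun s hs => ?_
    rw [← Measure.tsum_indicator_apply_singleton _ s hs,
      ← Measure.tsum_indicator_apply_singleton _ s hs]
    exact ENNReal.tsum_le_tsum fun w => Set.indicator_le_indicator (hsing w)
  have hmarg : ∀ k, μ.map (wait Z k) = waitLaw (p k) := by
    intro k
    have : wait Z k = (fun w : Fin d → ℕ => w k) ∘ fun ω k => wait Z k ω := rfl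
    rw [this, ← Measure.map_map (measurable_pi_apply k) hWm, ← hlaw]
    exact (measurePreserving_eval _ k).map_eq
  refine ⟨?_, ?_, fun k n => ?_⟩
  -- The event that the waiting times equal w contains the corresponding cylinder and has the same
  -- probability, so almost surely the path is the pure-birth path. Vectors with a zero entry, which
  -- could arise from infinite hitting times through `toNat`, are null.
  · have hae : ∀ᵐ ω ∂μ, ∀ w : Fin d → ℕ, (fun k => wait Z k ω) = w → (∀ k, w k ≠ 0) ∧
        ω ∈ E (fun k => w k - 1) := by
      rw [ae_all_iff]
      intro w
      by_cases hw : ∀ k, w k ≠ 0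
      · have hw' : (fun k => (w k - 1) + 1) = w := by
          ext k
          have := hw k
          omega
        have hmE : MeasurableSet (E fun k => w k - 1) := measurableSet_fdd hZ.measurable _ _
        have h2 : μ ({ω | (fun k => wait Z k ω) = w} \ E (fun k => w k - 1)) = 0 := by
          have h4 : μ (E fun k => w k - 1) = μ {ω | (fun k => wait Z k ω) = w} := by
            refine (hEμ fun k => w k - 1).trans ?_
            rw [hw', hlaw, Measure.map_apply hWm (measurableSet_singleton _)]
            rfl
          rw [measure_sdiff (fun ω hω => by rw [← hw']; exact hE _ ω hω) hmE.nullMeasurableSet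
            (measure_ne_top _ _)]
          exact (congrArg _ h4).trans (tsub_self _)
        filter_upwards [measure_eq_zero_iff_ae_notMem.1 h2] with ω hω h
        refine ⟨hw, ?_⟩
        by_contra h'
        exact hω ⟨h, h'⟩
      · have h2 : μ {ω | (fun k => wait Z k ω) = w} = 0 := by
          have h3 := Measure.map_apply (μ := μ) hWm (measurableSet_singleton w)
          rw [← hlaw, Measure.pi_singleton] at h3
          push Not at hw
          obtain ⟨k, hk⟩ := hw
          rw [Finset.prod_eq_zero (Finset.mem_univ k) (by rw [hk, waitLaw_zero])] at h3
          exact h3.symm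
        filter_upwards [measure_eq_zero_iff_ae_notMem.1 h2] with ω hω h
        exact absurd h hω
    filter_upwards [hae] with ω hω
    obtain ⟨hw, hE'⟩ := hω _ rfl
    rw [hit_eq_of_path hE' (Fin.last d), birthTime, Fin.val_last, Finset.sum_range]
    congr 1
    refine Finset.sum_congr rfl fun k _ => ?_
    have := hw k
    simp only [Fin.is_lt, dif_pos, Fin.eta]
    omega
  · rw [iIndepFun_iff_map_fun_eq_pi_map
      fun k => (measurable_wait hZ.measurable k).aemeasurable]
    simp only [hmarg]
    exact hlaw.symm
  · have h2 : μ.real {ω | wait Z k ω = n + 1} = (waitLaw (p k)).real {n + 1} := by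
      rw [← hmarg, map_measureReal_apply (measurable_wait hZ.measurable k)
        (measurableSet_singleton _)]
      rfl
    rw [h2, measureReal_def, waitLaw_succ (hp0 k), ENNReal.toReal_ofReal]
    · simp [hp]
    · exact mul_nonneg (pow_nonneg (by simp [hp, h0]) _) (by simp [hp, (h1 k).le])

end Waits

/-! ### Discrete time: conclusion -/

section DiscreteMain

variable {d : ℕ} {P : Matrix (State d) (State d) ℝ} {θ : State d → ℝ}
  {Ω : Type*} [MeasurableSpace Ω] {μ : Measure Ω} [IsProbabilityMeasure μ]
  {X : ℕ → Ω → State d} {U : ℕ → Ω → ℝ} {Xh : ℕ → Ω → State d}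

/-- Joint distributions along consecutive times determine those along all times. -/
lemma joint_fdd_of_consecutive {Y : ℕ → Ω → State d} (hY : ∀ t, Measurable (Y t)) {B : Set Ω}
    {N : ℕ} {c : State d → ℝ}
    (h : ∀ z : ℕ → State d, μ.real {ω | (∀ i ≤ N, Y i ω = z i) ∧ ω ∈ B} =
      μ.real {ω | ∀ i ≤ N, Y i ω = z i} * c (z N))
    {n : ℕ} {t : ℕ → ℕ} (ht : Monotone t) (htn : t n = N) (x : ℕ → State d) :
    μ.real {ω | (∀ i ≤ n, Y (t i) ω = x i) ∧ ω ∈ B} =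
      μ.real {ω | ∀ i ≤ n, Y (t i) ω = x i} * c (x n) := by
  have hW : Measurable fun ω (i : Fin (N + 1)) => Y i ω := measurable_pi_lambda _ fun i => hY _
  rw [measureReal_eq_sum_fiber μ hW, measureReal_eq_sum_fiber μ hW, Finset.sum_mul]
  refine Finset.sum_congr rfl fun w _ => ?_
  set z : ℕ → State d := fun i => w ⟨min i N, by omega⟩ with hz
  have hzw : ∀ ω, (fun i : Fin (N + 1) => Y i ω) = w ↔ ∀ i ≤ N, Y i ω = z i := by
    intro ω
    exact Set.ext_iff.1 (preimage_singleton_eq_fdd Y N w) ω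
  have hti : ∀ i ≤ n, t i ≤ N := fun i hi => htn ▸ ht hi
  by_cases hx : ∀ i ≤ n, z (t i) = x i
  · have e1 : {ω | ω ∈ {ω | (∀ i ≤ n, Y (t i) ω = x i) ∧ ω ∈ B} ∧
        (fun i : Fin (N + 1) => Y i ω) = w} = {ω | (∀ i ≤ N, Y i ω = z i) ∧ ω ∈ B} := by
      ext ω
      simp only [Set.mem_ofPred_eq, hzw]
      constructor
      · rintro ⟨⟨-, h1⟩, h2⟩
        exact ⟨h2, h1⟩
      · rintro ⟨h1, h2⟩
        exact ⟨⟨fun i hi => by rw [h1 _ (hti i hi), hx i hi], h2⟩, h1⟩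
    have e2 : {ω | ω ∈ {ω | ∀ i ≤ n, Y (t i) ω = x i} ∧
        (fun i : Fin (N + 1) => Y i ω) = w} = {ω | ∀ i ≤ N, Y i ω = z i} := by
      ext ω
      simp only [Set.mem_ofPred_eq, hzw]
      constructor
      · rintro ⟨-, h2⟩
        exact h2
      · intro h1
        exact ⟨fun i hi => by rw [h1 _ (hti i hi), hx i hi], h1⟩
    rw [e1, e2, h z, ← hx n le_rfl, htn]
  · have e1 : {ω | ω ∈ {ω | (∀ i ≤ n, Y (t i) ω = x i) ∧ ω ∈ B} ∧
        (fun i : Fin (N + 1) => Y i ω) = w} = ∅ := by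
      ext ω
      simp only [Set.mem_ofPred_eq, hzw, Set.mem_empty_iff_false, iff_false]
      rintro ⟨⟨h1, -⟩, h2⟩
      exact hx fun i hi => by rw [← h1 i hi, h2 _ (hti i hi)]
    have e2 : {ω | ω ∈ {ω | ∀ i ≤ n, Y (t i) ω = x i} ∧
        (fun i : Fin (N + 1) => Y i ω) = w} = ∅ := by
      ext ω
      simp only [Set.mem_ofPred_eq, hzw, Set.mem_empty_iff_false, iff_false]
      rintro ⟨h1, h2⟩
      exact hx fun i hi => by rw [← h1 i hi, h2 _ (hti i hi)]
    rw [e1, e2]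
    simp

/-- Everything is read off from the joint law: summing over y gives the chain, factoring gives the
conditional law, and the support of the link gives the order and the common hitting time. -/
theorem discrete_sample_path (hP : IsKernel P) (hm : Monotone θ) (he : HasEigenvalues P θ)
    (hθ : ∀ i, 0 ≤ θ i) (hX : IsChain μ X P) (hU : IsIndependentNoise μ X U unifMeasure)
    (hXh : ∀ t ω, Xh t ω = dualPath (genLink P 1 θ) θ (fun s => X s ω) (fun n => U n ω) t) :
    IsChain μ Xh (genSpectral 1 θ) ∧
    SamplePathIntertwined μ X Xh (genLink P 1 θ) ∧
    (∀ᵐ ω ∂μ, ∀ t, 0 < genLink P 1 θ (Xh t ω) (X t ω) ∧ X t ω ≤ Xh t ω) ∧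
    (∀ᵐ ω ∂μ, hit X (Fin.last d) ω = hit Xh (Fin.last d) ω) ∧
    (∀ᵐ ω ∂μ, hit X (Fin.last d) ω = ((∑ k : Fin d, wait Xh k ω : ℕ) : ℕ∞)) ∧
    iIndepFun (fun k : Fin d => wait Xh k) μ ∧
    (∀ (k : Fin d) (n : ℕ), μ.real {ω | wait Xh k ω = n + 1} =
      θ k.castSucc ^ n * (1 - θ k.castSucc)) := by
  have hA := hP.isBirthDeath
  have hL := genLink_stochastic hA hm he
  have hT := fun i j => genLink_triangular (θ := θ) hA i j
  have hlast := genLink_last hA hm he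
  have hjoint := discrete_joint_fdd hP hm he hθ hX hU hXh
  have hmXh : ∀ t, Measurable (Xh t) := by
    intro t
    have h1 : Xh t = (fun q : (ℕ → State d) × (ℕ → ℝ) => dualPath (genLink P 1 θ) θ q.1 q.2 t) ∘
        fun ω => (fun s => X s ω, fun n => U n ω) := by
      ext1 ω
      exact hXh t ω
    rw [h1]
    exact (measurable_dualPath _ _ t).comp ((measurable_pi_lambda _ hX.measurable).prodMk
      (measurable_pi_lambda _ hU.measurable))
  have hchain : IsChain μ Xh (genSpectral 1 θ) := by
    refine ⟨hmXh, fun n z => ?_⟩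
    rw [measureReal_eq_sum_fiber μ (hX.measurable n)]
    have h1 : ∀ y, μ.real {ω | ω ∈ {ω | ∀ i ≤ n, Xh i ω = z i} ∧ X n ω = y} = _ := hjoint n z
    rw [Finset.sum_congr rfl fun y _ => h1 y, ← Finset.mul_sum,
      Matrix.sum_row_of_mem_rowStochastic hL, mul_one]
  have hj : ∀ (n : ℕ) (t : ℕ → ℕ) (x : ℕ → State d) (y : State d), Monotone t → t 0 = ⊥ →
      μ.real {ω | (∀ i ≤ n, Xh (t i) ω = x i) ∧ X (t n) ω = y} =
        μ.real {ω | ∀ i ≤ n, Xh (t i) ω = x i} * genLink P 1 θ (x n) y := by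
    intro n t x y ht _
    refine joint_fdd_of_consecutive (B := {ω | X (t n) ω = y}) (c := fun x => genLink P 1 θ x y)
      hmXh (fun z => ?_) ht rfl x
    rw [hchain.fdd]
    exact hjoint (t n) z y
  have hpos : ∀ᵐ ω ∂μ, ∀ t, 0 < genLink P 1 θ (Xh t ω) (X t ω) :=
    ae_all_iff.2 fun t => ae_link_pos_of_fdd μ X Xh _ hL.1 hj t
  have hhit : ∀ᵐ ω ∂μ, hit X (Fin.last d) ω = hit Xh (Fin.last d) ω := by
    filter_upwards [hpos] with ω hω
    have := fun t => eq_last_iff_of_link_pos hL hT hlast (hω t)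
    simp only [hit, this]
  obtain ⟨hw1, hw2, hw3⟩ := discrete_waits hchain hθ fun i =>
    hA.eigenvalue_lt hm he i.castSucc i.is_lt
  refine ⟨hchain, samplePathIntertwined_of_fdd μ X Xh hX.measurable hmXh _ hL.1 hj, ?_, hhit, ?_,
    hw2, hw3⟩
  · filter_upwards [hpos] with ω hω t
    exact ⟨hω t, le_of_link_pos hT (hω t)⟩
  · filter_upwards [hhit, hw1] with ω h1 h2
    rw [h1, h2]

end DiscreteMain

/-! ### Paths that are right-continuous with left limits -/

/-- Right-continuous paths with left limits, in the discrete state space. -/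
structure IsCadlag {d : ℕ} (p : ℝ≥0 → State d) : Prop where
  right_cont : ∀ t, ∀ᶠ s in 𝓝[>] t, p s = p t
  left_lim : ∀ t, ∃ y, ∀ᶠ s in 𝓝[<] t, p s = y

section Paths

variable {d : ℕ} {p : ℝ≥0 → State d}

lemma IsCadlag.exists_const_right (hp : IsCadlag p) (t : ℝ≥0) :
    ∃ u, t < u ∧ ∀ s, t ≤ s → s < u → p s = p t := by
  have h := hp.right_cont t
  rw [eventually_iff, mem_nhdsGT_iff_exists_Ioo_subset] at h
  obtain ⟨u, hu, h⟩ := h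
  refine ⟨u, hu, fun s h1 h2 => ?_⟩
  rcases h1.eq_or_lt with rfl | h1
  · rfl
  · exact h ⟨h1, h2⟩

lemma IsCadlag.exists_const_left (hp : IsCadlag p) {t : ℝ≥0} (ht : 0 < t) :
    ∃ u < t, ∃ y, ∀ s, u < s → s < t → p s = y := by
  obtain ⟨y, h⟩ := hp.left_lim t
  rw [eventually_iff, mem_nhdsLT_iff_exists_Ioo_subset' ht] at h
  obtain ⟨u, hu, h⟩ := h
  exact ⟨u, hu, y, fun s h1 h2 => h ⟨h1, h2⟩⟩

lemma eq_of_lt_nextJump {s t : ℝ≥0} (h : s ≤ t) (ht : (t : ℝ≥0∞) < nextJump p s) :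
    p t = p s := by
  by_contra hne
  have hlt : s < t := lt_of_le_of_ne h fun h' => hne (by rw [h'])
  exact absurd (iInf₂_le (f := fun (t : ℝ≥0) (_ : s < t ∧ p t ≠ p s) => (t : ℝ≥0∞)) t ⟨hlt, hne⟩)
    (not_le.2 ht)

lemma le_nextJump_of_const {s u : ℝ≥0} (h : ∀ t, s ≤ t → t < u → p t = p s) :
    (u : ℝ≥0∞) ≤ nextJump p s := by
  refine le_iInf₂ fun t ht => ?_
  by_contra hlt
  exact ht.2 (h t ht.1.le (by exact_mod_cast not_le.1 hlt))

/-- Right-continuity at `s'` extends the constancy strictly beyond `s'`, which makes the inequality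
strict. -/
lemma lt_nextJump_of_const (hp : IsCadlag p) {s s' : ℝ≥0} (hs : s ≤ s')
    (h : ∀ t, s ≤ t → t ≤ s' → p t = p s) : (s' : ℝ≥0∞) < nextJump p s := by
  obtain ⟨u, hu, h'⟩ := hp.exists_const_right s'
  refine lt_of_lt_of_le (ENNReal.coe_lt_coe.2 hu) (le_nextJump_of_const fun t h1 h2 => ?_)
  rcases le_total t s' with h3 | h3
  · exact h t h1 h3
  · rw [h' t h3 h2, h s' hs le_rfl]

lemma lt_nextJump (hp : IsCadlag p) (s : ℝ≥0) : (s : ℝ≥0∞) < nextJump p s :=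
  lt_nextJump_of_const hp le_rfl fun t h1 h2 => by rw [le_antisymm h2 h1]

/-- The infimum is attained: otherwise the path would be constant up to and including that time,
hence a little longer. -/
lemma nextJump_ne (hp : IsCadlag p) {s : ℝ≥0} (h : nextJump p s ≠ ⊤) :
    p (nextJump p s).toNNReal ≠ p s := by
  intro heq
  set J := (nextJump p s).toNNReal with hJ
  have hJc : (J : ℝ≥0∞) = nextJump p s := ENNReal.coe_toNNReal h
  have hsJ : s ≤ J := by
    have := (lt_nextJump hp s).le
    rw [← hJc] at this
    exact_mod_cast this
  have := lt_nextJump_of_const hp hsJ fun t h1 h2 => by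
    rcases h2.eq_or_lt with rfl | h2
    · exact heq
    · exact eq_of_lt_nextJump h1 (by rw [← hJc]; exact_mod_cast h2)
  rw [hJc] at this
  exact lt_irrefl _ this

lemma nextJump_congr {s s' : ℝ≥0} (hs : s ≤ s') (h : (s' : ℝ≥0∞) < nextJump p s) :
    nextJump p s' = nextJump p s := by
  have heq := eq_of_lt_nextJump hs h
  refine le_antisymm (le_iInf₂ fun t ht => iInf₂_le t ⟨?_, by rw [heq]; exact ht.2⟩)
    (le_iInf₂ fun t ht => iInf₂_le t ⟨lt_of_le_of_lt hs ht.1, by rw [← heq]; exact ht.2⟩)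
  by_contra hlt
  exact ht.2 (eq_of_lt_nextJump ht.1.le
    (lt_of_le_of_lt (ENNReal.coe_le_coe.2 (not_lt.1 hlt)) h))

lemma nextJump_eq {s J : ℝ≥0} (hs : s < J) (h : ∀ t, s ≤ t → t < J → p t = p s)
    (hJ : p J ≠ p s) : nextJump p s = J :=
  le_antisymm (iInf₂_le J ⟨hs, hJ⟩) (le_nextJump_of_const h)

/-- On a bounded interval, short cells see at most one jump, out of a finite set of times. -/
lemma IsCadlag.exists_cells (hp : IsCadlag p) (T : ℝ≥0) :
    ∃ δ : ℝ, 0 < δ ∧ ∃ F : Finset ℝ≥0, ∀ s s' : ℝ≥0, s ≤ s' → s' ≤ T → (s' : ℝ) - s < δ →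
      (∀ t, s ≤ t → t ≤ s' → p t = p s) ∨
        ∃ J ∈ F, s < J ∧ J ≤ s' ∧ (∀ t, s ≤ t → t < J → p t = p s) ∧
          (∀ t, J ≤ t → t ≤ s' → p t = p J) ∧ p J ≠ p s := by
  -- Around each t the path has one value just before t and one from t on, so t is the only possible
  -- jump nearby. By compactness finitely many such centres suffice; they form F, and δ is a
  -- Lebesgue number of the cover.
  have hloc : ∀ t : ℝ≥0, ∃ ε : ℝ, 0 < ε ∧
      (∃ y, ∀ s : ℝ≥0, (t : ℝ) - ε < s → s < t → p s = y) ∧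
      ∀ s : ℝ≥0, t ≤ s → (s : ℝ) < t + ε → p s = p t := by
    intro t
    obtain ⟨u, hu, h1⟩ := hp.exists_const_right t
    have hu' : (0 : ℝ) < u - t := sub_pos.2 (by exact_mod_cast hu)
    rcases eq_zero_or_pos t with rfl | ht
    · refine ⟨u - (0 : ℝ≥0), hu', ⟨p 0, fun s _ h => absurd h not_lt_zero⟩, fun s h h2 => h1 s h ?_⟩
      have : (s : ℝ) < u := by linarith
      exact_mod_cast this
    · obtain ⟨v, hv, y, h2⟩ := hp.exists_const_left ht
      have hv' : (0 : ℝ) < t - v := sub_pos.2 (by exact_mod_cast hv)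
      refine ⟨min (u - t : ℝ) (t - v : ℝ), lt_min hu' hv', ⟨y, fun s h3 h4 => h2 s ?_ h4⟩,
        fun s h3 h4 => h1 s h3 ?_⟩
      · have : (v : ℝ) < s := by linarith [min_le_right (u - t : ℝ) (t - v : ℝ)]
        exact_mod_cast this
      · have : (s : ℝ) < u := by linarith [min_le_left (u - t : ℝ) (t - v : ℝ)]
        exact_mod_cast this
  choose ε hε hleft hright using hloc
  have hcomp : IsCompact (Set.Icc (0 : ℝ≥0) T) := isCompact_Icc
  obtain ⟨F, hF⟩ := hcomp.elim_nhds_subcover' (fun t _ => Metric.ball t (ε t))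
    (fun t _ => Metric.ball_mem_nhds t (hε t))
  obtain ⟨δ, hδ, hleb⟩ := lebesgue_number_lemma_of_metric hcomp
    (c := fun t : F => Metric.ball (t : Set.Icc (0 : ℝ≥0) T).1 (ε (t : Set.Icc (0 : ℝ≥0) T).1))
    (fun _ => Metric.isOpen_ball) (by
      intro x hx
      have := hF hx
      simp only [Set.mem_iUnion] at this ⊢
      obtain ⟨t, ht, h⟩ := this
      exact ⟨⟨t, ht⟩, h⟩)
  classical
  refine ⟨δ, hδ, F.image Subtype.val, fun s s' hs hs' hlt => ?_⟩
  obtain ⟨⟨⟨t, htm⟩, htF⟩, hball⟩ := hleb s ⟨zero_le, hs.trans hs'⟩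
  simp only at hball
  have hmem : ∀ r : ℝ≥0, s ≤ r → r ≤ s' → |(r : ℝ) - t| < ε t := by
    intro r h1 h2
    have h1' : (s : ℝ) ≤ r := by exact_mod_cast h1
    have h2' : (r : ℝ) ≤ s' := by exact_mod_cast h2
    have : r ∈ Metric.ball s δ := by
      rw [Metric.mem_ball, NNReal.dist_eq, abs_of_nonneg (by linarith)]
      linarith
    have := hball this
    rwa [Metric.mem_ball, NNReal.dist_eq] at this
  obtain ⟨y, hy⟩ := hleft t
  have hL : ∀ r : ℝ≥0, s ≤ r → r ≤ s' → r < t → p r = y := fun r h1 h2 h3 =>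
    hy r (by linarith [(abs_lt.1 (hmem r h1 h2)).1]) h3
  have hR : ∀ r : ℝ≥0, s ≤ r → r ≤ s' → t ≤ r → p r = p t := fun r h1 h2 h3 =>
    hright t r h3 (by linarith [(abs_lt.1 (hmem r h1 h2)).2])
  rcases le_or_gt t s with hts | hts
  · left
    intro r h1 h2
    rw [hR r h1 h2 (hts.trans h1), hR s le_rfl hs hts]
  · rcases lt_or_ge s' t with hts' | hts'
    · left
      intro r h1 h2
      rw [hL r h1 h2 (lt_of_le_of_lt h2 hts'), hL s le_rfl hs hts]
    · by_cases hpt : p t = p s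
      · left
        intro r h1 h2
        rcases lt_or_ge r t with h3 | h3
        · rw [hL r h1 h2 h3, hL s le_rfl hs hts]
        · rw [hR r h1 h2 h3, hpt]
      · right
        refine ⟨t, Finset.mem_image.2 ⟨_, htF, rfl⟩, hts, hts', fun r h1 h2 => ?_,
          fun r h1 h2 => hR r (hts.le.trans h1) h2 h1, hpt⟩
        rw [hL r h1 (h2.le.trans hts') h2, hL s le_rfl hs hts]

end Paths

/-! ### The skeleton of the continuous-time construction -/

section Skeleton

variable {d : ℕ} (Λ : Matrix (State d) (State d) ℝ) (ν : State d → ℝ)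

/-- The rate of the clock. -/
def clockRate (xh x : State d) : ℝ := ν xh * Λ (up xh) x / Λ xh x

/-- The reaction of `X̂` to a jump of `X` to `y`. -/
def jumpMap (y xh : State d) : State d := if y.val = xh.val + 1 then up xh else xh

/-- The time at which the clock rings. -/
def ringTime (p : ℝ≥0 → State d) (e : ℝ) (s : ℝ≥0) (xh : State d) : ℝ≥0∞ :=
  if 0 < clockRate Λ ν xh (p s) then s + ENNReal.ofReal (e / clockRate Λ ν xh (p s)) else ⊤

/-- The jump times and values from the initial condition `z`. -/
def skelFrom (p : ℝ≥0 → State d) (e : ℕ → ℝ) (z : ℝ≥0∞ × State d) : ℕ → ℝ≥0∞ × State d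
  | 0 => z
  | n + 1 => dualStep Λ ν p (e n) (skelFrom p e z n)

variable {Λ ν} {p : ℝ≥0 → State d}

lemma dualStep_coe (e : ℝ) (s : ℝ≥0) (xh : State d) :
    dualStep Λ ν p e ((s : ℝ≥0∞), xh) =
      if ringTime Λ ν p e s xh < nextJump p s then (ringTime Λ ν p e s xh, up xh)
      else if nextJump p s = ⊤ then (⊤, xh)
      else (nextJump p s, jumpMap (p (nextJump p s).toNNReal) xh) := by
  simp only [dualStep, ENNReal.coe_ne_top, if_false, ENNReal.toNNReal_coe]
  rfl

lemma dualStep_top (e : ℝ) (xh : State d) : dualStep Λ ν p e (⊤, xh) = (⊤, xh) := by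
  simp [dualStep]

lemma dualSkeleton_eq (e : ℕ → ℝ) (n : ℕ) :
    dualSkeleton Λ ν p e n = skelFrom Λ ν p e (0, 0) n := by
  induction n with
  | zero => rfl
  | succ n ih => rw [dualSkeleton, ih, skelFrom]

lemma skelFrom_shift (e : ℕ → ℝ) (z : ℝ≥0∞ × State d) (n : ℕ) :
    skelFrom Λ ν p e z (n + 1) =
      skelFrom Λ ν p (fun i => e (i + 1)) (dualStep Λ ν p (e 0) z) n := by
  induction n with
  | zero => rfl
  | succ n ih => rw [skelFrom, ih, skelFrom]

lemma le_ringTime (e : ℝ) (s : ℝ≥0) (xh : State d) : (s : ℝ≥0∞) ≤ ringTime Λ ν p e s xh := by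
  unfold ringTime
  split_ifs
  · exact le_self_add
  · exact le_top

lemma lt_ringTime {e : ℝ} (he : 0 < e) (s : ℝ≥0) (xh : State d) :
    (s : ℝ≥0∞) < ringTime Λ ν p e s xh := by
  unfold ringTime
  split_ifs with h
  · exact ENNReal.lt_add_right ENNReal.coe_ne_top (by simpa using div_pos he h)
  · exact ENNReal.coe_lt_top

lemma le_dualStep (hp : IsCadlag p) (e : ℝ) (z : ℝ≥0∞ × State d) :
    z.1 ≤ (dualStep Λ ν p e z).1 := by
  obtain ⟨s, xh⟩ := z
  induction s with
  | top => rw [dualStep_top]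
  | coe s =>
    rw [dualStep_coe]
    split_ifs
    · exact le_ringTime e s xh
    · exact le_top
    · exact (lt_nextJump hp s).le

lemma lt_dualStep (hp : IsCadlag p) {e : ℝ} (he : 0 < e) (s : ℝ≥0) (xh : State d) :
    (s : ℝ≥0∞) < (dualStep Λ ν p e ((s : ℝ≥0∞), xh)).1 := by
  rw [dualStep_coe]
  split_ifs
  · exact lt_ringTime he s xh
  · exact ENNReal.coe_lt_top
  · exact lt_nextJump hp s

lemma skelFrom_monotone (hp : IsCadlag p) (e : ℕ → ℝ) (z : ℝ≥0∞ × State d) :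
    Monotone fun n => (skelFrom Λ ν p e z n).1 :=
  monotone_nat_of_le_succ fun n => le_dualStep hp (e n) _

lemma le_up (x : State d) : x ≤ up x := by
  rw [Fin.le_def]
  simp only [up]
  omega

lemma le_jumpMap (y x : State d) : x ≤ jumpMap y x := by
  unfold jumpMap
  split_ifs
  · exact le_up x
  · exact le_rfl

lemma dualStep_snd_ge (e : ℝ) (z : ℝ≥0∞ × State d) : z.2 ≤ (dualStep Λ ν p e z).2 := by
  obtain ⟨s, xh⟩ := z
  induction s with
  | top => rw [dualStep_top]
  | coe s =>
    rw [dualStep_coe]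
    split_ifs
    · exact le_up xh
    · exact le_rfl
    · exact le_jumpMap _ xh

/-- The construction does not explode. -/
lemma exists_lt_skelFrom (hp : IsCadlag p) (hr : ∀ x, clockRate Λ ν (Fin.last d) x ≤ 0)
    (e : ℕ → ℝ) (z : ℝ≥0∞ × State d) (t : ℝ≥0) : ∃ n, (t : ℝ≥0∞) < (skelFrom Λ ν p e z n).1 := by
  by_contra hcon
  push Not at hcon
  set S := skelFrom Λ ν p e z with hS
  let s : ℕ → ℝ≥0 := fun n => (S n).1.toNNReal
  have hs : ∀ n, (s n : ℝ≥0∞) = (S n).1 := fun n =>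
    ENNReal.coe_toNNReal (ne_top_of_le_ne_top ENNReal.coe_ne_top (hcon n))
  have hst : ∀ n, s n ≤ t := fun n => by
    have := hcon n
    rw [← hs] at this
    exact_mod_cast this
  have hmono : Monotone fun n => (S n).2 := monotone_nat_of_le_succ fun n => dualStep_snd_ge (e n) _
  -- X̂ increases in a finite set, so it is constant from some step M on. From then on no clock
  -- rings, and each step is a jump of X.
  obtain ⟨M, hM⟩ : ∃ M, ∀ n, (S n).2 ≤ (S M).2 := by
    have hfin : (Set.range fun n => (S n).2).Finite := Set.toFinite _
    obtain ⟨_, ⟨M, rfl⟩, hM⟩ := hfin.exists_maximal ⟨_, ⟨0, rfl⟩⟩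
    exact ⟨M, fun n => (le_total (S n).2 (S M).2).elim id fun h => hM ⟨n, rfl⟩ h⟩
  have hstep : ∀ n, M ≤ n → s n < s (n + 1) ∧ p (s (n + 1)) ≠ p (s n) := by
    intro n hn
    have heq : (S (n + 1)).2 = (S n).2 :=
      le_antisymm ((hM _).trans (hmono hn)) (hmono (Nat.le_succ n))
    have hSn : S (n + 1) = dualStep Λ ν p (e n) ((s n : ℝ≥0∞), (S n).2) := by
      rw [hs]
      rfl
    have hne : (S (n + 1)).1 ≠ ⊤ := by
      rw [← hs]
      exact ENNReal.coe_ne_top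
    rw [dualStep_coe] at hSn
    split_ifs at hSn with h1 h2
    · exfalso
      rw [hSn] at heq
      by_cases hx : (S n).2.val < d
      · exact up_ne hx heq
      · rw [eq_last_of_not_lt hx, ringTime, if_neg (not_lt.2 (hr _))] at h1
        exact not_top_lt h1
    · rw [hSn] at hne
      exact absurd rfl hne
    · have h3 : s (n + 1) = (nextJump p (s n)).toNNReal := by simp only [s, hSn]
      rw [h3]
      refine ⟨?_, nextJump_ne hp h2⟩
      have := lt_nextJump hp (s n)
      rw [← ENNReal.coe_toNNReal h2] at this
      exact_mod_cast this
  have hbdd : BddAbove (Set.range fun n => s (M + n)) := ⟨t, by rintro _ ⟨n, rfl⟩; exact hst _⟩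
  set T := ⨆ n, s (M + n) with hT
  have hlt : ∀ n, s (M + n) < T := fun n =>
    lt_of_lt_of_le (hstep (M + n) (by omega)).1 (le_ciSup hbdd (n + 1))
  -- Infinitely many jumps of X accumulating at T from below contradict the left limit at T.
  obtain ⟨u, hu, y, hy⟩ := hp.exists_const_left (lt_of_le_of_lt zero_le (hlt 0))
  obtain ⟨n, hn⟩ := exists_lt_of_lt_ciSup hu
  have h1 := hstep (M + n) (by omega)
  exact h1.2 ((hy _ (hn.trans h1.1) (hlt (n + 1))).trans (hy _ hn (hlt n)).symm)

lemma exists_mem_skelFrom (hp : IsCadlag p) (hr : ∀ x, clockRate Λ ν (Fin.last d) x ≤ 0)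
    (e : ℕ → ℝ) (z : ℝ≥0∞ × State d) (t : ℝ≥0) (hz : z.1 ≤ t) :
    ∃ n, (skelFrom Λ ν p e z n).1 ≤ t ∧ (t : ℝ≥0∞) < (skelFrom Λ ν p e z (n + 1)).1 := by
  have hex := exists_lt_skelFrom hp hr e z t
  classical
  have h0 : Nat.find hex ≠ 0 := by
    intro h
    have := Nat.find_spec hex
    rw [h] at this
    exact absurd hz (not_le.2 this)
  refine ⟨Nat.find hex - 1, not_lt.1 (Nat.find_min hex (by omega)), ?_⟩
  have := Nat.find_spec hex
  rwa [show Nat.find hex - 1 + 1 = Nat.find hex by omega]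

lemma skelFrom_index_unique (hp : IsCadlag p) {e : ℕ → ℝ} {z : ℝ≥0∞ × State d} {t : ℝ≥0∞} {m n : ℕ}
    (hm : (skelFrom Λ ν p e z m).1 ≤ t) (hm' : t < (skelFrom Λ ν p e z (m + 1)).1)
    (hn : (skelFrom Λ ν p e z n).1 ≤ t) (hn' : t < (skelFrom Λ ν p e z (n + 1)).1) : m = n := by
  have hmono := skelFrom_monotone (Λ := Λ) (ν := ν) hp e z
  rcases lt_trichotomy m n with h | h | h
  · exact absurd (hm'.trans_le (hmono (show m + 1 ≤ n from h))) (not_lt.2 hn)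
  · exact h
  · exact absurd (hn'.trans_le (hmono (show n + 1 ≤ m from h))) (not_lt.2 hm)

lemma dualPathCont_eq (hp : IsCadlag p) {e : ℕ → ℝ} {t : ℝ≥0} {n : ℕ}
    (hn : (skelFrom Λ ν p e (0, 0) n).1 ≤ t)
    (hn' : (t : ℝ≥0∞) < (skelFrom Λ ν p e (0, 0) (n + 1)).1) :
    dualPathCont Λ ν p e t = (skelFrom Λ ν p e (0, 0) n).2 := by
  have hex : ∃ n, (dualSkeleton Λ ν p e n).1 ≤ t ∧
      (t : ℝ≥0∞) < (dualSkeleton Λ ν p e (n + 1)).1 :=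
    ⟨n, by rw [dualSkeleton_eq]; exact hn, by rw [dualSkeleton_eq]; exact hn'⟩
  classical
  rw [dualPathCont, dif_pos hex, dualSkeleton_eq]
  have h := Nat.find_spec hex
  rw [dualSkeleton_eq, dualSkeleton_eq] at h
  congr 1
  have : Nat.find hex = n := skelFrom_index_unique hp h.1 h.2 hn hn'
  convert! congrArg _ this

/-- The constructed path is right-continuous with left limits. -/
theorem isCadlag_dualPathCont (hp : IsCadlag p) (hr : ∀ x, clockRate Λ ν (Fin.last d) x ≤ 0)
    (e : ℕ → ℝ) : IsCadlag (dualPathCont Λ ν p e) := by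
  refine ⟨fun t => ?_, fun t => ?_⟩
  · obtain ⟨n, h1, h2⟩ := exists_mem_skelFrom hp hr e (0, 0) t zero_le
    obtain ⟨u, hu, hu'⟩ := ENNReal.lt_iff_exists_nnreal_btwn.1 h2
    filter_upwards [Ioo_mem_nhdsGT (show t < u by exact_mod_cast hu)] with s hs
    rw [dualPathCont_eq hp h1 h2, dualPathCont_eq hp (n := n)]
    · exact h1.trans (by exact_mod_cast hs.1.le)
    · exact lt_trans (by exact_mod_cast hs.2) hu'
  · rcases eq_zero_or_pos t with rfl | ht
    · exact ⟨0, by simp⟩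
    · have hex : ∃ n, (t : ℝ≥0∞) ≤ (skelFrom Λ ν p e (0, 0) n).1 :=
        (exists_lt_skelFrom hp hr e (0, 0) t).imp fun n h => h.le
      classical
      have h0 : Nat.find hex ≠ 0 := by
        intro h
        have := Nat.find_spec hex
        rw [h] at this
        exact absurd this (not_le.2 (by simpa [skelFrom] using ht))
      set n := Nat.find hex - 1 with hn
      have h1 : (skelFrom Λ ν p e (0, 0) n).1 < t := not_le.1 (Nat.find_min hex (by omega))
      have h2 : (t : ℝ≥0∞) ≤ (skelFrom Λ ν p e (0, 0) (n + 1)).1 := by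
        rw [show n + 1 = Nat.find hex by omega]
        exact Nat.find_spec hex
      obtain ⟨u, hu, hu'⟩ := ENNReal.lt_iff_exists_nnreal_btwn.1 h1
      refine ⟨(skelFrom Λ ν p e (0, 0) n).2, ?_⟩
      filter_upwards [Ioo_mem_nhdsLT (show u < t by exact_mod_cast hu')] with s hs
      rw [dualPathCont_eq hp (n := n)]
      · exact hu.le.trans (by exact_mod_cast hs.1.le)
      · exact lt_of_lt_of_le (by exact_mod_cast hs.2) h2

end Skeleton

/-! ### Measurability of the continuous-time construction -/

/-- The space of paths that are right-continuous with left limits. -/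
abbrev CadlagPath (d : ℕ) : Type := {p : ℝ≥0 → State d // IsCadlag p}

lemma exists_denseSeq_between {a b : ℝ≥0} (h : a < b) :
    ∃ n, a < TopologicalSpace.denseSeq ℝ≥0 n ∧ TopologicalSpace.denseSeq ℝ≥0 n < b := by
  obtain ⟨_, ⟨n, rfl⟩, h⟩ := (TopologicalSpace.denseRange_denseSeq ℝ≥0).exists_between h
  exact ⟨n, h.1, h.2⟩

lemma measurable_eval_coe {d : ℕ} (v : ℝ≥0) :
    Measurable fun q : CadlagPath d × ℝ≥0 => q.1.1 v :=
  (measurable_pi_apply v).comp (measurable_subtype_coe.comp measurable_fst)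

/-- By right-continuity, a path has value y at s exactly if it equals y at all points of a countable
dense set between s and some point of that set after s. Joint measurability in path and time is
needed because the construction evaluates X at random times. -/
lemma measurable_eval {d : ℕ} : Measurable fun q : CadlagPath d × ℝ≥0 => q.1.1 q.2 := by
  refine measurable_to_countable' fun y => ?_
  have hset : (fun q : CadlagPath d × ℝ≥0 => q.1.1 q.2) ⁻¹' {y} =
      ⋃ m, (Prod.snd ⁻¹' Set.Iio (TopologicalSpace.denseSeq ℝ≥0 m)) ∩
        ⋂ n, ((Prod.snd ⁻¹' Set.Ici (TopologicalSpace.denseSeq ℝ≥0 n)) ∪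
          {_q | TopologicalSpace.denseSeq ℝ≥0 m ≤ TopologicalSpace.denseSeq ℝ≥0 n} ∪
          (fun q : CadlagPath d × ℝ≥0 => q.1.1 (TopologicalSpace.denseSeq ℝ≥0 n)) ⁻¹' {y}) := by
    ext ⟨⟨p, hp⟩, s⟩
    simp only [Set.mem_preimage, Set.mem_singleton_iff, Set.mem_iUnion, Set.mem_inter_iff,
      Set.mem_Iio, Set.mem_iInter, Set.mem_union, Set.mem_Ici, Set.mem_ofPred_eq]
    obtain ⟨u, hu, hc⟩ := hp.exists_const_right s
    constructor
    · intro h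
      obtain ⟨m, hm1, hm2⟩ := exists_denseSeq_between hu
      refine ⟨m, hm1, fun n => ?_⟩
      by_cases h1 : TopologicalSpace.denseSeq ℝ≥0 n ≤ s
      · exact Or.inl (Or.inl h1)
      by_cases h2 : TopologicalSpace.denseSeq ℝ≥0 m ≤ TopologicalSpace.denseSeq ℝ≥0 n
      · exact Or.inl (Or.inr h2)
      · right
        rw [hc _ (not_le.1 h1).le ((not_le.1 h2).trans hm2), h]
    · rintro ⟨m, hm, h⟩
      obtain ⟨n, hn1, hn2⟩ := exists_denseSeq_between (lt_min hm hu)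
      rcases h n with (h1 | h1) | h1
      · exact absurd hn1 (not_lt.2 h1)
      · exact absurd (hn2.trans_le (min_le_left _ _)) (not_lt.2 h1)
      · rw [← hc _ hn1.le (hn2.trans_le (min_le_right _ _)), h1]
  rw [hset]
  refine MeasurableSet.iUnion fun m => (measurable_snd measurableSet_Iio).inter
    (MeasurableSet.iInter fun n => ((measurable_snd measurableSet_Ici).union
      (MeasurableSet.const _)).union (measurable_eval_coe _ (measurableSet_singleton y)))

lemma measurable_nextJump {d : ℕ} :
    Measurable fun q : CadlagPath d × ℝ≥0 => nextJump q.1.1 q.2 := by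
  refine measurable_of_Iio fun c => ?_
  have hset : (fun q : CadlagPath d × ℝ≥0 => nextJump q.1.1 q.2) ⁻¹' Set.Iio c =
      ⋃ n, (Prod.snd ⁻¹' Set.Iio (TopologicalSpace.denseSeq ℝ≥0 n)) ∩
        {_q | (TopologicalSpace.denseSeq ℝ≥0 n : ℝ≥0∞) < c} ∩
        {q : CadlagPath d × ℝ≥0 | q.1.1 (TopologicalSpace.denseSeq ℝ≥0 n) = q.1.1 q.2}ᶜ := by
    ext ⟨⟨p, hp⟩, s⟩
    simp only [Set.mem_preimage, Set.mem_Iio, Set.mem_iUnion, Set.mem_inter_iff,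
      Set.mem_ofPred_eq, Set.mem_compl_iff, nextJump, iInf_lt_iff]
    constructor
    · rintro ⟨t, ⟨h1, h2⟩, h3⟩
      obtain ⟨u, hu, hc⟩ := hp.exists_const_right t
      obtain ⟨v, hv, hv'⟩ := ENNReal.lt_iff_exists_nnreal_btwn.1 h3
      obtain ⟨n, hn1, hn2⟩ := exists_denseSeq_between (lt_min hu (ENNReal.coe_lt_coe.1 hv))
      refine ⟨n, ⟨h1.trans hn1, lt_trans ?_ hv'⟩, ?_⟩
      · exact_mod_cast hn2.trans_le (min_le_right _ _)
      · rw [hc _ hn1.le (hn2.trans_le (min_le_left _ _))]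
        exact h2
    · rintro ⟨n, ⟨h1, h2⟩, h3⟩
      exact ⟨_, ⟨h1, h3⟩, h2⟩
  rw [hset]
  exact MeasurableSet.iUnion fun n => ((measurable_snd measurableSet_Iio).inter
    (MeasurableSet.const _)).inter
      (measurableSet_eq_fun (measurable_eval_coe _) measurable_eval).compl

section Measurability

variable {d : ℕ} (Λ : Matrix (State d) (State d) ℝ) (ν : State d → ℝ)

lemma measurable_cadlag_apply {α : Type*} [MeasurableSpace α] {p : α → CadlagPath d}
    {s : α → ℝ≥0} (hp : Measurable p) (hs : Measurable s) : Measurable fun a => (p a).1 (s a) :=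
  measurable_eval.comp (hp.prodMk hs)

lemma measurable_cadlag_nextJump {α : Type*} [MeasurableSpace α] {p : α → CadlagPath d}
    {s : α → ℝ≥0} (hp : Measurable p) (hs : Measurable s) :
    Measurable fun a => nextJump (p a).1 (s a) :=
  measurable_nextJump.comp (hp.prodMk hs)

lemma measurable_dualStep {α : Type*} [MeasurableSpace α] {p : α → CadlagPath d} {e : α → ℝ}
    {z : α → ℝ≥0∞ × State d} (hp : Measurable p) (he : Measurable e) (hz : Measurable z) :
    Measurable fun a => dualStep Λ ν (p a).1 (e a) (z a) := by
  have hz1 : Measurable fun a => (z a).1 := measurable_fst.comp hz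
  have hz2 : Measurable fun a => (z a).2 := measurable_snd.comp hz
  have hs : Measurable fun a => (z a).1.toNNReal := ENNReal.measurable_toNNReal.comp hz1
  have hx : Measurable fun a => (p a).1 (z a).1.toNNReal := measurable_cadlag_apply hp hs
  have hr : Measurable fun a => clockRate Λ ν (z a).2 ((p a).1 (z a).1.toNNReal) :=
    (measurable_of_finite fun w : State d × State d => clockRate Λ ν w.1 w.2).comp (hz2.prodMk hx)
  have hup : Measurable fun a => up (z a).2 := (measurable_of_finite up).comp hz2
  have hJ : Measurable fun a => nextJump (p a).1 (z a).1.toNNReal :=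
    measurable_cadlag_nextJump hp hs
  have hJn : Measurable fun a => (nextJump (p a).1 (z a).1.toNNReal).toNNReal :=
    ENNReal.measurable_toNNReal.comp hJ
  have hJx : Measurable fun a => (p a).1 (nextJump (p a).1 (z a).1.toNNReal).toNNReal :=
    measurable_cadlag_apply hp hJn
  have hJm : Measurable fun a =>
      jumpMap ((p a).1 (nextJump (p a).1 (z a).1.toNNReal).toNNReal) (z a).2 :=
    (measurable_of_finite fun w : State d × State d => jumpMap w.1 w.2).comp (hJx.prodMk hz2)
  have hring : Measurable fun a => if 0 < clockRate Λ ν (z a).2 ((p a).1 (z a).1.toNNReal) then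
      (z a).1 + ENNReal.ofReal (e a / clockRate Λ ν (z a).2 ((p a).1 (z a).1.toNNReal)) else ⊤ :=
    Measurable.ite (measurableSet_lt measurable_const hr)
      (hz1.add (ENNReal.measurable_ofReal.comp (he.div hr))) measurable_const
  exact Measurable.ite (hz1 (measurableSet_singleton ⊤)) hz
    (Measurable.ite (measurableSet_lt hring hJ) (hring.prodMk hup)
      (Measurable.ite (hJ (measurableSet_singleton ⊤)) (measurable_const.prodMk hz2)
        (hJ.prodMk hJm)))

lemma measurable_skelFrom (z : ℝ≥0∞ × State d) (n : ℕ) :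
    Measurable fun q : CadlagPath d × (ℕ → ℝ) => skelFrom Λ ν q.1.1 q.2 z n := by
  induction n with
  | zero => exact measurable_const
  | succ n ih =>
    exact measurable_dualStep Λ ν measurable_fst ((measurable_pi_apply n).comp measurable_snd) ih

lemma measurable_dualPathCont (hr : ∀ x, clockRate Λ ν (Fin.last d) x ≤ 0) (t : ℝ≥0) :
    Measurable fun q : CadlagPath d × (ℕ → ℝ) => dualPathCont Λ ν q.1.1 q.2 t := by
  refine measurable_to_countable' fun y => ?_
  have hset : (fun q : CadlagPath d × (ℕ → ℝ) => dualPathCont Λ ν q.1.1 q.2 t) ⁻¹' {y} =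
      ⋃ n, {q : CadlagPath d × (ℕ → ℝ) | (skelFrom Λ ν q.1.1 q.2 (0, 0) n).1 ≤ t} ∩
        {q | (t : ℝ≥0∞) < (skelFrom Λ ν q.1.1 q.2 (0, 0) (n + 1)).1} ∩
        {q | (skelFrom Λ ν q.1.1 q.2 (0, 0) n).2 = y} := by
    ext ⟨⟨p, hp⟩, e⟩
    simp only [Set.mem_preimage, Set.mem_singleton_iff, Set.mem_iUnion, Set.mem_inter_iff,
      Set.mem_ofPred_eq]
    constructor
    · intro h
      obtain ⟨n, h1, h2⟩ := exists_mem_skelFrom hp hr e (0, 0) t zero_le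
      exact ⟨n, ⟨h1, h2⟩, by rw [← dualPathCont_eq hp h1 h2, h]⟩
    · rintro ⟨n, ⟨h1, h2⟩, h⟩
      rw [dualPathCont_eq hp h1 h2, h]
  rw [hset]
  refine MeasurableSet.iUnion fun n => ((measurableSet_le ?_ measurable_const).inter
    (measurableSet_lt measurable_const ?_)).inter ?_
  · exact measurable_fst.comp (measurable_skelFrom Λ ν (0, 0) n)
  · exact measurable_fst.comp (measurable_skelFrom Λ ν (0, 0) (n + 1))
  · exact (measurable_snd.comp (measurable_skelFrom Λ ν (0, 0) n)) (measurableSet_singleton y)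

end Measurability

/-! ### Splitting off the first clock -/

lemma map_cons_infinitePi (ρ : Measure ℝ) [IsProbabilityMeasure ρ] :
    (ρ.prod (Measure.infinitePi fun _ : ℕ => ρ)).map
        (fun q : ℝ × (ℕ → ℝ) => (fun n => Nat.casesOn n q.1 q.2 : ℕ → ℝ)) =
      Measure.infinitePi fun _ : ℕ => ρ := by
  classical
  have hm : Measurable (fun q : ℝ × (ℕ → ℝ) => (fun n => Nat.casesOn n q.1 q.2 : ℕ → ℝ)) := by
    refine measurable_pi_lambda _ fun n => ?_
    cases n with
    | zero => exact measurable_fst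
    | succ n => exact (measurable_pi_apply n).comp measurable_snd
  refine Measure.eq_infinitePi _ fun s t ht => ?_
  obtain ⟨N, hN⟩ : ∃ N, s ⊆ Finset.range (N + 1) :=
    ⟨s.sup id, fun i hi => Finset.mem_range.2 (Nat.lt_succ_of_le (Finset.le_sup (f := id) hi))⟩
  -- Padding by the whole line replaces the index set by an initial segment, from which index 0
  -- splits off and the rest is a shift.
  set t' : ℕ → Set ℝ := fun i => if i ∈ s then t i else Set.univ with ht'
  have ht'm : ∀ i, MeasurableSet (t' i) := by
    intro i
    simp only [ht']
    split_ifs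
    · exact ht i
    · exact MeasurableSet.univ
  have hprod : ∏ i ∈ s, ρ (t i) = ∏ i ∈ Finset.range (N + 1), ρ (t' i) := by
    rw [← Finset.prod_subset hN]
    · exact Finset.prod_congr rfl fun i hi => by simp [ht', hi]
    · intro i _ hi
      simp [ht', hi]
  have hpre : (fun q : ℝ × (ℕ → ℝ) => (fun n => Nat.casesOn n q.1 q.2 : ℕ → ℝ)) ⁻¹'
      (Set.pi s t) = t' 0 ×ˢ Set.pi (Finset.range N : Set ℕ) (fun i => t' (i + 1)) := by
    ext ⟨a, e⟩
    simp only [Set.mem_preimage, Set.mem_pi, Finset.mem_coe, Set.mem_prod, Finset.mem_range]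
    constructor
    · intro h
      refine ⟨?_, fun i _ => ?_⟩
      · by_cases h0 : 0 ∈ s
        · simpa [ht', h0] using h 0 h0
        · simp [ht', h0]
      · by_cases h0 : i + 1 ∈ s
        · simpa [ht', h0] using h (i + 1) h0
        · simp [ht', h0]
    · rintro ⟨h1, h2⟩ i hi
      cases i with
      | zero => simpa [ht', hi] using h1
      | succ i =>
        have := h2 i (by have := Finset.mem_range.1 (hN hi); omega)
        simpa [ht', hi] using this
  rw [Measure.map_apply hm (MeasurableSet.pi s.countable_toSet fun i _ => ht i), hpre,
    Measure.prod_prod, Measure.infinitePi_pi _ fun i _ => ht'm _, hprod, Finset.prod_range_succ',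
    mul_comm]

lemma map_shift_infinitePi (ρ : Measure ℝ) [IsProbabilityMeasure ρ] :
    (Measure.infinitePi fun _ : ℕ => ρ).map
        (fun e : ℕ → ℝ => (e 0, fun i => e (i + 1))) =
      ρ.prod (Measure.infinitePi fun _ : ℕ => ρ) := by
  have hm : Measurable (fun q : ℝ × (ℕ → ℝ) => (fun n => Nat.casesOn n q.1 q.2 : ℕ → ℝ)) := by
    refine measurable_pi_lambda _ fun n => ?_
    cases n with
    | zero => exact measurable_fst
    | succ n => exact (measurable_pi_apply n).comp measurable_snd
  have hm' : Measurable (fun e : ℕ → ℝ => (e 0, fun i => e (i + 1))) :=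
    (measurable_pi_apply 0).prodMk (measurable_pi_lambda _ fun i => measurable_pi_apply _)
  conv_lhs => rw [← map_cons_infinitePi ρ]
  rw [Measure.map_map hm' hm]
  exact Measure.map_id

/-- The law of a standard exponential variable. -/
abbrev clockLaw : Measure ℝ := expMeasure 1

instance : IsProbabilityMeasure clockLaw := isProbabilityMeasure_expMeasure one_pos

/-- The law of the sequence of clocks. -/
abbrev clocksLaw : Measure (ℕ → ℝ) := Measure.infinitePi fun _ : ℕ => clockLaw

lemma integral_clockLaw (f : ℝ → ℝ) :
    ∫ x, f x ∂clockLaw = ∫ x, (Set.Ioi 0).indicator (fun x => Real.exp (-x) * f x) x := by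
  have hm : Measurable (exponentialPDF 1) :=
    (measurable_exponentialPDFReal 1).ennreal_ofReal
  rw [clockLaw, expMeasure, gammaMeasure]
  change ∫ x, f x ∂(volume.withDensity (exponentialPDF 1)) = _
  rw [integral_withDensity_eq_integral_toReal_smul hm
    (Eventually.of_forall fun x => ENNReal.ofReal_lt_top)]
  refine integral_congr_ae ?_
  have h0 : ∀ᵐ x : ℝ, x ≠ 0 := by
    rw [ae_iff]
    simp
  filter_upwards [h0] with x hx
  rw [exponentialPDF_eq]
  rcases lt_or_gt_of_ne hx with h | h
  · rw [if_neg (not_le.2 h), Set.indicator_of_notMem (by simpa using h.le)]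
    simp
  · rw [if_pos h.le, Set.indicator_of_mem (by simpa using h), one_mul, one_mul,
      ENNReal.toReal_ofReal (Real.exp_pos _).le, smul_eq_mul]

/-- Lack of memory. -/
lemma setIntegral_clockLaw_Ioi (f : ℝ → ℝ) {c : ℝ} (hc : 0 ≤ c) :
    ∫ x in Set.Ioi c, f (x - c) ∂clockLaw = Real.exp (-c) * ∫ x, f x ∂clockLaw := by
  rw [← integral_indicator measurableSet_Ioi, integral_clockLaw, integral_clockLaw,
    ← integral_const_mul]
  refine Eq.trans ?_ (integral_sub_right_eq_self (fun x => Real.exp (-c) *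
    (Set.Ioi 0).indicator (fun x => Real.exp (-x) * f x) x) c)
  congr 1
  ext x
  by_cases hx : c < x
  · rw [Set.indicator_of_mem (Set.mem_Ioi.2 (lt_of_le_of_lt hc hx)),
      Set.indicator_of_mem (Set.mem_Ioi.2 hx), Set.indicator_of_mem (Set.mem_Ioi.2 (sub_pos.2 hx)),
      ← mul_assoc, ← Real.exp_add]
    ring_nf
  · rw [Set.indicator_of_notMem (s := Set.Ioi 0) (a := x - c) (by simpa using not_lt.1 hx)]
    by_cases hx0 : 0 < x
    · rw [Set.indicator_of_mem (by simpa using hx0),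
        Set.indicator_of_notMem (by simpa using not_lt.1 hx)]
      simp
    · rw [Set.indicator_of_notMem (by simpa using not_lt.1 hx0), mul_zero]

lemma clockLaw_real_Ioi {c : ℝ} (hc : 0 ≤ c) : clockLaw.real (Set.Ioi c) = Real.exp (-c) := by
  have := setIntegral_clockLaw_Ioi (fun _ => 1) hc
  simpa using this

lemma clockLaw_real_Iic {c : ℝ} (hc : 0 ≤ c) :
    clockLaw.real (Set.Iic c) = 1 - Real.exp (-c) := by
  rw [← Set.compl_Ioi, measureReal_compl measurableSet_Ioi, clockLaw_real_Ioi hc, probReal_univ]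

lemma ae_clockLaw_pos : ∀ᵐ x ∂clockLaw, 0 < x := by
  have h := clockLaw_real_Iic le_rfl
  rw [neg_zero, Real.exp_zero, sub_self, measureReal_eq_zero_iff] at h
  filter_upwards [measure_eq_zero_iff_ae_notMem.1 h] with x hx
  simpa using hx

/-! ### Observation probabilities for a fixed path of `X` -/

section Observation

variable {d : ℕ} (Λ : Matrix (State d) (State d) ℝ) (ν : State d → ℝ) (p : ℝ≥0 → State d)
  (τ : ℕ → ℝ≥0) (B : ℕ → Set (State d)) (K : ℕ)

/-- The clocks for which the path started from `z` lies in `B j` at time `τ j`, `k ≤ j ≤ K`. -/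
def goodSet (k : ℕ) (z : ℝ≥0∞ × State d) : Set (ℕ → ℝ) :=
  {e | ∀ m j, k ≤ j → j ≤ K → (skelFrom Λ ν p e z m).1 ≤ τ j →
    (τ j : ℝ≥0∞) < (skelFrom Λ ν p e z (m + 1)).1 → (skelFrom Λ ν p e z m).2 ∈ B j}

/-- The condition on the first segment, from `z` to `z'`. -/
def firstGood (k : ℕ) (z z' : ℝ≥0∞ × State d) : Prop :=
  ∀ j, k ≤ j → j ≤ K → z.1 ≤ τ j → (τ j : ℝ≥0∞) < z'.1 → z.2 ∈ B j

/-- The probability of `goodSet`. -/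
def goodProb (k : ℕ) (z : ℝ≥0∞ × State d) : ℝ := clocksLaw.real (goodSet Λ ν p τ B K k z)

open Classical in
/-- The probability of `goodSet` given the first clock. -/
def stepProb (k : ℕ) (z : ℝ≥0∞ × State d) (e : ℝ) : ℝ :=
  if firstGood τ B K k z (dualStep Λ ν p e z) then
    goodProb Λ ν p τ B K k (dualStep Λ ν p e z) else 0

variable {Λ ν p τ B K}

lemma goodProb_nonneg (k : ℕ) (z : ℝ≥0∞ × State d) : 0 ≤ goodProb Λ ν p τ B K k z :=
  measureReal_nonneg

lemma goodProb_le_one (k : ℕ) (z : ℝ≥0∞ × State d) : goodProb Λ ν p τ B K k z ≤ 1 :=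
  measureReal_le_one

lemma stepProb_nonneg (k : ℕ) (z : ℝ≥0∞ × State d) (e : ℝ) : 0 ≤ stepProb Λ ν p τ B K k z e := by
  unfold stepProb
  split_ifs
  · exact goodProb_nonneg _ _
  · exact le_rfl

lemma stepProb_le_one (k : ℕ) (z : ℝ≥0∞ × State d) (e : ℝ) : stepProb Λ ν p τ B K k z e ≤ 1 := by
  unfold stepProb
  split_ifs
  · exact goodProb_le_one _ _
  · exact zero_le_one

lemma mem_goodSet_iff (k : ℕ) (z : ℝ≥0∞ × State d) (e : ℕ → ℝ) :
    e ∈ goodSet Λ ν p τ B K k z ↔ firstGood τ B K k z (dualStep Λ ν p (e 0) z) ∧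
      (fun i => e (i + 1)) ∈ goodSet Λ ν p τ B K k (dualStep Λ ν p (e 0) z) := by
  constructor
  · intro h
    refine ⟨fun j h1 h2 h3 h4 => h 0 j h1 h2 h3 h4, fun m j h1 h2 h3 h4 => ?_⟩
    have := h (m + 1) j h1 h2
    rw [skelFrom_shift, skelFrom_shift] at this
    exact this h3 h4
  · rintro ⟨h1, h2⟩ m
    cases m with
    | zero => exact fun j => h1 j
    | succ m =>
      intro j
      rw [skelFrom_shift, skelFrom_shift]
      exact h2 m j

lemma measurableSet_good_joint (k : ℕ) (z : ℝ≥0∞ × State d) :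
    MeasurableSet {q : CadlagPath d × (ℕ → ℝ) | q.2 ∈ goodSet Λ ν q.1.1 τ B K k z} := by
  have hT : ∀ m, Measurable fun q : CadlagPath d × (ℕ → ℝ) => (skelFrom Λ ν q.1.1 q.2 z m).1 :=
    fun m => measurable_fst.comp (measurable_skelFrom Λ ν z m)
  have hX : ∀ m, Measurable fun q : CadlagPath d × (ℕ → ℝ) => (skelFrom Λ ν q.1.1 q.2 z m).2 :=
    fun m => measurable_snd.comp (measurable_skelFrom Λ ν z m)
  have hset : {q : CadlagPath d × (ℕ → ℝ) | q.2 ∈ goodSet Λ ν q.1.1 τ B K k z} =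
      ⋂ m, ⋂ j, ⋂ _ : k ≤ j, ⋂ _ : j ≤ K, {q : CadlagPath d × (ℕ → ℝ) |
        (skelFrom Λ ν q.1.1 q.2 z m).1 ≤ τ j → (τ j : ℝ≥0∞) < (skelFrom Λ ν q.1.1 q.2 z (m + 1)).1 →
          (skelFrom Λ ν q.1.1 q.2 z m).2 ∈ B j} := by
    ext q
    simp [goodSet]
  rw [hset]
  refine MeasurableSet.iInter fun m => MeasurableSet.iInter fun j => MeasurableSet.iInter fun _ =>
    MeasurableSet.iInter fun _ => ?_
  have h1 := measurableSet_le (hT m) (measurable_const (a := (τ j : ℝ≥0∞)))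
  have h2 := measurableSet_lt (measurable_const (a := (τ j : ℝ≥0∞))) (hT (m + 1))
  have h3 := hX m (Set.toFinite (B j)).measurableSet
  convert! h1.compl.union (h2.compl.union h3) using 1
  ext q
  simp only [Set.mem_ofPred_eq, Set.mem_union, Set.mem_compl_iff, Set.mem_preimage]
  tauto

lemma measurableSet_goodSet (hp : IsCadlag p) (k : ℕ) (z : ℝ≥0∞ × State d) :
    MeasurableSet (goodSet Λ ν p τ B K k z) :=
  (measurable_const (a := (⟨p, hp⟩ : CadlagPath d))).prodMk measurable_id
    (measurableSet_good_joint (Λ := Λ) (ν := ν) (τ := τ) (B := B) (K := K) k z)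

lemma shift_preimage_good (k : ℕ) (z : ℝ≥0∞ × State d) :
    goodSet Λ ν p τ B K k z = (fun e : ℕ → ℝ => (e 0, fun i => e (i + 1))) ⁻¹'
      {q : ℝ × (ℕ → ℝ) | firstGood τ B K k z (dualStep Λ ν p q.1 z) ∧
        q.2 ∈ goodSet Λ ν p τ B K k (dualStep Λ ν p q.1 z)} := by
  ext e
  exact mem_goodSet_iff k z e

lemma measurableSet_split_good (hp : IsCadlag p) (k : ℕ) (z : ℝ≥0∞ × State d) :
    MeasurableSet {q : ℝ × (ℕ → ℝ) | firstGood τ B K k z (dualStep Λ ν p q.1 z) ∧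
      q.2 ∈ goodSet Λ ν p τ B K k (dualStep Λ ν p q.1 z)} := by
  have hm : Measurable (fun q : ℝ × (ℕ → ℝ) => (fun n => Nat.casesOn n q.1 q.2 : ℕ → ℝ)) := by
    refine measurable_pi_lambda _ fun n => ?_
    cases n with
    | zero => exact measurable_fst
    | succ n => exact (measurable_pi_apply n).comp measurable_snd
  convert! hm (measurableSet_goodSet (Λ := Λ) (ν := ν) (τ := τ) (B := B) (K := K) hp k z) using 1
  rw [shift_preimage_good]
  rfl

lemma stepProb_eq (k : ℕ) (z : ℝ≥0∞ × State d) (e : ℝ) :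
    stepProb Λ ν p τ B K k z e = clocksLaw.real (Prod.mk e ⁻¹'
      {q : ℝ × (ℕ → ℝ) | firstGood τ B K k z (dualStep Λ ν p q.1 z) ∧
        q.2 ∈ goodSet Λ ν p τ B K k (dualStep Λ ν p q.1 z)}) := by
  unfold stepProb
  split_ifs with h
  · simp [h, goodProb]
  · simp [h]

lemma measurable_stepProb (hp : IsCadlag p) (k : ℕ) (z : ℝ≥0∞ × State d) :
    Measurable (stepProb Λ ν p τ B K k z) := by
  have : stepProb Λ ν p τ B K k z = fun e => clocksLaw.real (Prod.mk e ⁻¹'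
      {q : ℝ × (ℕ → ℝ) | firstGood τ B K k z (dualStep Λ ν p q.1 z) ∧
        q.2 ∈ goodSet Λ ν p τ B K k (dualStep Λ ν p q.1 z)}) := by
    ext e
    exact stepProb_eq k z e
  rw [this]
  exact (measurable_measure_prodMk_left (measurableSet_split_good hp k z)).ennreal_toReal

lemma integrable_stepProb (hp : IsCadlag p) (k : ℕ) (z : ℝ≥0∞ × State d) :
    Integrable (stepProb Λ ν p τ B K k z) clockLaw :=
  Integrable.of_bound (measurable_stepProb hp k z).aestronglyMeasurable 1
    (Eventually.of_forall fun e => by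
      rw [Real.norm_eq_abs, abs_of_nonneg (stepProb_nonneg k z e)]
      exact stepProb_le_one k z e)

/-- First-step analysis. -/
lemma goodProb_eq_integral (hp : IsCadlag p) (k : ℕ) (z : ℝ≥0∞ × State d) :
    goodProb Λ ν p τ B K k z = ∫ e, stepProb Λ ν p τ B K k z e ∂clockLaw := by
  have hm : Measurable (fun e : ℕ → ℝ => (e 0, fun i => e (i + 1))) :=
    (measurable_pi_apply 0).prodMk (measurable_pi_lambda _ fun i => measurable_pi_apply _)
  have hS := measurableSet_split_good (Λ := Λ) (ν := ν) (τ := τ) (B := B) (K := K) hp k z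
  rw [goodProb, shift_preimage_good, ← map_measureReal_apply hm hS, map_shift_infinitePi,
    prod_real_eq_integral _ _ hS]
  simp only [stepProb_eq]

lemma goodProb_split (hp : IsCadlag p) (k : ℕ) (z : ℝ≥0∞ × State d) (c : ℝ) :
    goodProb Λ ν p τ B K k z = (∫ e in Set.Iic c, stepProb Λ ν p τ B K k z e ∂clockLaw) +
      ∫ e in Set.Ioi c, stepProb Λ ν p τ B K k z e ∂clockLaw := by
  rw [goodProb_eq_integral hp, ← Set.compl_Iic,
    integral_add_compl measurableSet_Iic (integrable_stepProb hp k z)]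

lemma goodProb_last (k : ℕ) (hk : K < k) (z : ℝ≥0∞ × State d) : goodProb Λ ν p τ B K k z = 1 := by
  have : goodSet Λ ν p τ B K k z = Set.univ := by
    ext e
    simp only [Set.mem_univ, iff_true]
    intro m j h1 h2
    omega
  rw [goodProb, this, probReal_univ]

open Classical in
/-- An observation at the current time. -/
lemma goodProb_observe (hp : IsCadlag p) (k : ℕ) (hk : k ≤ K) (xh : State d) :
    goodProb Λ ν p τ B K k (τ k, xh) =
      (if xh ∈ B k then 1 else 0) * goodProb Λ ν p τ B K (k + 1) (τ k, xh) := by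
  -- A positive first clock makes the first segment nondegenerate, so the observation at time τ k
  -- sees the initial value. With a zero clock the process could have moved already.
  have hpos : ∀ᵐ e ∂clocksLaw, 0 < e 0 := by
    have hlaw : clocksLaw.map (fun e : ℕ → ℝ => e 0) = clockLaw :=
      Measure.infinitePi_map_eval _ 0
    have h := ae_clockLaw_pos
    rw [← hlaw] at h
    exact ae_of_ae_map (measurable_pi_apply 0).aemeasurable h
  have key : ∀ e : ℕ → ℝ, 0 < e 0 → (e ∈ goodSet Λ ν p τ B K k (τ k, xh) ↔
      xh ∈ B k ∧ e ∈ goodSet Λ ν p τ B K (k + 1) (τ k, xh)) := by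
    intro e he
    have hlt : (τ k : ℝ≥0∞) < (skelFrom Λ ν p e (τ k, xh) 1).1 := lt_dualStep hp he (τ k) xh
    constructor
    · intro h
      exact ⟨h 0 k le_rfl hk le_rfl hlt, fun m j h1 => h m j (by omega)⟩
    · rintro ⟨h1, h2⟩ m j h3 h4 h5 h6
      rcases h3.eq_or_lt with rfl | h3
      · have : m = 0 := by
          by_contra hm
          have := skelFrom_monotone (Λ := Λ) (ν := ν) hp e (τ k, xh) (show 1 ≤ m by omega)
          exact absurd (hlt.trans_le this) (not_lt.2 h5)
        subst this
        exact h1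
      · exact h2 m j h3 h4 h5 h6
  split_ifs with hB
  · rw [one_mul]
    refine measureReal_congr ?_
    filter_upwards [hpos] with e he
    exact propext ((key e he).trans (and_iff_right hB))
  · rw [zero_mul, goodProb, measureReal_eq_zero_iff, measure_eq_zero_iff_ae_notMem]
    filter_upwards [hpos] with e he h
    exact hB ((key e he).1 h).1

lemma one_sub_exp_neg_le {x : ℝ} : 1 - Real.exp (-x) ≤ x := by
  linarith [Real.add_one_le_exp (-x)]

lemma exp_neg_le_quadratic {x : ℝ} (hx : 0 ≤ x) : Real.exp (-x) - 1 + x ≤ x ^ 2 := by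
  rcases le_or_gt x 1 with h | h
  · have := Real.abs_exp_sub_one_sub_id_le (x := -x) (by rw [abs_neg, abs_of_nonneg hx]; exact h)
    have := le_of_abs_le this
    nlinarith
  · have : Real.exp (-x) ≤ 1 := Real.exp_le_one_iff.2 (by linarith)
    nlinarith

lemma setIntegral_clockLaw_mem {f : ℝ → ℝ} (h0 : ∀ x, 0 ≤ f x) (h1 : ∀ x, f x ≤ 1)
    (hf : Integrable f clockLaw) (s : Set ℝ) :
    0 ≤ ∫ x in s, f x ∂clockLaw ∧ ∫ x in s, f x ∂clockLaw ≤ clockLaw.real s := by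
  refine ⟨integral_nonneg h0, ?_⟩
  calc ∫ x in s, f x ∂clockLaw ≤ ∫ _ in s, (1 : ℝ) ∂clockLaw :=
        integral_mono hf.integrableOn (integrable_const _) h1
    _ = clockLaw.real s := by simp

/-! ### Estimates on one time cell without an interior observation -/

section Cell

variable {k : ℕ} {s s' : ℝ≥0}

/-- While neither X jumps nor the clock rings, the rate is constant, so a start at s with clock
value e is a start at s' with e reduced by the elapsed rate times time. No observation falls in
between. -/
lemma stepProb_shift (hs : s ≤ s') (hτ : ∀ j, k ≤ j → j ≤ K → s' ≤ τ j)
    (hJ : (s' : ℝ≥0∞) < nextJump p s) (xh : State d) {e : ℝ}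
    (he : clockRate Λ ν xh (p s) * ((s' : ℝ) - s) < e) :
    stepProb Λ ν p τ B K k (s, xh) e =
      stepProb Λ ν p τ B K k (s', xh) (e - clockRate Λ ν xh (p s) * ((s' : ℝ) - s)) := by
  set a := clockRate Λ ν xh (p s) with ha
  have hps : p s' = p s := eq_of_lt_nextJump hs hJ
  have hring : ringTime Λ ν p e s xh = ringTime Λ ν p (e - a * ((s' : ℝ) - s)) s' xh := by
    unfold ringTime
    rw [hps, ← ha]
    split_ifs with hpos
    · have hss : (0 : ℝ) ≤ s' - s := sub_nonneg.2 (by exact_mod_cast hs)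
      have h1 : (s' : ℝ≥0∞) = s + ENNReal.ofReal ((s' : ℝ) - s) := by
        rw [← ENNReal.ofReal_coe_nnreal, ← ENNReal.ofReal_coe_nnreal,
          ← ENNReal.ofReal_add s.coe_nonneg hss]
        congr 1
        ring
      rw [h1, add_assoc, ← ENNReal.ofReal_add hss (div_nonneg (by linarith) hpos.le)]
      congr 2
      field_simp
      ring
    · rfl
  have hstep : dualStep Λ ν p e ((s : ℝ≥0∞), xh) =
      dualStep Λ ν p (e - a * ((s' : ℝ) - s)) ((s' : ℝ≥0∞), xh) := by
    rw [dualStep_coe, dualStep_coe, hring, nextJump_congr hs hJ]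
  have hfirst : ∀ z', firstGood τ B K k ((s : ℝ≥0∞), xh) z' ↔
      firstGood τ B K k ((s' : ℝ≥0∞), xh) z' := by
    intro z'
    refine forall_congr' fun j => forall_congr' fun h1 => forall_congr' fun h2 => ?_
    have h3 : (s' : ℝ≥0∞) ≤ τ j := ENNReal.coe_le_coe.2 (hτ j h1 h2)
    have h4 : (s : ℝ≥0∞) ≤ τ j := ENNReal.coe_le_coe.2 (hs.trans (hτ j h1 h2))
    simp [h3, h4]
  rw [stepProb, stepProb, hstep]
  by_cases h : firstGood τ B K k ((s' : ℝ≥0∞), xh)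
      (dualStep Λ ν p (e - a * ((s' : ℝ) - s)) ((s' : ℝ≥0∞), xh))
  · rw [if_pos ((hfirst _).2 h), if_pos h]
  · rw [if_neg (mt (hfirst _).1 h), if_neg h]

/-- The first clock either rings within the cell or, by lack of memory, is as good as new at s'. -/
lemma goodProb_cell (hp : IsCadlag p) (hr0 : ∀ xh x, 0 ≤ clockRate Λ ν xh x) (hs : s ≤ s')
    (hτ : ∀ j, k ≤ j → j ≤ K → s' ≤ τ j)
    (hJ : (s' : ℝ≥0∞) < nextJump p s) (xh : State d) :
    goodProb Λ ν p τ B K k (s, xh) =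
      (∫ e in Set.Iic (clockRate Λ ν xh (p s) * ((s' : ℝ) - s)),
        stepProb Λ ν p τ B K k (s, xh) e ∂clockLaw) +
      Real.exp (-(clockRate Λ ν xh (p s) * ((s' : ℝ) - s))) *
        goodProb Λ ν p τ B K k (s', xh) := by
  have hss : (0 : ℝ) ≤ s' - s := sub_nonneg.2 (by exact_mod_cast hs)
  set c := clockRate Λ ν xh (p s) * ((s' : ℝ) - s) with hc
  have hc0 : 0 ≤ c := mul_nonneg (hr0 _ _) hss
  rw [goodProb_split hp k _ c, goodProb_eq_integral hp k (s', xh),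
    ← setIntegral_clockLaw_Ioi _ hc0]
  congr 1
  exact setIntegral_congr_fun measurableSet_Ioi fun e he => stepProb_shift hs hτ hJ xh he

/-- The two probabilities can differ only if the clock rings within the cell, an event of
probability at most rate times length. -/
lemma goodProb_lipschitz (hp : IsCadlag p) (hr0 : ∀ xh x, 0 ≤ clockRate Λ ν xh x) (hs : s ≤ s')
    (hτ : ∀ j, k ≤ j → j ≤ K → s' ≤ τ j)
    (hJ : (s' : ℝ≥0∞) < nextJump p s) (xh : State d) :
    |goodProb Λ ν p τ B K k (s, xh) - goodProb Λ ν p τ B K k (s', xh)| ≤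
      clockRate Λ ν xh (p s) * ((s' : ℝ) - s) := by
  have hss : (0 : ℝ) ≤ s' - s := sub_nonneg.2 (by exact_mod_cast hs)
  set c := clockRate Λ ν xh (p s) * ((s' : ℝ) - s) with hc
  have hc0 : 0 ≤ c := mul_nonneg (hr0 _ _) hss
  have h1 := goodProb_cell (Λ := Λ) (ν := ν) (B := B) hp hr0 hs hτ hJ xh
  rw [← hc] at h1
  have h2 := setIntegral_clockLaw_mem (stepProb_nonneg k _) (stepProb_le_one k _)
    (integrable_stepProb (Λ := Λ) (ν := ν) (τ := τ) (B := B) (K := K) hp k (s, xh)) (Set.Iic c)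
  rw [clockLaw_real_Iic hc0] at h2
  have h3 := goodProb_nonneg (Λ := Λ) (ν := ν) (p := p) (τ := τ) (B := B) (K := K) k (s', xh)
  have h4 := goodProb_le_one (Λ := Λ) (ν := ν) (p := p) (τ := τ) (B := B) (K := K) k (s', xh)
  have h5 := one_sub_exp_neg_le (x := c)
  have h6 : Real.exp (-c) ≤ 1 := Real.exp_le_one_iff.2 (by linarith)
  rw [abs_le]
  constructor <;> nlinarith

/-- A cell without a jump of `X`. -/
lemma goodProb_cell_const (hp : IsCadlag p) (hr0 : ∀ xh x, 0 ≤ clockRate Λ ν xh x) (hs : s ≤ s')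
    (hτ : ∀ j, k ≤ j → j ≤ K → s' ≤ τ j)
    (hJ : (s' : ℝ≥0∞) < nextJump p s) {A : ℝ}
    (hA : ∀ xh x, clockRate Λ ν xh x ≤ A) (xh : State d) :
    |goodProb Λ ν p τ B K k (s, xh) -
      ((1 - clockRate Λ ν xh (p s) * ((s' : ℝ) - s)) * goodProb Λ ν p τ B K k (s', xh) +
        clockRate Λ ν xh (p s) * ((s' : ℝ) - s) * goodProb Λ ν p τ B K k (s', up xh))| ≤
      2 * A ^ 2 * ((s' : ℝ) - s) ^ 2 := by
  set h := (s' : ℝ) - s with hh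
  have hss : 0 ≤ h := sub_nonneg.2 (by exact_mod_cast hs)
  set a := clockRate Λ ν xh (p s) with ha
  have ha0 : 0 ≤ a := hr0 _ _
  have haA : a ≤ A := hA _ _
  have hc0 : 0 ≤ a * h := mul_nonneg ha0 hss
  have hcA : a * h ≤ A * h := mul_le_mul_of_nonneg_right haA hss
  set g := goodProb Λ ν p τ B K k (s', xh) with hg
  set g' := goodProb Λ ν p τ B K k (s', up xh) with hg'
  have h1 := goodProb_cell (Λ := Λ) (ν := ν) (B := B) hp hr0 hs hτ hJ xh
  rw [← hh, ← ha, ← hg] at h1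
  have hm := clockLaw_real_Iic hc0
  -- After a ring at time r the process restarts from the next state; moving r to the end of the
  -- cell costs at most A h by the Lipschitz bound. The ring itself has probability at most A h, so
  -- the error is of second order.
  have hintegrable : |(∫ e in Set.Iic (a * h), stepProb Λ ν p τ B K k (s, xh) e ∂clockLaw) -
      (1 - Real.exp (-(a * h))) * g'| ≤ A * h * (1 - Real.exp (-(a * h))) := by
    have e1 : (1 - Real.exp (-(a * h))) * g' = ∫ _ in Set.Iic (a * h), g' ∂clockLaw := by
      rw [setIntegral_const, hm, smul_eq_mul]
    rw [e1, ← integral_sub (integrable_stepProb hp k _).integrableOn (integrable_const _),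
      ← hm, ← Real.norm_eq_abs]
    refine norm_setIntegral_le_of_norm_le_const_ae' (measure_lt_top _ _) ?_
    filter_upwards [ae_clockLaw_pos] with e he0 he
    have hapos : 0 < a := by
      by_contra hn
      have : a = 0 := le_antisymm (not_lt.1 hn) ha0
      rw [this, zero_mul] at he
      exact absurd he0 (not_lt.2 he)
    have hea : e / a ≤ h := by
      rw [div_le_iff₀ hapos, mul_comm]
      exact he
    have hea0 : 0 ≤ e / a := (div_pos he0 hapos).le
    set r : ℝ≥0 := s + Real.toNNReal (e / a) with hrdef
    have hr : ringTime Λ ν p e s xh = r := by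
      rw [ringTime, if_pos hapos, ← ha, hrdef, ENNReal.coe_add]
      rfl
    have hrr : (r : ℝ) = s + e / a := by
      rw [hrdef, NNReal.coe_add, Real.coe_toNNReal _ hea0]
    have hrs' : r ≤ s' := by
      rw [← NNReal.coe_le_coe, hrr]
      linarith
    have hrJ : (r : ℝ≥0∞) < nextJump p s := lt_of_le_of_lt (ENNReal.coe_le_coe.2 hrs') hJ
    have hsr : s ≤ r := le_self_add
    have hstep : stepProb Λ ν p τ B K k (s, xh) e = goodProb Λ ν p τ B K k (r, up xh) := by
      have : dualStep Λ ν p e ((s : ℝ≥0∞), xh) = ((r : ℝ≥0∞), up xh) := by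
        rw [dualStep_coe, hr, if_pos hrJ]
      rw [stepProb, this, if_pos]
      intro j h1 h2 _ h4
      exact absurd (hrs'.trans (hτ j h1 h2)) (not_le.2 (ENNReal.coe_lt_coe.1 h4))
    have hJ' : (s' : ℝ≥0∞) < nextJump p r := by rwa [nextJump_congr hsr hrJ]
    rw [hstep, Real.norm_eq_abs]
    refine (goodProb_lipschitz hp hr0 hrs' hτ hJ' (up xh)).trans ?_
    have hle : (s' : ℝ) - r ≤ h := by linarith
    have hle0 : (0 : ℝ) ≤ s' - r := sub_nonneg.2 (by exact_mod_cast hrs')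
    exact mul_le_mul (hA _ _) hle hle0 (ha0.trans haA)
  have h3 := goodProb_nonneg (Λ := Λ) (ν := ν) (p := p) (τ := τ) (B := B) (K := K) k (s', xh)
  have h4 := goodProb_le_one (Λ := Λ) (ν := ν) (p := p) (τ := τ) (B := B) (K := K) k (s', xh)
  have h3' := goodProb_nonneg (Λ := Λ) (ν := ν) (p := p) (τ := τ) (B := B) (K := K) k (s', up xh)
  have h4' := goodProb_le_one (Λ := Λ) (ν := ν) (p := p) (τ := τ) (B := B) (K := K) k (s', up xh)
  rw [← hg] at h3 h4
  rw [← hg'] at h3' h4'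
  have h5 := one_sub_exp_neg_le (x := a * h)
  have h6 := exp_neg_le_quadratic hc0
  have h7 := Real.add_one_le_exp (-(a * h))
  have hgg : |g - g'| ≤ 1 := by rw [abs_le]; constructor <;> linarith
  have hq : |(Real.exp (-(a * h)) - 1 + a * h) * (g - g')| ≤ A ^ 2 * h ^ 2 := by
    rw [abs_mul, abs_of_nonneg (by linarith)]
    calc (Real.exp (-(a * h)) - 1 + a * h) * |g - g'| ≤ (a * h) ^ 2 * 1 :=
          mul_le_mul h6 hgg (abs_nonneg _) (by positivity)
      _ ≤ A ^ 2 * h ^ 2 := by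
          rw [mul_one, ← mul_pow]
          exact pow_le_pow_left₀ hc0 hcA 2
  have hi : A * h * (1 - Real.exp (-(a * h))) ≤ A ^ 2 * h ^ 2 := by
    calc A * h * (1 - Real.exp (-(a * h))) ≤ A * h * (A * h) :=
          mul_le_mul_of_nonneg_left (h5.trans hcA) (hc0.trans hcA)
      _ = A ^ 2 * h ^ 2 := by ring
  rw [h1]
  calc _ = |((∫ e in Set.Iic (a * h), stepProb Λ ν p τ B K k (s, xh) e ∂clockLaw) -
      (1 - Real.exp (-(a * h))) * g') + (Real.exp (-(a * h)) - 1 + a * h) * (g - g')| := by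
        congr 1
        ring
    _ ≤ A * h * (1 - Real.exp (-(a * h))) + A ^ 2 * h ^ 2 :=
        (abs_add_le _ _).trans (add_le_add hintegrable hq)
    _ ≤ 2 * A ^ 2 * h ^ 2 := by linarith

/-- A cell with one jump of `X`. -/
lemma goodProb_cell_jump (hp : IsCadlag p) (hr0 : ∀ xh x, 0 ≤ clockRate Λ ν xh x)
    (hτ : ∀ j, k ≤ j → j ≤ K → s' ≤ τ j)
    {J : ℝ≥0} (hsJ : s < J) (hJs' : J ≤ s')
    (h1 : ∀ t, s ≤ t → t < J → p t = p s) (h2 : ∀ t, J ≤ t → t ≤ s' → p t = p J) (hJ : p J ≠ p s)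
    {A : ℝ} (hA : ∀ xh x, clockRate Λ ν xh x ≤ A) (xh : State d) :
    |goodProb Λ ν p τ B K k (s, xh) - goodProb Λ ν p τ B K k (s', jumpMap (p s') xh)| ≤
      2 * A * ((s' : ℝ) - s) := by
  have hsJ' : (s : ℝ) < J := by exact_mod_cast hsJ
  have hJs'' : (J : ℝ) ≤ s' := by exact_mod_cast hJs'
  have hnext : nextJump p s = J := nextJump_eq hsJ h1 hJ
  have hpJ : p s' = p J := h2 s' hJs' le_rfl
  have hA0 : 0 ≤ A := (hr0 xh (p s)).trans (hA _ _)
  set a := clockRate Λ ν xh (p s) with ha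
  have ha0 : 0 ≤ a := hr0 _ _
  set c := a * ((J : ℝ) - s) with hc
  have hc0 : 0 ≤ c := mul_nonneg ha0 (by linarith)
  have hstep : ∀ e, c < e → stepProb Λ ν p τ B K k (s, xh) e =
      goodProb Λ ν p τ B K k (J, jumpMap (p s') xh) := by
    intro e he
    have hnr : ¬ ringTime Λ ν p e s xh < J := by
      rw [not_lt, ringTime, ← ha]
      split_ifs with hpos
      · have : (J : ℝ≥0∞) = s + ENNReal.ofReal ((J : ℝ) - s) := by
          rw [← ENNReal.ofReal_coe_nnreal, ← ENNReal.ofReal_coe_nnreal,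
            ← ENNReal.ofReal_add s.coe_nonneg (by linarith)]
          congr 1
          ring
        rw [this]
        refine add_le_add le_rfl (ENNReal.ofReal_le_ofReal ?_)
        rw [le_div_iff₀ hpos, mul_comm]
        exact he.le
      · exact le_top
    have : dualStep Λ ν p e ((s : ℝ≥0∞), xh) = ((J : ℝ≥0∞), jumpMap (p s') xh) := by
      rw [dualStep_coe, hnext, if_neg hnr, if_neg ENNReal.coe_ne_top, ENNReal.toNNReal_coe, hpJ]
    rw [stepProb, this, if_pos]
    intro j h3 h4 _ h5
    exact absurd (hJs'.trans (hτ j h3 h4)) (not_le.2 (ENNReal.coe_lt_coe.1 h5))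
  set g := goodProb Λ ν p τ B K k (J, jumpMap (p s') xh) with hg
  have e1 : ∫ e in Set.Ioi c, stepProb Λ ν p τ B K k (s, xh) e ∂clockLaw =
      Real.exp (-c) * g := by
    rw [setIntegral_congr_fun (g := fun _ => g) measurableSet_Ioi fun e he => hstep e he,
      setIntegral_const, clockLaw_real_Ioi hc0, smul_eq_mul]
  have e2 := setIntegral_clockLaw_mem (stepProb_nonneg k _) (stepProb_le_one k _)
    (integrable_stepProb (Λ := Λ) (ν := ν) (τ := τ) (B := B) (K := K) hp k (s, xh)) (Set.Iic c)
  rw [clockLaw_real_Iic hc0] at e2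
  have h3 := goodProb_nonneg (Λ := Λ) (ν := ν) (p := p) (τ := τ) (B := B) (K := K) k
    (J, jumpMap (p s') xh)
  have h4 := goodProb_le_one (Λ := Λ) (ν := ν) (p := p) (τ := τ) (B := B) (K := K) k
    (J, jumpMap (p s') xh)
  rw [← hg] at h3 h4
  have h5 := one_sub_exp_neg_le (x := c)
  have h6 : Real.exp (-c) ≤ 1 := Real.exp_le_one_iff.2 (by linarith)
  have hcA : c ≤ A * ((s' : ℝ) - s) :=
    mul_le_mul (hA _ _) (by linarith) (by linarith) hA0
  -- Here a first-order bound suffices: the number of cells with a jump of X is bounded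
  -- independently of the mesh.
  have hfirst : |goodProb Λ ν p τ B K k (s, xh) - g| ≤ A * ((s' : ℝ) - s) := by
    rw [goodProb_split hp k _ c, e1, abs_le]
    constructor <;> nlinarith
  have hsecond : |g - goodProb Λ ν p τ B K k (s', jumpMap (p s') xh)| ≤ A * ((s' : ℝ) - s) := by
    refine (goodProb_lipschitz hp hr0 hJs' hτ (lt_nextJump_of_const hp hJs' h2) _).trans ?_
    exact mul_le_mul (hA _ _) (by linarith) (by linarith) hA0
  calc _ ≤ _ := abs_sub_le _ g _
    _ ≤ 2 * A * ((s' : ℝ) - s) := by linarith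

end Cell

end Observation

/-! ### Discretization of the continuous-time construction -/

section CellMatrix

variable {d : ℕ} (Λ : Matrix (State d) (State d) ℝ) (ν : State d → ℝ)

/-- Approximate transition probabilities of `X̂` over a cell of length `h` in which `X` moves from
`x` to `y`. -/
def cellMat (h : ℝ) (x y xh yh : State d) : ℝ :=
  if x = y then (if yh = xh then 1 - clockRate Λ ν xh x * h else 0) +
    (if yh = up xh then clockRate Λ ν xh x * h else 0)
  else if yh = jumpMap y xh then 1 else 0

/-- Rates of the bivariate chain. -/
def cellGen (G : Matrix (State d) (State d) ℝ) (x y xh yh : State d) : ℝ :=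
  if x = y then G x y * (if yh = xh then 1 else 0) + clockRate Λ ν xh x *
    ((if yh = up xh then 1 else 0) - (if yh = xh then 1 else 0))
  else G x y * (if yh = jumpMap y xh then 1 else 0)

variable {Λ ν}

lemma sum_cellMat_mul (h : ℝ) (x y xh : State d) (v : State d → ℝ) :
    ∑ yh, cellMat Λ ν h x y xh yh * v yh =
      if x = y then (1 - clockRate Λ ν xh x * h) * v xh + clockRate Λ ν xh x * h * v (up xh)
      else v (jumpMap y xh) := by
  unfold cellMat
  split_ifs
  · simp [add_mul, Finset.sum_add_distrib, ite_mul]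
  · simp [ite_mul]

lemma sum_cellMat (h : ℝ) (x y xh : State d) : ∑ yh, cellMat Λ ν h x y xh yh = 1 := by
  have := sum_cellMat_mul (Λ := Λ) (ν := ν) h x y xh fun _ => 1
  simp only [mul_one] at this
  rw [this]
  split_ifs
  · ring
  · rfl

lemma cellMat_nonneg (hr0 : ∀ xh x, 0 ≤ clockRate Λ ν xh x) {A : ℝ}
    (hA : ∀ xh x, clockRate Λ ν xh x ≤ A) {h : ℝ} (h0 : 0 ≤ h) (hAh : A * h ≤ 1)
    (x y xh yh : State d) : 0 ≤ cellMat Λ ν h x y xh yh := by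
  have h1 : clockRate Λ ν xh x * h ≤ 1 := (mul_le_mul_of_nonneg_right (hA _ _) h0).trans hAh
  have h2 : 0 ≤ clockRate Λ ν xh x * h := mul_nonneg (hr0 _ _) h0
  unfold cellMat
  split_ifs <;> linarith

/-- Second-order error of a product of two first-order expansions. -/
lemma abs_mul_sub_first_order_le {h m₀ m₁ p₀ p₁ P K : ℝ} (h0 : 0 ≤ h) (h1 : h ≤ 1)
    (hP : |P - p₀ - h * p₁| ≤ K * h ^ 2) :
    |P * (m₀ + h * m₁) - p₀ * m₀ - h * (p₁ * m₀ + p₀ * m₁)| ≤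
      (K * (|m₀| + |m₁|) + |p₁ * m₁|) * h ^ 2 := by
  have hK : 0 ≤ K * h ^ 2 := (abs_nonneg _).trans hP
  have hm : |m₀ + h * m₁| ≤ |m₀| + |m₁| := by
    refine (abs_add_le _ _).trans (add_le_add le_rfl ?_)
    rw [abs_mul, abs_of_nonneg h0]
    exact mul_le_of_le_one_left (abs_nonneg _) h1
  calc _ = |(P - p₀ - h * p₁) * (m₀ + h * m₁) + p₁ * m₁ * h ^ 2| := by
        congr 1
        ring
    _ ≤ K * h ^ 2 * (|m₀| + |m₁|) + |p₁ * m₁| * h ^ 2 := by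
        refine (abs_add_le _ _).trans (add_le_add ?_ ?_)
        · rw [abs_mul]
          exact mul_le_mul hP hm (abs_nonneg _) hK
        · rw [abs_mul _ (h ^ 2), abs_of_nonneg (sq_nonneg h)]
    _ = _ := by ring

/-- If x = y, both factors are affine in h up to second order and their product is expanded. If x ≠
y, the transition probability of X is already of first order and the other factor does not depend on
h. -/
lemma cell_expansion {G : Matrix (State d) (State d) ℝ} (hG1 : ∀ i j, i ≠ j → 0 ≤ G i j)
    (hG2 : ∀ i, ∑ j, G i j = 0) (x y xh yh : State d) :
    ∃ C : ℝ, ∀ h : ℝ, 0 ≤ h → h ≤ 1 →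
      |NormedSpace.exp (h • G) x y * cellMat Λ ν h x y xh yh -
        (if x = y then (if yh = xh then 1 else 0) else 0) -
        h * cellGen Λ ν G x y xh yh| ≤ C * h ^ 2 := by
  obtain ⟨K, -, hK⟩ := matrix_exp_second_order hG1 hG2
  by_cases hxy : x = y
  · subst hxy
    refine ⟨K * (|if yh = xh then (1 : ℝ) else 0| + |clockRate Λ ν xh x *
      ((if yh = up xh then 1 else 0) - (if yh = xh then 1 else 0))|) + |G x x *
        (clockRate Λ ν xh x * ((if yh = up xh then 1 else 0) - (if yh = xh then 1 else 0)))|,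
      fun h h0 h1 => ?_⟩
    have := abs_mul_sub_first_order_le (m₀ := if yh = xh then 1 else 0)
      (m₁ := clockRate Λ ν xh x *
        ((if yh = up xh then 1 else 0) - (if yh = xh then 1 else 0))) h0 h1 (hK h h0 x x)
    rw [Matrix.one_apply_eq, one_mul, one_mul] at this
    convert! this using 2
    have hM : cellMat Λ ν h x x xh yh = (if yh = xh then 1 else 0) + h * (clockRate Λ ν xh x *
        ((if yh = up xh then 1 else 0) - (if yh = xh then 1 else 0))) := by
      rw [cellMat, if_pos rfl]
      split_ifs <;> ring
    rw [hM, cellGen, if_pos rfl, if_pos rfl]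
  · refine ⟨K, fun h h0 h1 => ?_⟩
    have := hK h h0 x y
    rw [Matrix.one_apply_ne hxy] at this
    rw [cellMat, cellGen, if_neg hxy, if_neg hxy, if_neg hxy]
    split_ifs
    · simpa using this
    · have hK0 := (abs_nonneg _).trans this
      simpa using hK0

/-- One-step consistency of the discretization. -/
lemma transfer_consistency {G Gh L : Matrix (State d) (State d) ℝ}
    (hG1 : ∀ i j, i ≠ j → 0 ≤ G i j) (hG2 : ∀ i, ∑ j, G i j = 0)
    (hGh1 : ∀ i j, i ≠ j → 0 ≤ Gh i j) (hGh2 : ∀ i, ∑ j, Gh i j = 0)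
    (hFO : ∀ xh yh y, ∑ x, L xh x * cellGen Λ ν G x y xh yh = Gh xh yh * L yh y) :
    ∃ C : ℝ, 0 ≤ C ∧ ∀ h : ℝ, 0 ≤ h → h ≤ 1 → ∀ xh yh y : State d,
      |∑ x, L xh x * (NormedSpace.exp (h • G) x y * cellMat Λ ν h x y xh yh) -
        NormedSpace.exp (h • Gh) xh yh * L yh y| ≤ C * h ^ 2 := by
  obtain ⟨K, hK0, hK⟩ := matrix_exp_second_order hGh1 hGh2
  choose C hC using cell_expansion (Λ := Λ) (ν := ν) hG1 hG2
  have key : ∀ h : ℝ, 0 ≤ h → h ≤ 1 → ∀ xh yh y : State d,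
      |∑ x, L xh x * (NormedSpace.exp (h • G) x y * cellMat Λ ν h x y xh yh) -
        NormedSpace.exp (h • Gh) xh yh * L yh y| ≤
      (∑ x, |L xh x| * |C x y xh yh| + K * |L yh y|) * h ^ 2 := by
    intro h h0 h1 xh yh y
    have hzero : ∑ x, L xh x * (if x = y then (if yh = xh then (1 : ℝ) else 0) else 0) =
        (1 : Matrix (State d) (State d) ℝ) xh yh * L yh y := by
      rw [Finset.sum_eq_single y]
      · by_cases hxy : yh = xh
        · subst hxy
          simp
        · simp [hxy, Matrix.one_apply_ne (Ne.symm hxy)]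
      · intro b _ hb
        simp [hb]
      · simp
    -- The zeroth-order terms agree trivially and the first-order ones by `hFO`; only second-order
    -- remainders are left.
    have hsplit : ∑ x, L xh x * (NormedSpace.exp (h • G) x y * cellMat Λ ν h x y xh yh) -
        NormedSpace.exp (h • Gh) xh yh * L yh y =
        ∑ x, L xh x * (NormedSpace.exp (h • G) x y * cellMat Λ ν h x y xh yh -
          (if x = y then (if yh = xh then 1 else 0) else 0) - h * cellGen Λ ν G x y xh yh) -
        (NormedSpace.exp (h • Gh) xh yh - (1 : Matrix (State d) (State d) ℝ) xh yh -
          h * Gh xh yh) * L yh y := by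
      have e1 : ∑ x, L xh x * (NormedSpace.exp (h • G) x y * cellMat Λ ν h x y xh yh -
          (if x = y then (if yh = xh then 1 else 0) else 0) - h * cellGen Λ ν G x y xh yh) =
          ∑ x, L xh x * (NormedSpace.exp (h • G) x y * cellMat Λ ν h x y xh yh) -
          ∑ x, L xh x * (if x = y then (if yh = xh then (1 : ℝ) else 0) else 0) -
          h * ∑ x, L xh x * cellGen Λ ν G x y xh yh := by
        rw [Finset.mul_sum, ← Finset.sum_sub_distrib, ← Finset.sum_sub_distrib]
        exact Finset.sum_congr rfl fun x _ => by ring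
      rw [e1, hzero, hFO]
      ring
    rw [hsplit, add_mul, Finset.sum_mul]
    refine (abs_sub _ _).trans (add_le_add ((Finset.abs_sum_le_sum_abs _ _).trans
      (Finset.sum_le_sum fun x _ => ?_)) ?_)
    · rw [abs_mul, mul_assoc]
      refine mul_le_mul_of_nonneg_left ((hC x y xh yh h h0 h1).trans ?_) (abs_nonneg _)
      exact mul_le_mul_of_nonneg_right (le_abs_self _) (sq_nonneg h)
    · rw [abs_mul, mul_right_comm]
      exact mul_le_mul_of_nonneg_right (hK h h0 xh yh) (abs_nonneg _)
  have hterm : ∀ xh yh y : State d, 0 ≤ ∑ x, |L xh x| * |C x y xh yh| + K * |L yh y| :=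
    fun xh yh y => add_nonneg
      (Finset.sum_nonneg fun x _ => mul_nonneg (abs_nonneg _) (abs_nonneg _))
      (mul_nonneg hK0 (abs_nonneg _))
  obtain ⟨M, hM⟩ := (Set.finite_range fun w : State d × State d × State d =>
    ∑ x, |L w.1 x| * |C x w.2.2 w.1 w.2.1| + K * |L w.2.1 w.2.2|).bddAbove
  refine ⟨M, (hterm 0 0 0).trans (hM ⟨(0, 0, 0), rfl⟩), fun h h0 h1 xh yh y =>
    (key h h0 h1 xh yh y).trans ?_⟩
  exact mul_le_mul_of_nonneg_right (hM ⟨(xh, yh, y), rfl⟩) (sq_nonneg h)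

end CellMatrix

/-! ### The grid approximation along a fixed path of X -/

section Grid

variable {d : ℕ} (Λ : Matrix (State d) (State d) ℝ) (ν : State d → ℝ)
  (τ : ℕ → ℝ≥0) (B : ℕ → Set (State d))

open Classical in
/-- The weight of an observation. -/
def obsWeight (k : ℕ) (xh : State d) : ℝ := if xh ∈ B k then 1 else 0

/-- Approximate distribution of `X̂` at time `τ k`, restricted to the observed event, given the
values `x` of `X` at the times `τ`. -/
def gridVec (x : ℕ → State d) : ℕ → State d → ℝ
  | 0 => fun xh => if xh = 0 then 1 else 0
  | k + 1 => fun yh => ∑ xh, gridVec x k xh * obsWeight B k xh *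
      cellMat Λ ν ((τ (k + 1) : ℝ) - τ k) (x k) (x (k + 1)) xh yh

variable {Λ ν τ B}

lemma obsWeight_nonneg (k : ℕ) (xh : State d) : 0 ≤ obsWeight B k xh := by
  unfold obsWeight
  split_ifs <;> norm_num

lemma obsWeight_le_one (k : ℕ) (xh : State d) : obsWeight B k xh ≤ 1 := by
  unfold obsWeight
  split_ifs <;> norm_num

variable {A η : ℝ} {K : ℕ}

lemma gridVec_congr {x y : ℕ → State d} (k : ℕ) (h : ∀ i ≤ k, x i = y i) :
    gridVec Λ ν τ B x k = gridVec Λ ν τ B y k := by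
  induction k with
  | zero => rfl
  | succ k ih =>
    ext yh
    simp only [gridVec]
    rw [ih fun i hi => h i (by omega), h k (by omega), h (k + 1) le_rfl]

lemma grid_step_nonneg (hτ : Monotone τ)
    (k : ℕ) : (0 : ℝ) ≤ (τ (k + 1) : ℝ) - τ k :=
  sub_nonneg.2 (by exact_mod_cast hτ (Nat.le_succ k))

lemma cellMat_grid_nonneg (hτ : Monotone τ) (hr0 : ∀ xh x, 0 ≤ clockRate Λ ν xh x)
    (hA : ∀ xh x, clockRate Λ ν xh x ≤ A) (hη : ∀ k < K, (τ (k + 1) : ℝ) - τ k ≤ η)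
    (hAη : A * η ≤ 1)
    (k : ℕ) (hk : k < K) (x y xh yh : State d) :
    0 ≤ cellMat Λ ν ((τ (k + 1) : ℝ) - τ k) x y xh yh :=
  cellMat_nonneg hr0 hA (grid_step_nonneg hτ k)
    ((mul_le_mul_of_nonneg_left (hη k hk) ((hr0 0 0).trans (hA 0 0))).trans hAη) _ _ _ _

lemma gridVec_nonneg (hτ : Monotone τ) (hr0 : ∀ xh x, 0 ≤ clockRate Λ ν xh x)
    (hA : ∀ xh x, clockRate Λ ν xh x ≤ A) (hη : ∀ k < K, (τ (k + 1) : ℝ) - τ k ≤ η)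
    (hAη : A * η ≤ 1)
    (x : ℕ → State d) (k : ℕ) (hk : k ≤ K) (xh : State d) :
    0 ≤ gridVec Λ ν τ B x k xh := by
  induction k generalizing xh with
  | zero =>
    simp only [gridVec]
    split_ifs <;> norm_num
  | succ k ih =>
    simp only [gridVec]
    exact Finset.sum_nonneg fun yh _ => mul_nonneg (mul_nonneg (ih (by omega) yh)
      (obsWeight_nonneg _ _)) (cellMat_grid_nonneg hτ hr0 hA hη hAη k hk _ _ _ _)

lemma sum_gridVec_le (hτ : Monotone τ) (hr0 : ∀ xh x, 0 ≤ clockRate Λ ν xh x)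
    (hA : ∀ xh x, clockRate Λ ν xh x ≤ A) (hη : ∀ k < K, (τ (k + 1) : ℝ) - τ k ≤ η)
    (hAη : A * η ≤ 1)
    (x : ℕ → State d) (k : ℕ) (hk : k ≤ K) :
    ∑ xh, gridVec Λ ν τ B x k xh ≤ 1 := by
  induction k with
  | zero => simp [gridVec]
  | succ k ih =>
    simp only [gridVec]
    rw [Finset.sum_comm]
    refine le_trans (Finset.sum_le_sum fun xh _ => ?_) (ih (by omega))
    rw [← Finset.mul_sum, sum_cellMat, mul_one]
    exact mul_le_of_le_one_right (gridVec_nonneg hτ hr0 hA hη hAη x k (by omega) xh)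
      (obsWeight_le_one _ _)

/-- Cells of a grid that contain points of a finite set. -/
lemma sum_cells_le_card (hτ : Monotone τ) (F : Finset ℝ≥0) (K : ℕ) :
    ∑ k ∈ Finset.range K, (F.filter fun J => τ k < J ∧ J ≤ τ (k + 1)).card ≤ F.card := by
  rw [← Finset.card_biUnion]
  · refine Finset.card_le_card fun J hJ => ?_
    obtain ⟨k, -, h⟩ := Finset.mem_biUnion.1 hJ
    exact (Finset.mem_filter.1 h).1
  · intro i _ j _ hij
    refine Finset.disjoint_left.2 fun J h1 h2 => ?_
    have h1' := (Finset.mem_filter.1 h1).2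
    have h2' := (Finset.mem_filter.1 h2).2
    rcases lt_or_gt_of_ne hij with h | h
    · exact absurd (h1'.2.trans (hτ (show i + 1 ≤ j from h))) (not_le.2 h2'.1)
    · exact absurd (h2'.2.trans (hτ (show j + 1 ≤ i from h))) (not_le.2 h1'.1)

/-- Pathwise error of the discretization. -/
lemma grid_path_bound (hτ : Monotone τ) (hr0 : ∀ xh x, 0 ≤ clockRate Λ ν xh x)
    (hA : ∀ xh x, clockRate Λ ν xh x ≤ A) (hη : ∀ k < K, (τ (k + 1) : ℝ) - τ k ≤ η)
    (hAη : A * η ≤ 1)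
    {p : ℝ≥0 → State d} (hp : IsCadlag p) {δ : ℝ} {F : Finset ℝ≥0}
    (hF : ∀ s s' : ℝ≥0, s ≤ s' → s' ≤ τ K → (s' : ℝ) - s < δ →
      (∀ t, s ≤ t → t ≤ s' → p t = p s) ∨
        ∃ J ∈ F, s < J ∧ J ≤ s' ∧ (∀ t, s ≤ t → t < J → p t = p s) ∧
          (∀ t, J ≤ t → t ≤ s' → p t = p J) ∧ p J ≠ p s) (hη0 : 0 ≤ η) (hηδ : η < δ) :
    |goodProb Λ ν p τ B K 0 (τ 0, 0) -
      ∑ xh, gridVec Λ ν τ B (fun k => p (τ k)) K xh * obsWeight B K xh| ≤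
      2 * A ^ 2 * η * τ K + 2 * A * η * F.card := by
  have hA0 : 0 ≤ A := (hr0 0 0).trans (hA 0 0)
  set a := gridVec Λ ν τ B (fun k => p (τ k)) with ha
  -- The exact probability of the observations from index k on, given X̂ = x̂ at time τ k. Its
  -- pairing with the forward approximation `a` is the exact probability at k = 0 and the
  -- approximation at k = K; between them the error telescopes over the cells.
  set g : ℕ → State d → ℝ := fun k xh => goodProb Λ ν p τ B K k (τ k, xh) with hg
  have hobs : ∀ k ≤ K, ∀ xh, g k xh =
      obsWeight B k xh * goodProb Λ ν p τ B K (k + 1) (τ k, xh) :=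
    fun k hk xh => goodProb_observe hp k hk xh
  have hend : ∑ xh, a K xh * obsWeight B K xh = ∑ xh, a K xh * g K xh := by
    refine Finset.sum_congr rfl fun xh _ => ?_
    rw [hobs K le_rfl, goodProb_last _ (Nat.lt_succ_self K), mul_one]
  have hstart : goodProb Λ ν p τ B K 0 (τ 0, 0) = ∑ xh, a 0 xh * g 0 xh := by
    simp [ha, hg, gridVec]
  -- Counts the candidate jump times in a cell. It is at least 1 when X jumps there, and its sum
  -- over the cells is at most the cardinality of F.
  set c : ℕ → ℕ := fun k => (F.filter fun J => τ k < J ∧ J ≤ τ (k + 1)).card with hc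
  have hcell : ∀ k < K, ∀ xh, |goodProb Λ ν p τ B K (k + 1) (τ k, xh) -
      ∑ yh, cellMat Λ ν ((τ (k + 1) : ℝ) - τ k) (p (τ k)) (p (τ (k + 1))) xh yh * g (k + 1) yh| ≤
      2 * A ^ 2 * η * ((τ (k + 1) : ℝ) - τ k) + 2 * A * η * c k := by
    intro k hk xh
    have hs := hτ (Nat.le_succ k)
    have hs0 := grid_step_nonneg hτ k
    have hτ' : ∀ j, k + 1 ≤ j → j ≤ K → τ (k + 1) ≤ τ j := fun j hj _ => hτ hj
    rw [sum_cellMat_mul]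
    rcases hF _ _ hs (hτ hk) (lt_of_le_of_lt (hη k hk) hηδ) with h | ⟨J, hJF, hJ1, hJ2, h1, h2, h3⟩
    · rw [if_pos (h _ hs le_rfl).symm]
      refine (goodProb_cell_const hp hr0 hs hτ' (lt_nextJump_of_const hp hs h) hA xh).trans ?_
      have e1 : 2 * A ^ 2 * ((τ (k + 1) : ℝ) - τ k) ^ 2 ≤
          2 * A ^ 2 * η * ((τ (k + 1) : ℝ) - τ k) := by
        rw [mul_assoc _ η, pow_two ((τ (k + 1) : ℝ) - τ k)]
        exact mul_le_mul_of_nonneg_left (mul_le_mul_of_nonneg_right (hη k hk) hs0) (by positivity)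
      have e2 : 0 ≤ 2 * A * η * c k := by positivity
      exact e1.trans (by linarith)
    · have hne : p (τ k) ≠ p (τ (k + 1)) := by
        rw [h2 _ hJ2 le_rfl]
        exact h3.symm
      rw [if_neg hne]
      refine (goodProb_cell_jump hp hr0 hτ' hJ1 hJ2 h1 h2 h3 hA xh).trans ?_
      have hc1 : (1 : ℝ) ≤ c k := by
        have : 0 < c k := Finset.card_pos.2 ⟨J, Finset.mem_filter.2 ⟨hJF, hJ1, hJ2⟩⟩
        exact_mod_cast this
      have e1 : 2 * A * ((τ (k + 1) : ℝ) - τ k) ≤ 2 * A * η * 1 := by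
        rw [mul_one]
        exact mul_le_mul_of_nonneg_left (hη k hk) (by positivity)
      have e2 : 2 * A * η * 1 ≤ 2 * A * η * c k := mul_le_mul_of_nonneg_left hc1 (by positivity)
      have e3 : 0 ≤ 2 * A ^ 2 * η * ((τ (k + 1) : ℝ) - τ k) := by positivity
      linarith
  have hstep : ∀ k < K, |∑ xh, a k xh * g k xh - ∑ xh, a (k + 1) xh * g (k + 1) xh| ≤
      2 * A ^ 2 * η * ((τ (k + 1) : ℝ) - τ k) + 2 * A * η * c k := by
    intro k hk
    have e1 : ∑ yh, a (k + 1) yh * g (k + 1) yh = ∑ xh, a k xh * obsWeight B k xh *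
        ∑ yh, cellMat Λ ν ((τ (k + 1) : ℝ) - τ k) (p (τ k)) (p (τ (k + 1))) xh yh *
          g (k + 1) yh := by
      simp only [ha, gridVec, Finset.sum_mul, Finset.mul_sum]
      rw [Finset.sum_comm]
      exact Finset.sum_congr rfl fun _ _ => Finset.sum_congr rfl fun _ _ => by ring
    rw [e1, ← Finset.sum_sub_distrib]
    set ε := 2 * A ^ 2 * η * ((τ (k + 1) : ℝ) - τ k) + 2 * A * η * c k with hε
    have hε0 : 0 ≤ ε := (abs_nonneg _).trans (hcell k hk 0)
    calc _ ≤ ∑ xh, a k xh * ε := by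
          refine (Finset.abs_sum_le_sum_abs _ _).trans (Finset.sum_le_sum fun xh _ => ?_)
          have ha0 := gridVec_nonneg (B := B) hτ hr0 hA hη hAη (fun k => p (τ k)) k hk.le xh
          rw [hobs k hk.le, mul_assoc, ← mul_sub, ← mul_sub, abs_mul, abs_mul, abs_of_nonneg ha0,
            abs_of_nonneg (obsWeight_nonneg _ _)]
          refine mul_le_mul_of_nonneg_left ?_ ha0
          exact (mul_le_of_le_one_left (abs_nonneg _) (obsWeight_le_one _ _)).trans (hcell k hk xh)
      _ ≤ ε := by
          rw [← Finset.sum_mul]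
          exact mul_le_of_le_one_left hε0
            (sum_gridVec_le hτ hr0 hA hη hAη (fun k => p (τ k)) k hk.le)
  have htel : ∀ k ≤ K, |∑ xh, a 0 xh * g 0 xh - ∑ xh, a k xh * g k xh| ≤
      ∑ i ∈ Finset.range k, (2 * A ^ 2 * η * ((τ (i + 1) : ℝ) - τ i) + 2 * A * η * c i) := by
    intro k
    induction k with
    | zero => simp
    | succ k ih =>
      intro hk
      rw [Finset.sum_range_succ]
      exact (abs_sub_le _ _ _).trans (add_le_add (ih (by omega)) (hstep k hk))
  rw [hstart, hend]
  refine (htel K le_rfl).trans ?_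
  rw [Finset.sum_add_distrib, ← Finset.mul_sum, ← Finset.mul_sum,
    Finset.sum_range_sub (fun i => (τ i : ℝ))]
  refine add_le_add (mul_le_mul_of_nonneg_left ?_ (by positivity))
    (mul_le_mul_of_nonneg_left ?_ (by positivity))
  · linarith [(τ 0).coe_nonneg]
  · rw [← Nat.cast_sum]
    exact_mod_cast sum_cells_le_card hτ F K

end Grid

/-- The algebraic conditions under which the construction of `dualPathCont` intertwines a chain with
generator `G` and a chain with generator `Gh` through the link `L`. -/
structure IsDualData {d : ℕ} (Λ : Matrix (State d) (State d) ℝ) (ν : State d → ℝ)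
    (G Gh L : Matrix (State d) (State d) ℝ) : Prop where
  rate_nonneg : ∀ xh x, 0 ≤ clockRate Λ ν xh x
  rate_last : ∀ x, clockRate Λ ν (Fin.last d) x ≤ 0
  gen_offDiag : ∀ i j, i ≠ j → 0 ≤ G i j
  gen_row_sum : ∀ i, ∑ j, G i j = 0
  dual_offDiag : ∀ i j, i ≠ j → 0 ≤ Gh i j
  dual_row_sum : ∀ i, ∑ j, Gh i j = 0
  link_stochastic : L ∈ Matrix.rowStochastic ℝ (State d)
  link_zero : ∀ x, L 0 x = if x = 0 then 1 else 0
  consistent : ∀ xh yh y, ∑ x, L xh x * cellGen Λ ν G x y xh yh = Gh xh yh * L yh y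

/-! ### Averaging the grid approximation over the chain X -/

section Expectation

variable {d : ℕ} {Λ : Matrix (State d) (State d) ℝ} {ν : State d → ℝ}
  {G Gh L : Matrix (State d) (State d) ℝ} {τ : ℕ → ℝ≥0} {B : ℕ → Set (State d)}
  {Ω : Type*} [MeasurableSpace Ω] {μ : Measure Ω} [IsProbabilityMeasure μ]
  {X : ℝ≥0 → Ω → State d} {A η : ℝ} {K : ℕ}

variable (Λ ν τ B μ X) in
/-- Mean of `gridVec` on the event that `X` is at `x`. -/
def gridMean (k : ℕ) (xh x : State d) : ℝ :=
  ∫ ω, (if X (τ k) ω = x then gridVec Λ ν τ B (fun i => X (τ i) ω) k xh else 0) ∂μ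

variable (Gh τ B) in
/-- Distribution of a chain with generator `Gh` at time `τ k`, restricted to the observed event. -/
def dualVec : ℕ → State d → ℝ
  | 0 => fun xh => if xh = 0 then 1 else 0
  | k + 1 => fun yh => ∑ xh, dualVec k xh * obsWeight B k xh *
      NormedSpace.exp (((τ (k + 1) : ℝ) - τ k) • Gh) xh yh

lemma measurable_gridVec (k : ℕ) (xh : State d) :
    Measurable fun x : ℕ → State d => gridVec Λ ν τ B x k xh := by
  induction k generalizing xh with
  | zero => exact measurable_const
  | succ k ih =>
    simp only [gridVec]
    refine Finset.measurable_sum _ fun yh _ => ((ih yh).mul measurable_const).mul ?_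
    have hpair : Measurable fun x : ℕ → State d => (x k, x (k + 1)) :=
      (measurable_pi_apply k).prodMk (measurable_pi_apply (k + 1))
    exact (measurable_of_finite fun w : State d × State d =>
      cellMat Λ ν ((τ (k + 1) : ℝ) - τ k) w.1 w.2 yh xh).comp hpair

lemma dualVec_nonneg (hD : IsDualData Λ ν G Gh L) (hτ : Monotone τ) (k : ℕ) (xh : State d) :
    0 ≤ dualVec Gh τ B k xh := by
  induction k generalizing xh with
  | zero =>
    simp only [dualVec]
    split_ifs <;> norm_num
  | succ k ih =>
    simp only [dualVec]
    exact Finset.sum_nonneg fun yh _ => mul_nonneg (mul_nonneg (ih yh) (obsWeight_nonneg _ _))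
      (matrix_exp_nonneg hD.dual_offDiag (grid_step_nonneg hτ k) _ _)

lemma sum_dualVec_le (hD : IsDualData Λ ν G Gh L) (hτ : Monotone τ) (k : ℕ) :
    ∑ xh, dualVec Gh τ B k xh ≤ 1 := by
  induction k with
  | zero => simp [dualVec]
  | succ k ih =>
    simp only [dualVec]
    rw [Finset.sum_comm]
    refine le_trans (Finset.sum_le_sum fun xh _ => ?_) ih
    rw [← Finset.mul_sum, matrix_exp_row_sum hD.dual_row_sum, mul_one]
    exact mul_le_of_le_one_right (dualVec_nonneg hD hτ k xh) (obsWeight_le_one _ _)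

lemma gridVec_le_one (hD : IsDualData Λ ν G Gh L) (hτ : Monotone τ)
    (hA : ∀ xh x, clockRate Λ ν xh x ≤ A) (hη : ∀ k < K, (τ (k + 1) : ℝ) - τ k ≤ η)
    (hAη : A * η ≤ 1)
    (x : ℕ → State d) (k : ℕ) (hk : k ≤ K) (xh : State d) :
    gridVec Λ ν τ B x k xh ≤ 1 :=
  (Finset.single_le_sum (fun xh _ => gridVec_nonneg hτ hD.rate_nonneg hA hη hAη x k hk xh)
    (Finset.mem_univ xh)).trans (sum_gridVec_le hτ hD.rate_nonneg hA hη hAη x k hk)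

lemma integrable_gridVec (hD : IsDualData Λ ν G Gh L) (hX : IsContChain μ X G) (hτ : Monotone τ)
    (hA : ∀ xh x, clockRate Λ ν xh x ≤ A) (hη : ∀ k < K, (τ (k + 1) : ℝ) - τ k ≤ η)
    (hAη : A * η ≤ 1)
    (k : ℕ) (hk : k ≤ K) (xh : State d) {s : Set Ω} (hs : MeasurableSet s)
    [DecidablePred (· ∈ s)] : Integrable
      (fun ω => if ω ∈ s then gridVec Λ ν τ B (fun i => X (τ i) ω) k xh else 0) μ := by
  have hm : Measurable fun ω => gridVec Λ ν τ B (fun i => X (τ i) ω) k xh :=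
    (measurable_gridVec k xh).comp (measurable_pi_lambda _ fun i => hX.measurable (τ i))
  refine Integrable.of_bound (C := 1) (Measurable.ite hs hm measurable_const).aestronglyMeasurable
    (Eventually.of_forall fun ω => ?_)
  split_ifs
  · rw [Real.norm_eq_abs, abs_of_nonneg (gridVec_nonneg hτ hD.rate_nonneg hA hη hAη _ k hk xh)]
    exact gridVec_le_one hD hτ hA hη hAη _ k hk xh
  · simp

/-- The Markov property of X at time τ k, applied to the grid vector, which depends on X only
through its values up to that time. -/
lemma gridMean_succ (hD : IsDualData Λ ν G Gh L) (hX : IsContChain μ X G) (hτ : Monotone τ)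
    (hτ0 : τ 0 = 0) (hA : ∀ xh x, clockRate Λ ν xh x ≤ A) (hη : ∀ k < K, (τ (k + 1) : ℝ) - τ k ≤ η)
    (hAη : A * η ≤ 1)
    (k : ℕ) (hk : k < K) (yh y : State d) :
    gridMean Λ ν τ B μ X (k + 1) yh y = ∑ xh, obsWeight B k xh * ∑ x,
      gridMean Λ ν τ B μ X k xh x * (NormedSpace.exp (((τ (k + 1) : ℝ) - τ k) • G) x y *
        cellMat Λ ν ((τ (k + 1) : ℝ) - τ k) x y xh yh) := by
  have hpt : ∀ ω, (if X (τ (k + 1)) ω = y then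
      gridVec Λ ν τ B (fun i => X (τ i) ω) (k + 1) yh else 0) =
      ∑ xh, ∑ x, obsWeight B k xh * cellMat Λ ν ((τ (k + 1) : ℝ) - τ k) x y xh yh *
        (if X (τ k) ω = x ∧ X (τ (k + 1)) ω = y then
          gridVec Λ ν τ B (fun i => X (τ i) ω) k xh else 0) := by
    intro ω
    by_cases hy : X (τ (k + 1)) ω = y
    · simp only [hy, if_true, and_true, gridVec]
      refine Finset.sum_congr rfl fun xh _ => ?_
      rw [Finset.sum_eq_single (X (τ k) ω)]
      · rw [if_pos rfl]
        ring
      · intro x _ hx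
        rw [if_neg (Ne.symm hx), mul_zero]
      · simp
    · simp [hy]
  have hintegrable : ∀ xh x, Integrable (fun ω => if X (τ k) ω = x ∧ X (τ (k + 1)) ω = y then
      gridVec Λ ν τ B (fun i => X (τ i) ω) k xh else 0) μ := by
    intro xh x
    exact integrable_gridVec hD hX hτ hA hη hAη k hk.le xh
      (s := {ω | X (τ k) ω = x ∧ X (τ (k + 1)) ω = y})
      ((hX.measurable _ (measurableSet_singleton x)).inter
        (hX.measurable _ (measurableSet_singleton y)))
  rw [gridMean]
  simp only [hpt]
  rw [integral_finsetSum _ fun xh _ => integrable_finsetSum _ fun x _ => (hintegrable xh x).const_mul _]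
  refine Finset.sum_congr rfl fun xh _ => ?_
  rw [integral_finsetSum _ fun x _ => (hintegrable xh x).const_mul _, Finset.mul_sum]
  refine Finset.sum_congr rfl fun x _ => ?_
  have hstep := integral_markov_step μ (fun i => X (τ i)) (fun i => hX.measurable _)
    (fun i => NormedSpace.exp (((τ (i + 1) : ℝ) - τ i) • G))
    (fun n x => hX.fdd n τ x hτ hτ0) (fun x => gridVec Λ ν τ B x k xh) k
    (fun x y h => by rw [gridVec_congr k h]) x y
  rw [integral_const_mul, hstep, gridMean]
  ring

lemma sum_four_comm {α : Type*} [Fintype α] (f : α → α → α → α → ℝ) :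
    ∑ a, ∑ b, ∑ c, ∑ e, f a b c e = ∑ c, ∑ e, ∑ b, ∑ a, f a b c e := by
  rw [Finset.sum_congr rfl fun a _ => Finset.sum_comm, Finset.sum_comm]
  refine Finset.sum_congr rfl fun c _ => ?_
  rw [Finset.sum_congr rfl fun a _ => Finset.sum_comm, Finset.sum_comm]
  exact Finset.sum_congr rfl fun e _ => Finset.sum_comm

/-- The transfer operator of a cell is a contraction. -/
lemma transfer_contraction {w : State d → ℝ} (hw0 : ∀ xh, 0 ≤ w xh) (hw1 : ∀ xh, w xh ≤ 1)
    {P : Matrix (State d) (State d) ℝ} (hP : P ∈ Matrix.rowStochastic ℝ (State d)) {h : ℝ}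
    (hM : ∀ x y xh yh, 0 ≤ cellMat Λ ν h x y xh yh) (D : State d → State d → ℝ) :
    ∑ yh, ∑ y, |∑ xh, w xh * ∑ x, D xh x * (P x y * cellMat Λ ν h x y xh yh)| ≤
      ∑ xh, ∑ x, |D xh x| := by
  calc ∑ yh, ∑ y, |∑ xh, w xh * ∑ x, D xh x * (P x y * cellMat Λ ν h x y xh yh)|
      ≤ ∑ yh, ∑ y, ∑ xh, ∑ x, |D xh x| * (P x y * cellMat Λ ν h x y xh yh) := by
        refine Finset.sum_le_sum fun yh _ => Finset.sum_le_sum fun y _ =>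
          (Finset.abs_sum_le_sum_abs _ _).trans (Finset.sum_le_sum fun xh _ => ?_)
        rw [abs_mul, abs_of_nonneg (hw0 xh)]
        refine (mul_le_of_le_one_left (abs_nonneg _) (hw1 xh)).trans
          ((Finset.abs_sum_le_sum_abs _ _).trans (Finset.sum_le_sum fun x _ => ?_))
        rw [abs_mul, abs_of_nonneg (mul_nonneg (hP.1 x y) (hM x y xh yh))]
    _ = ∑ xh, ∑ x, |D xh x| * ∑ y, P x y * ∑ yh, cellMat Λ ν h x y xh yh := by
        simp only [Finset.mul_sum]
        exact sum_four_comm _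
    _ = ∑ xh, ∑ x, |D xh x| := by
        simp only [sum_cellMat, mul_one, Matrix.sum_row_of_mem_rowStochastic hP]

/-- The mean of the discretization approximates the law of the dual chain. -/
lemma gridMean_bound (hD : IsDualData Λ ν G Gh L) (hX : IsContChain μ X G) (hτ : Monotone τ)
    (hτ0 : τ 0 = 0) (hA : ∀ xh x, clockRate Λ ν xh x ≤ A) (hη : ∀ k < K, (τ (k + 1) : ℝ) - τ k ≤ η)
    (hAη : A * η ≤ 1)
    {C : ℝ} (hC0 : 0 ≤ C) (hC : ∀ h : ℝ, 0 ≤ h → h ≤ 1 → ∀ xh yh y : State d,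
      |∑ x, L xh x * (NormedSpace.exp (h • G) x y * cellMat Λ ν h x y xh yh) -
        NormedSpace.exp (h • Gh) xh yh * L yh y| ≤ C * h ^ 2) (hη1 : η ≤ 1) (k : ℕ) (hk : k ≤ K) :
    ∑ xh, ∑ x, |gridMean Λ ν τ B μ X k xh x - dualVec Gh τ B k xh * L xh x| ≤
      ((d + 1 : ℕ) : ℝ) ^ 2 * C * η * τ k := by
  induction k with
  | zero =>
    have hz : ∀ xh x, gridMean Λ ν τ B μ X 0 xh x - dualVec Gh τ B 0 xh * L xh x = 0 := by
      intro xh x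
      have h0 := hX.fdd 0 τ (fun _ => x) hτ hτ0
      simp only [nonpos_iff_eq_zero, forall_eq, Finset.range_zero, Finset.prod_empty,
        mul_one] at h0
      have hms : MeasurableSet {ω | X (τ 0) ω = x} :=
        hX.measurable _ (measurableSet_singleton x)
      have h1 : ∀ ω, (if X (τ 0) ω = x then
          gridVec Λ ν τ B (fun i => X (τ i) ω) 0 xh else 0) =
          Set.indicator {ω | X (τ 0) ω = x} (fun _ => if xh = 0 then (1 : ℝ) else 0) ω := by
        intro ω
        simp [Set.indicator_apply, gridVec]
      rw [gridMean]
      simp only [h1]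
      rw [integral_indicator_const _ hms, h0]
      by_cases hxh : xh = 0
      · simp [hxh, dualVec, hD.link_zero]
      · simp [hxh, dualVec]
    simp only [hz, abs_zero, Finset.sum_const_zero, hτ0, NNReal.coe_zero, mul_zero, le_refl]
  | succ k ih =>
    set h := (τ (k + 1) : ℝ) - τ k with hh
    have h0 : 0 ≤ h := grid_step_nonneg hτ k
    have hle : h ≤ η := hη k hk
    -- The number of pairs of states over which the one-step error is summed.
    set S : ℝ := ((d + 1 : ℕ) : ℝ) ^ 2 with hS
    set D : State d → State d → ℝ := fun xh x =>
      gridMean Λ ν τ B μ X k xh x - dualVec Gh τ B k xh * L xh x with hDdef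
    -- The new error is the old one pushed through a contraction, plus a fresh consistency error of
    -- second order in the cell length.
    have hsplit : ∀ yh y, gridMean Λ ν τ B μ X (k + 1) yh y - dualVec Gh τ B (k + 1) yh * L yh y =
        (∑ xh, obsWeight B k xh * ∑ x, D xh x * (NormedSpace.exp (h • G) x y *
          cellMat Λ ν h x y xh yh)) +
        ∑ xh, obsWeight B k xh * dualVec Gh τ B k xh *
          (∑ x, L xh x * (NormedSpace.exp (h • G) x y * cellMat Λ ν h x y xh yh) -
            NormedSpace.exp (h • Gh) xh yh * L yh y) := by
      intro yh y
      rw [gridMean_succ hD hX hτ hτ0 hA hη hAη k hk]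
      simp only [dualVec]
      rw [Finset.sum_mul, ← Finset.sum_sub_distrib, ← Finset.sum_add_distrib]
      refine Finset.sum_congr rfl fun xh _ => ?_
      simp only [hDdef, sub_mul, Finset.sum_sub_distrib, mul_assoc, ← Finset.mul_sum]
      ring
    have hfirst := transfer_contraction (Λ := Λ) (ν := ν) (obsWeight_nonneg (B := B) k)
      (obsWeight_le_one (B := B) k) (matrix_exp_mem_rowStochastic hD.gen_offDiag hD.gen_row_sum h0)
      (cellMat_grid_nonneg hτ hD.rate_nonneg hA hη hAη k hk) D
    have hsecond : ∀ yh y, |∑ xh, obsWeight B k xh * dualVec Gh τ B k xh *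
        (∑ x, L xh x * (NormedSpace.exp (h • G) x y * cellMat Λ ν h x y xh yh) -
          NormedSpace.exp (h • Gh) xh yh * L yh y)| ≤ C * h ^ 2 := by
      intro yh y
      have hCh : 0 ≤ C * h ^ 2 := by positivity
      calc _ ≤ ∑ xh, dualVec Gh τ B k xh * (C * h ^ 2) := by
            refine (Finset.abs_sum_le_sum_abs _ _).trans (Finset.sum_le_sum fun xh _ => ?_)
            have hv := dualVec_nonneg (B := B) hD hτ k xh
            rw [abs_mul, abs_of_nonneg (mul_nonneg (obsWeight_nonneg _ _) hv)]
            exact mul_le_mul (mul_le_of_le_one_left hv (obsWeight_le_one _ _))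
              (hC h h0 (hle.trans hη1) xh yh y) (abs_nonneg _) hv
        _ ≤ C * h ^ 2 := by
            rw [← Finset.sum_mul]
            exact mul_le_of_le_one_left hCh (sum_dualVec_le hD hτ k)
    calc ∑ yh, ∑ y, |gridMean Λ ν τ B μ X (k + 1) yh y - dualVec Gh τ B (k + 1) yh * L yh y|
        ≤ ∑ yh : State d, ∑ y : State d, (|∑ xh, obsWeight B k xh * ∑ x, D xh x *
          (NormedSpace.exp (h • G) x y * cellMat Λ ν h x y xh yh)| + C * h ^ 2) := by
          refine Finset.sum_le_sum fun yh _ => Finset.sum_le_sum fun y _ => ?_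
          rw [hsplit]
          exact (abs_add_le _ _).trans (add_le_add le_rfl (hsecond yh y))
      _ ≤ S * C * η * τ k + S * (C * h ^ 2) := by
          simp only [Finset.sum_add_distrib]
          refine add_le_add (hfirst.trans (ih (by omega))) (le_of_eq ?_)
          simp only [Finset.sum_const, Finset.card_univ, Fintype.card_fin, nsmul_eq_mul, hS]
          ring
      _ ≤ S * C * η * τ k + S * (C * (η * h)) := by
          have : h ^ 2 ≤ η * h := by
            rw [pow_two]
            exact mul_le_mul_of_nonneg_right hle h0
          gcongr
      _ = S * C * η * τ (k + 1) := by
          rw [hh]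
          ring

end Expectation

/-! ### Refining a sequence of times -/

section Refinement

variable {d : ℕ} (t : ℕ → ℝ≥0) (z : ℕ → State d) (N : ℕ)

/-- Each interval `[t i, t (i + 1)]` is divided into `N` equal parts. -/
def gridTime (k : ℕ) : ℝ≥0 :=
  t (k / N) + (k % N : ℕ) / N * (t (k / N + 1) - t (k / N))

/-- The values of `z` at the times `t`, and no condition at the other grid points. -/
def gridObs (k : ℕ) : Set (State d) := {x | N ∣ k → x = z (k / N)}

variable {t z N}

lemma gridTime_add (ht : Monotone t) (hN : 0 < N) (i : ℕ) {j : ℕ} (hj : j ≤ N) :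
    (gridTime t N (i * N + j) : ℝ) = t i + (j : ℝ) / N * ((t (i + 1) : ℝ) - t i) := by
  have hN' : (N : ℝ) ≠ 0 := by positivity
  rcases hj.eq_or_lt with rfl | hj
  · have h1 : i * j + j = j * (i + 1) := by ring
    rw [gridTime, h1, Nat.mul_div_cancel_left _ hN, Nat.mul_mod_right]
    rw [div_self hN']
    simp
  · have h1 : (i * N + j) / N = i := by
      rw [mul_comm, Nat.mul_add_div hN, Nat.div_eq_of_lt hj, add_zero]
    have h2 : (i * N + j) % N = j := by
      rw [mul_comm, Nat.mul_add_mod, Nat.mod_eq_of_lt hj]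
    rw [gridTime, h1, h2]
    push_cast [NNReal.coe_sub (ht (Nat.le_succ i))]
    rfl

lemma gridTime_mul (ht : Monotone t) (hN : 0 < N) (i : ℕ) : gridTime t N (i * N) = t i := by
  have := gridTime_add ht hN i (Nat.zero_le N)
  rw [add_zero] at this
  exact_mod_cast (by simpa using this : (gridTime t N (i * N) : ℝ) = t i)

lemma gridTime_step (ht : Monotone t) (hN : 0 < N) (i : ℕ) {j : ℕ} (hj : j < N) :
    (gridTime t N (i * N + j + 1) : ℝ) - gridTime t N (i * N + j) =
      ((t (i + 1) : ℝ) - t i) / N := by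
  rw [add_assoc, gridTime_add ht hN i hj, gridTime_add ht hN i hj.le]
  push_cast
  ring

lemma eq_mul_add_mod (hN : 0 < N) (k : ℕ) : ∃ i j, j < N ∧ k = i * N + j :=
  ⟨k / N, k % N, Nat.mod_lt k hN, by rw [mul_comm]; exact (Nat.div_add_mod k N).symm⟩

lemma gridTime_monotone (ht : Monotone t) (hN : 0 < N) : Monotone (gridTime t N) := by
  refine monotone_nat_of_le_succ fun k => ?_
  obtain ⟨i, j, hj, rfl⟩ := eq_mul_add_mod hN k
  have h := gridTime_step ht hN i hj
  have h1 : (0 : ℝ) ≤ (t (i + 1) : ℝ) - t i := sub_nonneg.2 (by exact_mod_cast ht (Nat.le_succ i))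
  have h2 : (0 : ℝ) ≤ ((t (i + 1) : ℝ) - t i) / N := by positivity
  rw [← h, sub_nonneg] at h2
  exact_mod_cast h2

lemma gridTime_mesh (ht : Monotone t) (hN : 0 < N) {n k : ℕ} (hk : k < n * N) :
    (gridTime t N (k + 1) : ℝ) - gridTime t N k ≤ t n / N := by
  obtain ⟨i, j, hj, rfl⟩ := eq_mul_add_mod hN k
  rw [gridTime_step ht hN i hj]
  have hi : i + 1 ≤ n := by
    by_contra h
    have : n * N ≤ i * N := Nat.mul_le_mul_right N (by omega)
    omega
  have h1 : (t (i + 1) : ℝ) ≤ t n := by exact_mod_cast ht hi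
  gcongr
  linarith [(t i).coe_nonneg]

lemma obsWeight_gridObs_mul (hN : 0 < N) (i : ℕ) (x : State d) :
    obsWeight (gridObs z N) (i * N) x = if x = z i then 1 else 0 := by
  have : x ∈ gridObs z N (i * N) ↔ x = z i := by
    simp [gridObs, Nat.mul_div_cancel _ hN]
  simp only [obsWeight, this]

lemma obsWeight_gridObs_add {i j : ℕ} (h0 : 0 < j) (hj : j < N) (x : State d) :
    obsWeight (gridObs z N) (i * N + j) x = 1 := by
  have : ¬ N ∣ i * N + j := by
    rw [Nat.dvd_add_right (Dvd.intro_left i rfl)]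
    exact fun h => absurd (Nat.le_of_dvd h0 h) (by omega)
  have h2 : x ∈ gridObs z N (i * N + j) := fun h => absurd h this
  simp [obsWeight, h2]

/-- The law of the dual chain at the given times, from the refinement. -/
lemma dualVec_grid (ht : Monotone t) (hN : 0 < N) (Gh : Matrix (State d) (State d) ℝ) (i : ℕ)
    (x : State d) :
    dualVec Gh (gridTime t N) (gridObs z N) (i * N) x * obsWeight (gridObs z N) (i * N) x =
      (if z 0 = 0 then 1 else 0) * (∏ l ∈ Finset.range i,
        NormedSpace.exp (((t (l + 1) : ℝ) - t l) • Gh) (z l) (z (l + 1))) *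
          (if x = z i then 1 else 0) := by
  have hN' : (N : ℝ) ≠ 0 := by positivity
  induction i generalizing x with
  | zero =>
    rw [obsWeight_gridObs_mul hN, zero_mul]
    simp only [dualVec, Finset.range_zero, Finset.prod_empty, mul_one]
    by_cases hx : x = z 0
    · simp [hx]
    · simp [hx]
  | succ i ih =>
    set c := (if z 0 = 0 then (1 : ℝ) else 0) * (∏ l ∈ Finset.range i,
        NormedSpace.exp (((t (l + 1) : ℝ) - t l) • Gh) (z l) (z (l + 1))) with hc
    -- After the observation at t i nothing is observed until t (i + 1), so the exponentials of the
    -- small cells compose by the semigroup property.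
    have hseg : ∀ j, 1 ≤ j → j ≤ N → ∀ y,
        dualVec Gh (gridTime t N) (gridObs z N) (i * N + j) y =
          c * NormedSpace.exp (((j : ℝ) / N * ((t (i + 1) : ℝ) - t i)) • Gh) (z i) y := by
      intro j hj
      induction j, hj using Nat.le_induction with
      | base =>
        intro _ y
        have hstep := gridTime_step ht hN i hN
        rw [add_zero] at hstep
        simp only [dualVec]
        rw [hstep, Finset.sum_congr rfl fun xh _ => by rw [ih xh], Finset.sum_eq_single (z i)]
        · rw [if_pos rfl, mul_one]
          congr 4
          push_cast
          ring_nf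
        · intro b _ hb
          rw [if_neg hb]
          ring
        · simp
      | succ j hj ihj =>
        intro hjN y
        rw [← add_assoc]
        simp only [dualVec]
        rw [gridTime_step ht hN i (show j < N by omega),
          Finset.sum_congr rfl fun xh _ => by
            rw [obsWeight_gridObs_add (show 0 < j by omega) (show j < N by omega), mul_one,
              ihj (by omega), mul_assoc], ← Finset.mul_sum, ← Matrix.mul_apply, ← matrix_exp_add]
        congr 4
        push_cast
        ring_nf
    have hend : (i + 1) * N = i * N + N := by ring
    rw [hend, hseg N hN le_rfl x, ← hend, obsWeight_gridObs_mul hN, Finset.prod_range_succ,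
      div_self hN', one_mul]
    by_cases hx : x = z (i + 1)
    · rw [hx, if_pos rfl, hc]
      ring
    · rw [if_neg hx]
      ring

end Refinement

/-! ### Joint distributions of the continuous-time construction -/

section ContJoint

variable {d : ℕ} {Λ : Matrix (State d) (State d) ℝ} {ν : State d → ℝ}

/-- Only multiples of N carry a condition, so the event does not depend on the refinement; the limit
N → ∞ is taken for a fixed event. -/
lemma goodSet_grid {p : ℝ≥0 → State d} (hp : IsCadlag p)
    (hr : ∀ x, clockRate Λ ν (Fin.last d) x ≤ 0) {t : ℕ → ℝ≥0} (ht : Monotone t) (z : ℕ → State d)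
    (n : ℕ) {N : ℕ} (hN : 0 < N) :
    goodSet Λ ν p (gridTime t N) (gridObs z N) (n * N) 0 (0, 0) =
      {e | ∀ i ≤ n, dualPathCont Λ ν p e (t i) = z i} := by
  ext e
  constructor
  · intro h i hi
    obtain ⟨m, h1, h2⟩ := exists_mem_skelFrom hp hr e (0, 0) (t i) zero_le
    have := h m (i * N) (Nat.zero_le _) (Nat.mul_le_mul_right N hi)
    rw [gridTime_mul ht hN] at this
    rw [dualPathCont_eq hp h1 h2]
    have h3 := this h1 h2 (Dvd.intro_left i rfl)
    rwa [Nat.mul_div_cancel _ hN] at h3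
  · rintro h m j - hj h1 h2 ⟨i, rfl⟩
    rw [mul_comm N i] at hj h1 h2 ⊢
    rw [gridTime_mul ht hN] at h1 h2
    rw [Nat.mul_div_cancel _ hN, ← dualPathCont_eq hp h1 h2]
    exact h i (Nat.le_of_mul_le_mul_right hj hN)

variable {G Gh L : Matrix (State d) (State d) ℝ}
  {Ω : Type*} [MeasurableSpace Ω] {μ : Measure Ω}
  {X : ℝ≥0 → Ω → State d} {E : ℕ → Ω → ℝ} {Xh : ℝ≥0 → Ω → State d}

/-- The path of `X` as a random element of the space of paths. -/
def pathOf (hX : IsContChain μ X G) (ω : Ω) : CadlagPath d :=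
  ⟨fun s => X s ω, hX.right_cont ω, hX.left_lim ω⟩

lemma measurable_pathOf (hX : IsContChain μ X G) : Measurable (pathOf hX) :=
  (measurable_pi_lambda _ hX.measurable).subtype_mk

lemma indepFun_pathOf (hX : IsContChain μ X G) {ρ : Measure ℝ}
    (hE : IsIndependentNoise μ X E ρ) : IndepFun (pathOf hX) (fun ω n => E n ω) μ := by
  have h := hE.indep
  rw [IndepFun_iff_Indep] at h ⊢
  convert! h using 1
  exact MeasurableSpace.comap_comp

lemma measurable_of_dualPathCont (hD : IsDualData Λ ν G Gh L) (hX : IsContChain μ X G)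
    {ρ : Measure ℝ} (hE : IsIndependentNoise μ X E ρ)
    (hXh : ∀ t ω, Xh t ω = dualPathCont Λ ν (fun s => X s ω) (fun n => E n ω) t) (t : ℝ≥0) :
    Measurable (Xh t) := by
  have h1 : Xh t = (fun q : CadlagPath d × (ℕ → ℝ) => dualPathCont Λ ν q.1.1 q.2 t) ∘
      fun ω => (pathOf hX ω, fun n => E n ω) := by
    ext1 ω
    exact hXh t ω
  rw [h1]
  exact (measurable_dualPathCont Λ ν hD.rate_last t).comp
    ((measurable_pathOf hX).prodMk (measurable_pi_lambda _ hE.measurable))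

variable [IsProbabilityMeasure μ]

/-- Integration over the clocks. -/
lemma joint_eq_integral (hD : IsDualData Λ ν G Gh L) (hX : IsContChain μ X G)
    (hE : IsIndependentNoise μ X E clockLaw)
    (hXh : ∀ t ω, Xh t ω = dualPathCont Λ ν (fun s => X s ω) (fun n => E n ω) t)
    (n : ℕ) (t : ℕ → ℝ≥0) (z : ℕ → State d) (y : State d) :
    μ.real {ω | (∀ i ≤ n, Xh (t i) ω = z i) ∧ X (t n) ω = y} =
      ∫ ω, (if X (t n) ω = y then clocksLaw.real
        {e | ∀ i ≤ n, dualPathCont Λ ν (fun s => X s ω) e (t i) = z i} else 0) ∂μ := by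
  have hm := measurable_pathOf hX
  have hmE : Measurable fun ω n => E n ω := measurable_pi_lambda _ hE.measurable
  have hlaw := map_prod_noise μ (pathOf hX) hm E hE.measurable clockLaw hE.law hE.iid
    (indepFun_pathOf hX hE)
  set S : Set (CadlagPath d × (ℕ → ℝ)) :=
    {q | (∀ i ≤ n, dualPathCont Λ ν q.1.1 q.2 (t i) = z i) ∧ q.1.1 (t n) = y} with hS
  have hqn : Measurable fun q : CadlagPath d × (ℕ → ℝ) => q.1.1 (t n) :=
    measurable_cadlag_apply measurable_fst measurable_const
  have hSm : MeasurableSet S :=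
    (measurableSet_fdd
      (Y := fun i (q : CadlagPath d × (ℕ → ℝ)) => dualPathCont Λ ν q.1.1 q.2 (t i))
      (fun i => measurable_dualPathCont Λ ν hD.rate_last (t i)) n z).inter
      (hqn (measurableSet_singleton y))
  have h1 : μ.real {ω | (∀ i ≤ n, Xh (t i) ω = z i) ∧ X (t n) ω = y} =
      ((μ.map (pathOf hX)).prod clocksLaw).real S := by
    rw [← hlaw, map_measureReal_apply (hm.prodMk hmE) hSm]
    congr 1
    ext ω
    simp only [hS, Set.mem_ofPred_eq, Set.mem_preimage, hXh]
    rfl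
  have : IsProbabilityMeasure (μ.map (pathOf hX)) :=
    Measure.isProbabilityMeasure_map hm.aemeasurable
  have hsm : AEStronglyMeasurable (fun q => clocksLaw.real (Prod.mk q ⁻¹' S))
      (μ.map (pathOf hX)) :=
    (measurable_measure_prodMk_left hSm).ennreal_toReal.aestronglyMeasurable
  rw [h1, prod_real_eq_integral _ _ hSm, integral_map hm.aemeasurable hsm]
  congr 1
  ext ω
  by_cases hy : X (t n) ω = y
  · rw [if_pos hy]
    congr 1
    ext e
    simp [hS, hy, pathOf]
  · have : Prod.mk (pathOf hX ω) ⁻¹' S = ∅ := by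
      ext e
      simp [hS, hy, pathOf]
    rw [this, measureReal_empty, if_neg hy]

/-- The joint distribution of the past of `X̂` and the present of `X`. -/
theorem cont_joint_fdd (hD : IsDualData Λ ν G Gh L) (hX : IsContChain μ X G)
    (hE : IsIndependentNoise μ X E clockLaw)
    (hXh : ∀ t ω, Xh t ω = dualPathCont Λ ν (fun s => X s ω) (fun n => E n ω) t)
    (n : ℕ) (t : ℕ → ℝ≥0) (z : ℕ → State d) (y : State d) (ht : Monotone t) (ht0 : t 0 = 0) :
    μ.real {ω | (∀ i ≤ n, Xh (t i) ω = z i) ∧ X (t n) ω = y} =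
      (if z 0 = 0 then 1 else 0) * (∏ i ∈ Finset.range n,
        NormedSpace.exp (((t (i + 1) : ℝ) - t i) • Gh) (z i) (z (i + 1))) * L (z n) y := by
  rw [joint_eq_integral hD hX hE hXh]
  obtain ⟨A, hA'⟩ := (Set.finite_range fun w : State d × State d =>
    clockRate Λ ν w.1 w.2).bddAbove
  have hA : ∀ xh x, clockRate Λ ν xh x ≤ A := fun xh x => hA' ⟨(xh, x), rfl⟩
  have hA0 : 0 ≤ A := (hD.rate_nonneg 0 0).trans (hA 0 0)
  obtain ⟨C, hC0, hC⟩ := transfer_consistency (Λ := Λ) (ν := ν) hD.gen_offDiag hD.gen_row_sum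
    hD.dual_offDiag hD.dual_row_sum hD.consistent
  set c : ℝ := (if z 0 = 0 then 1 else 0) * (∏ i ∈ Finset.range n,
        NormedSpace.exp (((t (i + 1) : ℝ) - t i) • Gh) (z i) (z (i + 1))) with hc
  set η : ℕ → ℝ := fun N => (t n : ℝ) / N with hηdef
  have hηlim : Tendsto η atTop (𝓝 0) := tendsto_const_div_atTop_nhds_zero_nat _
  have hη0 : ∀ N, 0 ≤ η N := fun N => by positivity
  set f : ℕ → Ω → ℝ := fun N ω => if X (t n) ω = y then
    ∑ xh, gridVec Λ ν (gridTime t N) (gridObs z N) (fun k => X (gridTime t N k) ω) (n * N) xh *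
      obsWeight (gridObs z N) (n * N) xh else 0 with hf
  have hlarge : ∀ᶠ N in atTop, 0 < N ∧ A * η N ≤ 1 ∧ η N ≤ 1 := by
    have h1 : Tendsto (fun N => A * η N) atTop (𝓝 (A * 0)) := hηlim.const_mul A
    rw [mul_zero] at h1
    filter_upwards [eventually_gt_atTop 0, h1.eventually (ge_mem_nhds one_pos),
      hηlim.eventually (ge_mem_nhds one_pos)] with N h1 h2 h3
    exact ⟨h1, h2, h3⟩
  have hgrid0 : ∀ {N}, 0 < N → gridTime t N 0 = 0 := fun {N} hN => by
    have := gridTime_mul ht hN 0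
    rwa [zero_mul, ht0] at this
  -- For each ω the pathwise error tends to 0, with constants depending on the jumps of that path.
  -- Since the approximations lie in [0, 1], dominated convergence applies.
  have hlim1 : Tendsto (fun N => ∫ ω, f N ω ∂μ) atTop (𝓝 (∫ ω, (if X (t n) ω = y then
      clocksLaw.real {e | ∀ i ≤ n, dualPathCont Λ ν (fun s => X s ω) e (t i) = z i} else 0) ∂μ)) := by
    refine tendsto_integral_filter_of_dominated_convergence (fun _ => (1 : ℝ))
      (Eventually.of_forall fun N => ?_) ?_ (integrable_const _)
      (Eventually.of_forall fun ω => ?_)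
    · refine (Measurable.ite (hX.measurable _ (measurableSet_singleton y))
        (Finset.measurable_sum _ fun xh _ => Measurable.mul_const ?_ _)
        measurable_const).aestronglyMeasurable
      exact (measurable_gridVec (n * N) xh).comp
        (measurable_pi_lambda _ fun k => hX.measurable (gridTime t N k))
    · filter_upwards [hlarge] with N hN
      refine Eventually.of_forall fun ω => ?_
      have hτ := gridTime_monotone ht hN.1
      have hη : ∀ k < n * N, (gridTime t N (k + 1) : ℝ) - gridTime t N k ≤ η N :=
        fun k hk => gridTime_mesh ht hN.1 hk
      simp only [hf]
      split_ifs
      · have h0 := gridVec_nonneg (B := gridObs z N) hτ hD.rate_nonneg hA hη hN.2.1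
          (fun k => X (gridTime t N k) ω) (n * N) le_rfl
        rw [Real.norm_eq_abs, abs_of_nonneg (Finset.sum_nonneg fun xh _ =>
          mul_nonneg (h0 xh) (obsWeight_nonneg _ _))]
        refine le_trans (Finset.sum_le_sum fun xh _ => ?_)
          (sum_gridVec_le (B := gridObs z N) hτ hD.rate_nonneg hA hη hN.2.1
            (fun k => X (gridTime t N k) ω) (n * N) le_rfl)
        exact mul_le_of_le_one_right (h0 xh) (obsWeight_le_one _ _)
      · simp
    · simp only [hf]
      by_cases hy : X (t n) ω = y
      · simp only [hy, if_true]
        have hp : IsCadlag fun s => X s ω := ⟨hX.right_cont ω, hX.left_lim ω⟩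
        obtain ⟨δ, hδ, F, hF⟩ := hp.exists_cells (t n)
        rw [tendsto_iff_dist_tendsto_zero]
        have hb : Tendsto (fun N => 2 * A ^ 2 * η N * t n + 2 * A * η N * F.card) atTop (𝓝 0) := by
          have := ((hηlim.const_mul (2 * A ^ 2)).mul_const (t n : ℝ)).add
            ((hηlim.const_mul (2 * A)).mul_const (F.card : ℝ))
          simpa using this
        refine squeeze_zero' (Eventually.of_forall fun N => dist_nonneg) ?_ hb
        filter_upwards [hlarge, hηlim.eventually (gt_mem_nhds hδ)] with N hN hNδ
        have hτ := gridTime_monotone ht hN.1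
        have hη : ∀ k < n * N, (gridTime t N (k + 1) : ℝ) - gridTime t N k ≤ η N :=
          fun k hk => gridTime_mesh ht hN.1 hk
        have hKt : gridTime t N (n * N) = t n := gridTime_mul ht hN.1 n
        have := grid_path_bound (B := gridObs z N) hτ hD.rate_nonneg hA hη hN.2.1 hp
          (δ := δ) (F := F) (by rw [hKt]; exact hF) (hη0 N) hNδ
        rw [hgrid0 hN.1, hKt, goodProb, ENNReal.coe_zero,
          goodSet_grid hp hD.rate_last ht z n hN.1] at this
        rw [dist_comm, Real.dist_eq]
        exact this
      · simp [hy]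
  -- The same integrals, computed through the Markov property of X: their distance to the product
  -- form is linear in the mesh.
  have hlim2 : Tendsto (fun N => ∫ ω, f N ω ∂μ) atTop (𝓝 (c * L (z n) y)) := by
    rw [tendsto_iff_dist_tendsto_zero]
    have hb : Tendsto (fun N => ((d + 1 : ℕ) : ℝ) ^ 2 * C * η N * t n) atTop (𝓝 0) := by
      have := (hηlim.const_mul (((d + 1 : ℕ) : ℝ) ^ 2 * C)).mul_const (t n : ℝ)
      simpa using this
    refine squeeze_zero' (Eventually.of_forall fun N => dist_nonneg) ?_ hb
    filter_upwards [hlarge] with N hN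
    have hτ := gridTime_monotone ht hN.1
    have hη : ∀ k < n * N, (gridTime t N (k + 1) : ℝ) - gridTime t N k ≤ η N :=
      fun k hk => gridTime_mesh ht hN.1 hk
    have hKt : gridTime t N (n * N) = t n := gridTime_mul ht hN.1 n
    have hbound := gridMean_bound (B := gridObs z N) hD hX hτ (hgrid0 hN.1) hA hη hN.2.1 hC0 hC
      hN.2.2 (n * N) le_rfl
    rw [hKt] at hbound
    have e1 : ∫ ω, f N ω ∂μ = ∑ xh, obsWeight (gridObs z N) (n * N) xh *
        gridMean Λ ν (gridTime t N) (gridObs z N) μ X (n * N) xh y := by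
      have hpt : ∀ ω, f N ω = ∑ xh, obsWeight (gridObs z N) (n * N) xh *
          (if X (gridTime t N (n * N)) ω = y then
            gridVec Λ ν (gridTime t N) (gridObs z N) (fun k => X (gridTime t N k) ω) (n * N) xh
              else 0) := by
        intro ω
        simp only [hf, hKt]
        split_ifs
        · exact Finset.sum_congr rfl fun xh _ => mul_comm _ _
        · simp
      simp only [hpt]
      rw [integral_finsetSum]
      · exact Finset.sum_congr rfl fun xh _ => by rw [integral_const_mul, gridMean]
      · intro xh _
        exact (integrable_gridVec hD hX hτ hA hη hN.2.1 (n * N) le_rfl xh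
          (s := {ω | X (gridTime t N (n * N)) ω = y})
          (hX.measurable _ (measurableSet_singleton y))).const_mul _
    have e2 : c * L (z n) y = ∑ xh, obsWeight (gridObs z N) (n * N) xh *
        (dualVec Gh (gridTime t N) (gridObs z N) (n * N) xh * L xh y) := by
      have : ∀ xh, obsWeight (gridObs z N) (n * N) xh *
          (dualVec Gh (gridTime t N) (gridObs z N) (n * N) xh * L xh y) =
          c * (if xh = z n then 1 else 0) * L xh y := by
        intro xh
        rw [← mul_assoc, mul_comm (obsWeight _ _ _), dualVec_grid ht hN.1]
      simp only [this]
      rw [Finset.sum_eq_single (z n)]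
      · simp
      · intro b _ hb
        simp [hb]
      · simp
    rw [Real.dist_eq, e1, e2, ← Finset.sum_sub_distrib]
    refine le_trans (Finset.abs_sum_le_sum_abs _ _) (le_trans (Finset.sum_le_sum fun xh _ => ?_)
      hbound)
    rw [← mul_sub, abs_mul, abs_of_nonneg (obsWeight_nonneg _ _)]
    refine (mul_le_of_le_one_left (abs_nonneg _) (obsWeight_le_one _ _)).trans ?_
    exact Finset.single_le_sum (f := fun x => |gridMean Λ ν (gridTime t N) (gridObs z N) μ X (n * N)
      xh x - dualVec Gh (gridTime t N) (gridObs z N) (n * N) xh * L xh x|)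
      (fun x _ => abs_nonneg _) (Finset.mem_univ y)
  exact tendsto_nhds_unique hlim1 hlim2

/-- The constructed process is a chain with generator `Gh`. -/
theorem isContChain_dual (hD : IsDualData Λ ν G Gh L) (hX : IsContChain μ X G)
    (hE : IsIndependentNoise μ X E clockLaw)
    (hXh : ∀ t ω, Xh t ω = dualPathCont Λ ν (fun s => X s ω) (fun n => E n ω) t) :
    IsContChain μ Xh Gh := by
  have hpath : ∀ ω, IsCadlag fun t => Xh t ω := by
    intro ω
    have h1 : (fun t => Xh t ω) = dualPathCont Λ ν (fun s => X s ω) (fun n => E n ω) :=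
      funext fun t => hXh t ω
    rw [h1]
    exact isCadlag_dualPathCont ⟨hX.right_cont ω, hX.left_lim ω⟩ hD.rate_last _
  refine ⟨measurable_of_dualPathCont hD hX hE hXh, fun ω => (hpath ω).right_cont,
    fun ω => (hpath ω).left_lim, fun n t x ht ht0 => ?_⟩
  rw [measureReal_eq_sum_fiber μ (hX.measurable (t n))]
  have h1 : ∀ y, μ.real {ω | ω ∈ {ω | ∀ i ≤ n, Xh (t i) ω = x i} ∧ X (t n) ω = y} = _ :=
    fun y => cont_joint_fdd hD hX hE hXh n t x y ht ht0
  rw [Finset.sum_congr rfl fun y _ => h1 y, ← Finset.mul_sum,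
    Matrix.sum_row_of_mem_rowStochastic hD.link_stochastic, mul_one]

end ContJoint

/-! ### Data for the construction -/

section Data

variable {d : ℕ} {ν : State d → ℝ}

lemma spectralGenerator_apply (hν : ν (Fin.last d) = 0) (i j : State d) :
    spectralGenerator ν i j = ν i * ((if j = up i then 1 else 0) - (if j = i then 1 else 0)) := by
  by_cases hi : i.val < d
  · have h1 := up_val hi
    have h2 := up_ne hi
    by_cases hj : j = i
    · subst hj
      simp [spectralGenerator, h2.symm]
    · have h3 : j.val = i.val + 1 ↔ j = up i := by rw [Fin.ext_iff, h1]
      simp [spectralGenerator, hj, h3]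
  · have := eq_last_of_not_lt hi
    subst this
    have h3 : j.val ≠ d + 1 := by omega
    simp [spectralGenerator, hν, h3]

lemma spectralGenerator_offDiag (h0 : ∀ i, 0 ≤ ν i) (i j : State d) (hij : i ≠ j) :
    0 ≤ spectralGenerator ν i j := by
  simp only [spectralGenerator, Matrix.of_apply, if_neg hij.symm]
  split_ifs
  exacts [h0 i, le_rfl]

lemma spectralGenerator_row_sum (hν : ν (Fin.last d) = 0) (i : State d) :
    ∑ j, spectralGenerator ν i j = 0 := by
  simp [spectralGenerator_apply hν, ← Finset.mul_sum]

/-- The link and the spectral generator are data for the construction. -/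
theorem isDualData_link {G L : Matrix (State d) (State d) ℝ} (hν : ν (Fin.last d) = 0)
    (h0 : ∀ i, 0 ≤ ν i) (hG1 : ∀ i j, i ≠ j → 0 ≤ G i j) (hG2 : ∀ i, ∑ j, G i j = 0)
    (hL : L ∈ Matrix.rowStochastic ℝ (State d)) (hL0 : ∀ x, L 0 x = if x = 0 then 1 else 0)
    (hT : ∀ i j, i < j → L i j = 0)
    (hup : ∀ i j : State d, i.val < d → j ≤ i → L i j = 0 → L (up i) j = 0)
    (hI : L * G = spectralGenerator ν * L) :
    IsDualData L ν G (spectralGenerator ν) L := by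
  have hS : ∀ xh y, ∑ x, L xh x * G x y = ν xh * (L (up xh) y - L xh y) := by
    intro xh y
    rw [← Matrix.mul_apply, hI, Matrix.mul_apply]
    simp only [spectralGenerator_apply hν, mul_assoc, ← Finset.mul_sum, sub_mul, ite_mul, one_mul,
      zero_mul, Finset.sum_sub_distrib, Finset.sum_ite_eq', Finset.mem_univ, if_true]
  refine ⟨fun xh x => ?_, fun x => ?_, hG1, hG2, spectralGenerator_offDiag h0,
    spectralGenerator_row_sum hν, hL, hL0, fun xh yh y => ?_⟩
  · exact div_nonneg (mul_nonneg (h0 _) (hL.1 _ _)) (hL.1 _ _)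
  · simp [clockRate, hν]
  -- When X jumps to y, the reaction of X̂ depends on y only, so the sum over x ≠ y is the full sum
  -- minus its diagonal term, and the full sum is known from the intertwining.
  have hsplit : ∑ x, L xh x * cellGen L ν G x y xh yh =
      (∑ x, L xh x * G x y - L xh y * G y y) * (if yh = jumpMap y xh then 1 else 0) +
      L xh y * cellGen L ν G y y xh yh := by
    rw [← Finset.add_sum_erase _ _ (Finset.mem_univ y),
      ← Finset.add_sum_erase _ (fun x => L xh x * G x y) (Finset.mem_univ y), add_sub_cancel_left,
      Finset.sum_mul, add_comm]
    congr 1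
    refine Finset.sum_congr rfl fun x hx => ?_
    rw [cellGen, if_neg (Finset.mem_erase.1 hx).1]
    ring
  rw [hsplit, hS, cellGen, if_pos rfl, spectralGenerator_apply hν]
  -- If y = x̂ + 1, the link vanishes at (x̂, y) and the whole flow ν Λ(x̂ + 1, y) comes from jumps
  -- of X that push X̂. Otherwise jumps of X leave X̂ in place, and this flow must come from the
  -- clock.
  by_cases hy : y.val = xh.val + 1
  · have hxd : xh.val < d := by omega
    have hyu : y = up xh := Fin.ext (by rw [hy, up_val hxd])
    have hz : L xh y = 0 := hT _ _ (by rw [Fin.lt_def]; omega)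
    rw [hz, jumpMap, if_pos hy]
    by_cases h1 : yh = up xh
    · simp [h1, up_ne hxd]
    · by_cases h2 : yh = xh
      · simp [h2, (up_ne hxd).symm, hz]
      · simp [h1, h2]
  -- Off the support of the link the rate is a division by zero; the identity still holds because a
  -- zero of the link persists to the next row.
  · have hr : L xh y * clockRate L ν xh y = ν xh * L (up xh) y := by
      by_cases hz : L xh y = 0
      · rw [hz, zero_mul]
        by_cases hxd : xh.val < d
        · rcases le_or_gt y xh with h | h
          · rw [hup xh y hxd h hz, mul_zero]
          · rw [hT _ _ (by rw [Fin.lt_def, up_val hxd]; rw [Fin.lt_def] at h; omega), mul_zero]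
        · rw [eq_last_of_not_lt hxd, hν, zero_mul]
      · rw [clockRate]
        field_simp
    rw [jumpMap, if_neg hy]
    have e : L xh y * (G y y * (if yh = xh then 1 else 0) + clockRate L ν xh y *
        ((if yh = up xh then 1 else 0) - (if yh = xh then 1 else 0))) =
        L xh y * G y y * (if yh = xh then 1 else 0) + ν xh * L (up xh) y *
        ((if yh = up xh then 1 else 0) - (if yh = xh then 1 else 0)) := by
      rw [← hr]
      ring
    rw [e]
    by_cases h1 : yh = up xh
    · by_cases h2 : yh = xh
      · have h3 : up xh = xh := h1 ▸ h2
        simp only [h2, h3]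
        simp
      · subst h1
        simp [h2]
    · by_cases h2 : yh = xh
      · subst h2
        simp only [h1, if_true, if_false]
        ring
      · simp [h1, h2]

/-- With a constant path, the construction runs through the clocks one after the other. -/
theorem isDualData_const (hν : ν (Fin.last d) = 0) (h0 : ∀ i, 0 ≤ ν i) :
    IsDualData (Matrix.of fun _ _ => 1) ν 0 (spectralGenerator ν)
      (Matrix.of fun _ x => if x = 0 then 1 else 0) := by
  have hr : ∀ xh x : State d, clockRate (Matrix.of fun _ _ => 1) ν xh x = ν xh := by
    intro xh x
    simp [clockRate]
  refine ⟨fun xh x => by rw [hr]; exact h0 _, fun x => by rw [hr, hν], by simp, by simp,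
    spectralGenerator_offDiag h0, spectralGenerator_row_sum hν, ⟨fun i j => ?_, ?_⟩, by simp,
    fun xh yh y => ?_⟩
  · simp only [Matrix.of_apply]
    split_ifs <;> norm_num
  · ext i
    simp [Matrix.mulVec, dotProduct]
  · rw [spectralGenerator_apply hν, Finset.sum_eq_single 0]
    · by_cases hy : 0 = y
      · subst hy
        simp [cellGen, hr]
      · simp [cellGen, hy, Ne.symm hy]
    · intro x _ hx
      simp [hx]
    · simp

end Data

/-! ### Almost sure properties in continuous time -/

section AlmostSure

variable {d : ℕ} {Λ G Gh L : Matrix (State d) (State d) ℝ} {ν : State d → ℝ}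
  {Ω : Type*} [MeasurableSpace Ω] {μ : Measure Ω}
  {X : ℝ≥0 → Ω → State d} {E : ℕ → Ω → ℝ} {Xh : ℝ≥0 → Ω → State d}

lemma IsContChain.isCadlag (hX : IsContChain μ X G) (ω : Ω) : IsCadlag fun t => X t ω :=
  ⟨hX.right_cont ω, hX.left_lim ω⟩

variable [IsProbabilityMeasure μ]

lemma cont_joint_fdd_mul (hD : IsDualData Λ ν G Gh L) (hX : IsContChain μ X G)
    (hE : IsIndependentNoise μ X E clockLaw)
    (hXh : ∀ t ω, Xh t ω = dualPathCont Λ ν (fun s => X s ω) (fun n => E n ω) t)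
    (n : ℕ) (t : ℕ → ℝ≥0) (x : ℕ → State d) (y : State d) (ht : Monotone t) (ht0 : t 0 = ⊥) :
    μ.real {ω | (∀ i ≤ n, Xh (t i) ω = x i) ∧ X (t n) ω = y} =
      μ.real {ω | ∀ i ≤ n, Xh (t i) ω = x i} * L (x n) y := by
  rw [(isContChain_dual hD hX hE hXh).fdd n t x ht ht0, cont_joint_fdd hD hX hE hXh n t x y ht ht0]

/-- The pair of processes stays in the support of the link. -/
theorem ae_forall_link_pos (hD : IsDualData Λ ν G Gh L) (hX : IsContChain μ X G)
    (hE : IsIndependentNoise μ X E clockLaw)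
    (hXh : ∀ t ω, Xh t ω = dualPathCont Λ ν (fun s => X s ω) (fun n => E n ω) t) :
    ∀ᵐ ω ∂μ, ∀ t, 0 < L (Xh t ω) (X t ω) := by
  -- Countably many times are handled at once; right-continuity of both paths carries positivity to
  -- all times.
  have h1 : ∀ᵐ ω ∂μ, ∀ m, 0 < L (Xh (TopologicalSpace.denseSeq ℝ≥0 m) ω)
      (X (TopologicalSpace.denseSeq ℝ≥0 m) ω) :=
    ae_all_iff.2 fun m => ae_link_pos_of_fdd μ X Xh L hD.link_stochastic.1
      (cont_joint_fdd_mul hD hX hE hXh) _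
  have hc := isContChain_dual hD hX hE hXh
  filter_upwards [h1] with ω hω t
  obtain ⟨u, hu, h2⟩ := (hX.isCadlag ω).exists_const_right t
  obtain ⟨v, hv, h3⟩ := (hc.isCadlag ω).exists_const_right t
  obtain ⟨m, hm1, hm2⟩ := exists_denseSeq_between (lt_min hu hv)
  have := hω m
  rwa [h2 _ hm1.le (hm2.trans_le (min_le_left _ _)),
    h3 _ hm1.le (hm2.trans_le (min_le_right _ _))] at this

end AlmostSure

/-! ### Hitting times in continuous time -/

section Hitting

variable {d : ℕ}

/-- The infimum of the times in a countable dense set at which a path is at `k`. -/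
def denseHit (k : State d) (p : ℝ≥0 → State d) : ℝ≥0∞ :=
  ⨅ (n : ℕ) (_ : p (TopologicalSpace.denseSeq ℝ≥0 n) = k),
    (TopologicalSpace.denseSeq ℝ≥0 n : ℝ≥0∞)

lemma measurable_denseHit (k : State d) : Measurable (denseHit k) := by
  refine Measurable.iInf fun n => ?_
  have : (fun p : ℝ≥0 → State d => ⨅ (_ : p (TopologicalSpace.denseSeq ℝ≥0 n) = k),
      (TopologicalSpace.denseSeq ℝ≥0 n : ℝ≥0∞)) = fun p =>
        if p (TopologicalSpace.denseSeq ℝ≥0 n) = k then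
          (TopologicalSpace.denseSeq ℝ≥0 n : ℝ≥0∞) else ⊤ := by
    ext1 p
    rw [iInf_eq_if]
  have hm : Measurable fun p : ℝ≥0 → State d => p (TopologicalSpace.denseSeq ℝ≥0 n) :=
    measurable_pi_apply _
  rw [this]
  exact Measurable.ite (hm (measurableSet_singleton k)) measurable_const measurable_const

/-- A right-continuous path stays at k for a while after each visit, so dense times see it
arbitrarily soon. Hitting times thereby become measurable functionals of the path, so their laws
depend only on the law of the process. -/
lemma hitCont_eq_denseHit {Ω : Type*} {Z : ℝ≥0 → Ω → State d} {ω : Ω}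
    (h : IsCadlag fun t => Z t ω) (k : State d) :
    hitCont Z k ω = denseHit k fun t => Z t ω := by
  refine le_antisymm (le_iInf₂ fun n hn =>
    iInf₂_le (TopologicalSpace.denseSeq ℝ≥0 n) hn) (le_iInf₂ fun t ht => ?_)
  refine le_of_forall_gt fun c hc => ?_
  obtain ⟨u, hu, hu'⟩ := h.exists_const_right t
  obtain ⟨b, hb1, hb2⟩ := ENNReal.lt_iff_exists_nnreal_btwn.1 hc
  obtain ⟨m, hm1, hm2⟩ := exists_denseSeq_between (lt_min hu (show t < b by exact_mod_cast hb1))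
  have h1 : Z (TopologicalSpace.denseSeq ℝ≥0 m) ω = k :=
    (hu' _ hm1.le (hm2.trans_le (min_le_left _ _))).trans ht
  refine lt_of_le_of_lt (iInf₂_le m h1) (lt_trans ?_ hb2)
  exact_mod_cast hm2.trans_le (min_le_right _ _)

/-- Waiting times as functions of the path. -/
def denseWait (p : ℝ≥0 → State d) (k : Fin d) : ℝ :=
  (denseHit k.succ p).toReal - (denseHit k.castSucc p).toReal

lemma measurable_denseWait : Measurable (denseWait (d := d)) :=
  measurable_pi_lambda _ fun k => (measurable_denseHit k.succ).ennreal_toReal.sub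
    (measurable_denseHit k.castSucc).ennreal_toReal

lemma waitCont_eq_denseWait {Ω : Type*} {Z : ℝ≥0 → Ω → State d} {ω : Ω}
    (h : IsCadlag fun t => Z t ω) (k : Fin d) :
    waitCont Z k ω = denseWait (fun t => Z t ω) k := by
  rw [waitCont, hitCont_eq_denseHit h, hitCont_eq_denseHit h, denseWait]

end Hitting

/-! ### Waiting times of a continuous-time pure-birth chain -/

section ContWaits

variable {d : ℕ} {ν : State d → ℝ}

lemma nextJump_const (x : State d) (s : ℝ≥0) : nextJump (fun _ => x) s = ⊤ := by
  simp [nextJump]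

lemma isCadlag_const (x : State d) : IsCadlag fun _ => x :=
  ⟨fun _ => Eventually.of_forall fun _ => rfl, fun _ => ⟨x, Eventually.of_forall fun _ => rfl⟩⟩

/-- Partial sums of the rescaled clocks. -/
def clockSum (ν : State d → ℝ) (e : ℕ → ℝ) (k : ℕ) : ℝ :=
  ∑ j ∈ Finset.range k, e j / natExt ν j

lemma natExt_of_le (ν : State d → ℝ) {k : ℕ} (hk : k ≤ d) :
    natExt ν k = ν ⟨k, Nat.lt_succ_of_le hk⟩ := by
  simp [natExt, hk]

lemma clockSum_nonneg (h0 : ∀ i, 0 ≤ ν i) {e : ℕ → ℝ} (he : ∀ n, 0 < e n) (k : ℕ) :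
    0 ≤ clockSum ν e k :=
  Finset.sum_nonneg fun j _ => div_nonneg (he j).le (h0 _)

/-- A constant path never jumps, and with the constant link 1 the clock at k has rate ν_k; the k-th
jump time is therefore a sum of independent rescaled clocks. -/
lemma skelFrom_const (h0 : ∀ i, 0 ≤ ν i) (hpos : ∀ i : State d, i.val < d → 0 < ν i)
    {e : ℕ → ℝ} (he : ∀ n, 0 < e n) (k : ℕ) (hk : k ≤ d) :
    skelFrom (Matrix.of fun _ _ => 1) ν (fun _ => 0) e (0, 0) k =
      (ENNReal.ofReal (clockSum ν e k), ⟨k, Nat.lt_succ_of_le hk⟩) := by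
  induction k with
  | zero => simp [skelFrom, clockSum]
  | succ k ih =>
    have hk' : (⟨k, by omega⟩ : State d).val < d := hk
    have hr : clockRate (Matrix.of fun _ _ => 1) ν (⟨k, by omega⟩ : State d) 0 =
        ν ⟨k, by omega⟩ := by simp [clockRate]
    have hν := hpos _ hk'
    have hring : ringTime (Matrix.of fun _ _ => 1) ν (fun _ => 0) (e k)
        (clockSum ν e k).toNNReal (⟨k, by omega⟩ : State d) =
        ENNReal.ofReal (clockSum ν e (k + 1)) := by
      simp only [ringTime]
      have hs : clockSum ν e (k + 1) = clockSum ν e k + e k / natExt ν k :=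
        Finset.sum_range_succ _ _
      rw [hr, if_pos hν, hs, natExt_of_le ν (by omega : k ≤ d),
        ENNReal.ofReal_add (clockSum_nonneg h0 he k) (div_nonneg (he k).le (h0 _))]
      rfl
    rw [skelFrom, ih (by omega), ENNReal.ofReal, dualStep_coe, nextJump_const, hring,
      if_pos ENNReal.ofReal_lt_top]
    exact Prod.ext rfl (Fin.ext (up_val hk'))

lemma skelFrom_const_top (hν : ν (Fin.last d) = 0) (h0 : ∀ i, 0 ≤ ν i)
    (hpos : ∀ i : State d, i.val < d → 0 < ν i) {e : ℕ → ℝ} (he : ∀ n, 0 < e n) (k : ℕ)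
    (hk : d < k) :
    (skelFrom (Matrix.of fun _ _ => 1) ν (fun _ => 0) e (0, 0) k).1 = ⊤ := by
  have h1 : (skelFrom (Matrix.of fun _ _ => 1) ν (fun _ => 0) e (0, 0) (d + 1)).1 = ⊤ := by
    rw [skelFrom, skelFrom_const h0 hpos he d le_rfl, ENNReal.ofReal, dualStep_coe,
      nextJump_const]
    have : ringTime (Matrix.of fun _ _ => 1) ν (fun _ => 0) (e d) (clockSum ν e d).toNNReal
        (⟨d, Nat.lt_succ_of_le le_rfl⟩ : State d) = ⊤ := by
      have hl : (⟨d, Nat.lt_succ_of_le le_rfl⟩ : State d) = Fin.last d := rfl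
      simp [ringTime, clockRate, hl, hν]
    simp [this]
  exact top_le_iff.1 (h1 ▸ skelFrom_monotone (isCadlag_const 0) e (0, 0) (show d + 1 ≤ k from hk))

/-- The hitting times of the path constructed from a constant path. -/
lemma hitCont_const {Ω : Type*} (hν : ν (Fin.last d) = 0) (h0 : ∀ i, 0 ≤ ν i)
    (hpos : ∀ i : State d, i.val < d → 0 < ν i) {Y : ℝ≥0 → Ω → State d} {ω : Ω} {e : ℕ → ℝ}
    (he : ∀ n, 0 < e n)
    (hY : ∀ t, Y t ω = dualPathCont (Matrix.of fun _ _ => 1) ν (fun _ => 0) e t) (k : State d) :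
    hitCont Y k ω = ENNReal.ofReal (clockSum ν e k) := by
  have hc := isCadlag_const (0 : State d)
  have hrate : ∀ x : State d, clockRate (Matrix.of fun _ _ => 1) ν (Fin.last d) x ≤ 0 := fun x => by
    simp [clockRate, hν]
  refine le_antisymm ?_ (le_iInf₂ fun t ht => ?_)
  · have hkd : k.val ≤ d := by omega
    refine iInf₂_le (clockSum ν e k).toNNReal ?_
    rw [hY, dualPathCont_eq hc (n := k.val), skelFrom_const h0 hpos he k hkd]
    · rw [skelFrom_const h0 hpos he k hkd]
      rfl
    · rcases hkd.lt_or_eq with h | h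
      · rw [skelFrom_const h0 hpos he (k + 1) h]
        refine (ENNReal.ofReal_lt_ofReal_iff_of_nonneg (clockSum_nonneg h0 he k)).2 ?_
        rw [clockSum, clockSum, Finset.sum_range_succ, natExt_of_le ν hkd]
        have := div_pos (he k) (hpos k h)
        linarith
      · rw [skelFrom_const_top hν h0 hpos he _ (by omega)]
        exact ENNReal.coe_lt_top
  · obtain ⟨n, h1, h2⟩ := exists_mem_skelFrom hc hrate e (0, 0) t zero_le
    have hn : n ≤ d := by
      by_contra hn
      rw [skelFrom_const_top hν h0 hpos he n (not_le.1 hn)] at h1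
      exact absurd h1 (by simp)
    rw [hY, dualPathCont_eq hc h1 h2, skelFrom_const h0 hpos he n hn] at ht
    rw [skelFrom_const h0 hpos he n hn] at h1
    rw [← ht]
    exact h1

lemma map_div_clockLaw {c : ℝ} (hc : 0 < c) : clockLaw.map (fun x => x / c) = expMeasure c := by
  have hm : Measurable fun x : ℝ => x / c := measurable_id.div_const c
  have := isProbabilityMeasure_expMeasure hc
  have : IsProbabilityMeasure (clockLaw.map fun x => x / c) :=
    Measure.isProbabilityMeasure_map hm.aemeasurable
  refine Measure.eq_of_cdf _ _ (StieltjesFunction.ext fun x => ?_)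
  rw [cdf_expMeasure_eq hc, cdf_eq_real, map_measureReal_apply hm measurableSet_Iic]
  have hset : (fun x => x / c) ⁻¹' Set.Iic x = Set.Iic (x * c) := by
    ext y
    simp [div_le_iff₀ hc]
  rw [hset, ← cdf_eq_real, cdf_expMeasure_eq one_pos, one_mul]
  have : 0 ≤ x * c ↔ 0 ≤ x := mul_nonneg_iff_of_pos_right hc
  simp only [this, mul_comm c x]

variable {Ω : Type*} [MeasurableSpace Ω] {μ : Measure Ω} [IsProbabilityMeasure μ]

lemma isContChain_const : IsContChain μ (fun (_ : ℝ≥0) (_ : Ω) => (0 : State d)) 0 := by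
  refine ⟨fun _ => measurable_const, fun _ => (isCadlag_const 0).right_cont,
    fun _ => (isCadlag_const 0).left_lim, fun n t x _ _ => ?_⟩
  simp only [smul_zero, NormedSpace.exp_zero, Matrix.one_apply]
  by_cases h : ∀ i ≤ n, 0 = x i
  · rw [Finset.prod_eq_one, ← h 0 (Nat.zero_le n)]
    · rw [if_pos rfl, mul_one, Set.eq_univ_of_forall (s := {_ω : Ω | ∀ i ≤ n, 0 = x i}) fun _ => h,
        probReal_univ]
    · intro i hi
      have := Finset.mem_range.1 hi
      rw [← h i this.le, ← h (i + 1) this, if_pos rfl]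
  · have hz : (if x 0 = 0 then (1 : ℝ) else 0) *
        ∏ i ∈ Finset.range n, (if x i = x (i + 1) then 1 else 0) = 0 := by
      by_contra hne
      apply h
      intro i
      induction i with
      | zero =>
        intro _
        by_contra h0
        exact hne (by rw [if_neg (Ne.symm h0), zero_mul])
      | succ i ih =>
        intro hi
        rw [ih (by omega)]
        by_contra h1
        exact hne (by rw [Finset.prod_eq_zero (Finset.mem_range.2 hi) (if_neg h1), mul_zero])
    rw [hz]
    simp [h]

/-- The waiting times of a pure-birth chain, by comparison with the chain driven by the clocks. -/
theorem cont_waits {ι : Type*} {X : ι → Ω → State d} {E : ℕ → Ω → ℝ} {Z : ℝ≥0 → Ω → State d}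
    (hν : ν (Fin.last d) = 0) (hpos : ∀ i : Fin d, 0 < ν i.castSucc)
    (hE : IsIndependentNoise μ X E clockLaw) (hZ : IsContChain μ Z (spectralGenerator ν)) :
    (∀ᵐ ω ∂μ, hitCont Z (Fin.last d) ω = ENNReal.ofReal (∑ k : Fin d, waitCont Z k ω)) ∧
    iIndepFun (fun k : Fin d => waitCont Z k) μ ∧
    (∀ k : Fin d, HasLaw (waitCont Z k) (expMeasure (ν k.castSucc)) μ) := by
  have hpos' : ∀ i : State d, i.val < d → 0 < ν i := fun i hi => hpos ⟨i, hi⟩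
  have h0 : ∀ i, 0 ≤ ν i := by
    intro i
    by_cases hi : i.val < d
    · exact (hpos' i hi).le
    · rw [eq_last_of_not_lt hi, hν]
  -- Comparison process with explicit waiting times. By `isContChain_dual` it has the same generator
  -- as Z, hence the same law on path space.
  set Y : ℝ≥0 → Ω → State d := fun t ω =>
    dualPathCont (Matrix.of fun _ _ => 1) ν (fun _ => 0) (fun n => E n ω) t with hYdef
  have hE' : IsIndependentNoise μ (fun (_ : ℝ≥0) (_ : Ω) => (0 : State d)) E clockLaw :=
    ⟨hE.measurable, hE.law, hE.iid, indepFun_const_left _ _⟩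
  have hY : IsContChain μ Y (spectralGenerator ν) :=
    isContChain_dual (isDualData_const hν h0) isContChain_const hE' fun _ _ => rfl
  have hlaw : μ.map (fun ω t => Z t ω) = μ.map (fun ω t => Y t ω) :=
    map_eq_of_fdd μ μ Z Y hZ.measurable hY.measurable fun n t x ht ht0 => by
      rw [hZ.fdd n t x ht ht0, hY.fdd n t x ht ht0]
  have hmZ : Measurable fun ω t => Z t ω := measurable_pi_lambda _ hZ.measurable
  have hmY : Measurable fun ω t => Y t ω := measurable_pi_lambda _ hY.measurable
  have hEpos : ∀ᵐ ω ∂μ, ∀ n, 0 < E n ω :=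
    ae_all_iff.2 fun n => by
      have := ae_clockLaw_pos
      rw [← (hE.law n).map_eq] at this
      exact ae_of_ae_map (hE.measurable n).aemeasurable this
  have hYhit : ∀ᵐ ω ∂μ, ∀ k, hitCont Y k ω = ENNReal.ofReal (clockSum ν (fun n => E n ω) k) := by
    filter_upwards [hEpos] with ω hω k
    exact hitCont_const hν h0 hpos' hω (fun t => rfl) k
  have hYwait : ∀ᵐ ω ∂μ, ∀ k : Fin d, waitCont Y k ω = E k ω / ν k.castSucc := by
    filter_upwards [hEpos, hYhit] with ω hω h k
    rw [waitCont, h, h, ENNReal.toReal_ofReal (clockSum_nonneg h0 hω _),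
      ENNReal.toReal_ofReal (clockSum_nonneg h0 hω _), Fin.val_succ, Fin.val_castSucc, clockSum,
      clockSum, Finset.sum_range_succ, add_sub_cancel_left,
      natExt_of_le ν (show k.val ≤ d by omega)]
    rfl
  have hwZ : (fun ω k => waitCont Z k ω) = denseWait ∘ fun ω t => Z t ω := by
    ext ω k
    exact waitCont_eq_denseWait (hZ.isCadlag ω) k
  have hwY : (fun ω k => waitCont Y k ω) = denseWait ∘ fun ω t => Y t ω := by
    ext ω k
    exact waitCont_eq_denseWait (hY.isCadlag ω) k
  have hmwZ : Measurable fun ω k => waitCont Z k ω := hwZ ▸ measurable_denseWait.comp hmZ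
  have hwaits : μ.map (fun ω k => waitCont Z k ω) =
      μ.map fun ω (k : Fin d) => E k ω / ν k.castSucc := by
    have h1 : μ.map (fun ω k => waitCont Z k ω) = μ.map (fun ω k => waitCont Y k ω) := by
      rw [hwZ, hwY, ← Measure.map_map measurable_denseWait hmZ, hlaw,
        Measure.map_map measurable_denseWait hmY]
    rw [h1]
    refine Measure.map_congr ?_
    filter_upwards [hYwait] with ω hω
    exact funext hω
  have hmE : ∀ k : Fin d, Measurable fun ω => E k ω / ν k.castSucc :=
    fun k => (hE.measurable k).div_const _
  have hEind : iIndepFun (fun (k : Fin d) ω => E k ω / ν k.castSucc) μ :=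
    (hE.iid.precomp Fin.val_injective).comp (fun k x => x / ν k.castSucc)
      fun k => measurable_id.div_const _
  have hmarg : ∀ k : Fin d, μ.map (waitCont Z k) = μ.map fun ω => E k ω / ν k.castSucc := by
    intro k
    have e1 : waitCont Z k = (fun v : Fin d → ℝ => v k) ∘ fun ω k => waitCont Z k ω := rfl
    have e2 : (fun ω => E k ω / ν k.castSucc) =
      (fun v : Fin d → ℝ => v k) ∘ fun ω (k : Fin d) => E k ω / ν k.castSucc := rfl
    rw [e1, e2, ← Measure.map_map (measurable_pi_apply k) hmwZ, hwaits,
      Measure.map_map (measurable_pi_apply k) (measurable_pi_lambda _ hmE)]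
  have hmk : ∀ k : Fin d, Measurable (waitCont Z k) := fun k => (measurable_pi_apply k).comp hmwZ
  refine ⟨?_, ?_, fun k => ⟨(hmk k).aemeasurable, ?_⟩⟩
  -- The almost sure identity is a measurable property of the path, so it passes from Y to Z through
  -- the common law.
  · have hS : MeasurableSet {p : ℝ≥0 → State d | denseHit (Fin.last d) p =
        ENNReal.ofReal (∑ k : Fin d, denseWait p k)} :=
      measurableSet_eq_fun (measurable_denseHit _) (Finset.measurable_sum _ fun k _ =>
        (measurable_pi_apply k).comp measurable_denseWait).ennreal_ofReal
    have hYS : ∀ᵐ p ∂μ.map (fun ω t => Y t ω), denseHit (Fin.last d) p =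
        ENNReal.ofReal (∑ k : Fin d, denseWait p k) := by
      rw [ae_map_iff hmY.aemeasurable hS]
      filter_upwards [hYhit, hYwait] with ω h1 h2
      have h3 := fun k => (waitCont_eq_denseWait (hY.isCadlag ω) k).symm.trans (h2 k)
      rw [← hitCont_eq_denseHit (hY.isCadlag ω), h1]
      simp only [h3, clockSum, Fin.val_last]
      rw [Finset.sum_range]
      congr 1
      refine Finset.sum_congr rfl fun k _ => ?_
      rw [natExt_of_le ν (show k.val ≤ d by omega)]
      rfl
    rw [← hlaw, ae_map_iff hmZ.aemeasurable hS] at hYS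
    filter_upwards [hYS] with ω hω
    simp only [waitCont_eq_denseWait (hZ.isCadlag ω)]
    rw [hitCont_eq_denseHit (hZ.isCadlag ω), hω]
  · rw [iIndepFun_iff_map_fun_eq_pi_map fun k => (hmk k).aemeasurable, hwaits,
      (iIndepFun_iff_map_fun_eq_pi_map fun k => (hmE k).aemeasurable).1 hEind]
    simp only [hmarg]
  · have hm : Measurable fun x : ℝ => x / ν k.castSucc := measurable_id.div_const _
    have e : (fun ω => E k ω / ν k.castSucc) = (fun x => x / ν k.castSucc) ∘ E k := rfl
    rw [hmarg, e, ← Measure.map_map hm (hE.measurable k),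
      (hE.law k).map_eq, map_div_clockLaw (hpos k)]

end ContWaits

/-! ### The continuous-time construction -/

section ContMain

variable {d : ℕ} {G : Matrix (State d) (State d) ℝ} {ν : State d → ℝ}

lemma HasEigenvalues.of_neg (he : HasEigenvalues (-G) ν) : HasEigenvalues G fun i => -ν i := by
  simpa using he.neg

lemma IsGenerator.rate_last (hG : IsGenerator G) (hν : Antitone ν) (he : HasEigenvalues (-G) ν) :
    ν (Fin.last d) = 0 :=
  neg_eq_zero.1 (hG.isBirthDeath.eigenvalue_last hν.neg he.of_neg)

lemma IsGenerator.rate_pos (hG : IsGenerator G) (hν : Antitone ν) (he : HasEigenvalues (-G) ν)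
    (i : Fin d) : 0 < ν i.castSucc :=
  neg_lt_zero.1
    (hG.isBirthDeath.eigenvalue_lt hν.neg he.of_neg i.castSucc i.is_lt)

variable {Ω : Type*} [MeasurableSpace Ω] {μ : Measure Ω} [IsProbabilityMeasure μ]
  {X : ℝ≥0 → Ω → State d} {E : ℕ → Ω → ℝ} {Xh : ℝ≥0 → Ω → State d}

/-- The link satisfies the abstract conditions of `IsDualData`: persistence of zeros and the
intertwining supply the infinitesimal identity. The rest parallels discrete time. -/
theorem cont_sample_path (hG : IsGenerator G) (hν : Antitone ν) (he : HasEigenvalues (-G) ν)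
    (hX : IsContChain μ X G) (hE : IsIndependentNoise μ X E clockLaw)
    (hXh : ∀ t ω, Xh t ω = dualPathCont (linkGen G ν) ν (fun s => X s ω) (fun n => E n ω) t) :
    IsContChain μ Xh (spectralGenerator ν) ∧
    SamplePathIntertwined μ X Xh (linkGen G ν) ∧
    (∀ᵐ ω ∂μ, ∀ t, 0 < linkGen G ν (Xh t ω) (X t ω) ∧ X t ω ≤ Xh t ω) ∧
    (∀ᵐ ω ∂μ, hitCont X (Fin.last d) ω = hitCont Xh (Fin.last d) ω) ∧
    (∀ᵐ ω ∂μ, hitCont X (Fin.last d) ω = ENNReal.ofReal (∑ k : Fin d, waitCont Xh k ω)) ∧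
    iIndepFun (fun k : Fin d => waitCont Xh k) μ ∧
    (∀ k : Fin d, HasLaw (waitCont Xh k) (expMeasure (ν k.castSucc)) μ) := by
  have hA := hG.isBirthDeath
  have hm := hν.neg
  have h0 := hG.rate_last hν he
  have hL : linkGen G ν ∈ Matrix.rowStochastic ℝ (State d) := by
    rw [linkGen_eq]
    exact genLink_stochastic hA hm he.of_neg
  have hT : ∀ i j, i < j → linkGen G ν i j = 0 := by
    rw [linkGen_eq]
    exact genLink_triangular hA
  have hlast : linkGen G ν (Fin.last d) (Fin.last d) = 1 := by
    rw [linkGen_eq]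
    exact genLink_last hA hm he.of_neg
  have hD : IsDualData (linkGen G ν) ν G (spectralGenerator ν) (linkGen G ν) := by
    refine isDualData_link h0 (fun i => h0 ▸ hν (Fin.le_last i)) hG.offDiag_nonneg hG.row_sum hL
      ?_ hT ?_ ?_
    · rw [linkGen_eq]
      exact genLink_zero_row
    · rw [linkGen_eq]
      exact genLink_up_eq_zero hA hm he.of_neg
    · rw [linkGen_eq, spectralGenerator_eq]
      exact genLink_intertwine hA hm he.of_neg
  have hchain := isContChain_dual hD hX hE hXh
  have hpos := ae_forall_link_pos hD hX hE hXh
  have hhit : ∀ᵐ ω ∂μ, hitCont X (Fin.last d) ω = hitCont Xh (Fin.last d) ω := by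
    filter_upwards [hpos] with ω hω
    have := fun t => eq_last_iff_of_link_pos hL hT hlast (hω t)
    simp only [hitCont, this]
  obtain ⟨hw1, hw2, hw3⟩ := cont_waits h0 (hG.rate_pos hν he) hE hchain
  refine ⟨hchain, samplePathIntertwined_of_fdd μ X Xh hX.measurable hchain.measurable _ hL.1
    (cont_joint_fdd_mul hD hX hE hXh), ?_, hhit, ?_, hw2, hw3⟩
  · filter_upwards [hpos] with ω hω t
    exact ⟨hω t, le_of_link_pos hT (hω t)⟩
  · filter_upwards [hhit, hw1] with ω h1 h2
    rw [h1, h2]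

end ContMain

/-! ### Algebraic conclusions -/

section Algebra

variable {d : ℕ}

lemma isKernel_spectralKernel {P : Matrix (State d) (State d) ℝ} (hP : IsKernel P)
    {θ : State d → ℝ} (hm : Monotone θ) (he : HasEigenvalues P θ) (h0 : ∀ i, 0 ≤ θ i) :
    IsKernel (spectralKernel θ) := by
  have h := genSpectral_isBirthDeath hP.isBirthDeath hm he
  refine ⟨Matrix.mem_rowStochastic_iff_sum.2 ⟨fun i j => ?_, h.row_sum⟩, h.nearest, h.birth_pos,
    h.absorbing⟩
  by_cases hij : i = j
  · subst hij
    rw [spectralKernel_eq, genSpectral_self]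
    exact h0 i
  · exact h.offDiag_nonneg i j hij

lemma isGenerator_spectralGenerator {G : Matrix (State d) (State d) ℝ} (hG : IsGenerator G)
    {ν : State d → ℝ} (hν : Antitone ν) (he : HasEigenvalues (-G) ν) :
    IsGenerator (spectralGenerator ν) := by
  have h := genSpectral_isBirthDeath hG.isBirthDeath hν.neg he.of_neg
  rw [← spectralGenerator_eq] at h
  exact ⟨h.offDiag_nonneg, h.row_sum, h.nearest, h.birth_pos, h.absorbing⟩

end Algebra

end BirthDeath

end

/-! ### The main theorem -/

open BirthDeath in
theorem mainTheorem5 (d : ℕ) :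
    -- discrete time
    (∀ P : Matrix (State d) (State d) ℝ, IsKernel P →
      -- the eigenvalues are real; they are nonnegative if all holding probabilities are `≥ 1/2`
      (∃ θ : State d → ℝ, Monotone θ ∧ HasEigenvalues P θ) ∧
      ((∀ i, 1 / 2 ≤ P i i) → ∀ θ, HasEigenvalues P θ → ∀ i, 0 ≤ θ i) ∧
      ∀ θ : State d → ℝ, Monotone θ → HasEigenvalues P θ → (∀ i, 0 ≤ θ i) →
        θ (Fin.last d) = 1 ∧ (∀ i : Fin d, θ i.castSucc < 1) ∧
        -- the spectral polynomials and the link are stochastic; the intertwining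
        (∀ k, specQ P θ k ∈ Matrix.rowStochastic ℝ (State d)) ∧
        link P θ ∈ Matrix.rowStochastic ℝ (State d) ∧
        (∀ i j, i < j → link P θ i j = 0) ∧
        link P θ (Fin.last d) (Fin.last d) = 1 ∧
        (∀ t : ℕ, link P θ * P ^ t = spectralKernel θ ^ t * link P θ) ∧
        -- the spectral kernel is a birth-and-death kernel with these eigenvalues, and it is
        -- stochastically maximal at every epoch
        IsKernel (spectralKernel θ) ∧ HasEigenvalues (spectralKernel θ) θ ∧
        (∀ (t : ℕ) (j : State d),
          ∑ i ∈ Finset.Ici j, (P ^ t) 0 i ≤ ∑ i ∈ Finset.Ici j, (spectralKernel θ ^ t) 0 i) ∧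
        -- the sample-path construction
        ∀ {Ω : Type*} [MeasurableSpace Ω] (μ : Measure Ω) [IsProbabilityMeasure μ]
          (X : ℕ → Ω → State d) (U : ℕ → Ω → ℝ) (Xh : ℕ → Ω → State d),
          IsChain μ X P →
          IsIndependentNoise μ X U (volume.restrict (Set.Icc 0 1)) →
          (∀ t ω, Xh t ω = dualPath (link P θ) θ (fun s => X s ω) (fun n => U n ω) t) →
            IsChain μ Xh (spectralKernel θ) ∧
            SamplePathIntertwined μ X Xh (link P θ) ∧
            (∀ᵐ ω ∂μ, ∀ t, 0 < link P θ (Xh t ω) (X t ω) ∧ X t ω ≤ Xh t ω) ∧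
            (∀ᵐ ω ∂μ, hit X (Fin.last d) ω = hit Xh (Fin.last d) ω) ∧
            (∀ᵐ ω ∂μ, hit X (Fin.last d) ω = ((∑ k : Fin d, wait Xh k ω : ℕ) : ℕ∞)) ∧
            iIndepFun (fun k : Fin d => wait Xh k) μ ∧
            (∀ (k : Fin d) (n : ℕ), μ.real {ω | wait Xh k ω = n + 1} =
              θ k.castSucc ^ n * (1 - θ k.castSucc))) ∧
    -- continuous time
    (∀ G : Matrix (State d) (State d) ℝ, IsGenerator G →
      -- the eigenvalues are real
      (∃ ν : State d → ℝ, Antitone ν ∧ HasEigenvalues (-G) ν) ∧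
      ∀ ν : State d → ℝ, Antitone ν → HasEigenvalues (-G) ν →
        ν (Fin.last d) = 0 ∧ (∀ i : Fin d, 0 < ν i.castSucc) ∧
        -- the spectral polynomials are nonnegative and the link is stochastic; the intertwining
        (∀ k i j, 0 ≤ specPolyGen G ν k i j) ∧
        linkGen G ν ∈ Matrix.rowStochastic ℝ (State d) ∧
        (∀ i j, i < j → linkGen G ν i j = 0) ∧
        linkGen G ν (Fin.last d) (Fin.last d) = 1 ∧
        (∀ t : ℝ≥0, linkGen G ν * NormedSpace.exp ((t : ℝ) • G) =
          NormedSpace.exp ((t : ℝ) • spectralGenerator ν) * linkGen G ν) ∧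
        -- the spectral generator is a birth-and-death generator with these eigenvalues, and it is
        -- stochastically maximal at every epoch
        IsGenerator (spectralGenerator ν) ∧ HasEigenvalues (-spectralGenerator ν) ν ∧
        (∀ (t : ℝ≥0) (j : State d),
          ∑ i ∈ Finset.Ici j, NormedSpace.exp ((t : ℝ) • G) 0 i ≤
            ∑ i ∈ Finset.Ici j, NormedSpace.exp ((t : ℝ) • spectralGenerator ν) 0 i) ∧
        -- the sample-path construction
        ∀ {Ω : Type*} [MeasurableSpace Ω] (μ : Measure Ω) [IsProbabilityMeasure μ]
          (X : ℝ≥0 → Ω → State d) (E : ℕ → Ω → ℝ) (Xh : ℝ≥0 → Ω → State d),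
          IsContChain μ X G →
          IsIndependentNoise μ X E (expMeasure 1) →
          (∀ t ω, Xh t ω =
            dualPathCont (linkGen G ν) ν (fun s => X s ω) (fun n => E n ω) t) →
            IsContChain μ Xh (spectralGenerator ν) ∧
            SamplePathIntertwined μ X Xh (linkGen G ν) ∧
            (∀ᵐ ω ∂μ, ∀ t, 0 < linkGen G ν (Xh t ω) (X t ω) ∧ X t ω ≤ Xh t ω) ∧
            (∀ᵐ ω ∂μ, hitCont X (Fin.last d) ω = hitCont Xh (Fin.last d) ω) ∧
            (∀ᵐ ω ∂μ, hitCont X (Fin.last d) ω =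
              ENNReal.ofReal (∑ k : Fin d, waitCont Xh k ω)) ∧
            iIndepFun (fun k : Fin d => waitCont Xh k) μ ∧
            (∀ k : Fin d, HasLaw (waitCont Xh k) (expMeasure (ν k.castSucc)) μ)) := by
  refine ⟨fun P hP => ⟨hP.isBirthDeath.exists_eigenvalues,
    fun h θ he i => hP.eigenvalue_nonneg h he i, fun θ hm he h0 => ?_⟩, fun G hG => ⟨?_, ?_⟩⟩
  · have hA := hP.isBirthDeath
    have hK := isKernel_spectralKernel hP hm he h0
    have hI : ∀ t : ℕ, link P θ * P ^ t = spectralKernel θ ^ t * link P θ := fun t => by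
      rw [link_eq]
      exact ((show SemiconjBy _ _ _ from genLink_intertwine hA hm he).pow_right t).eq
    have hL : link P θ ∈ Matrix.rowStochastic ℝ (State d) := by
      rw [link_eq]
      exact genLink_stochastic hA hm he
    have hT : ∀ i j, i < j → link P θ i j = 0 := by
      rw [link_eq]
      exact genLink_triangular hA
    refine ⟨hA.eigenvalue_last hm he, fun i => hA.eigenvalue_lt hm he i.castSucc i.is_lt,
      fun k => ?_, hL, hT, ?_, hI, hK, genSpectral_hasEigenvalues 1 θ, fun t j => ?_, ?_⟩
    · rw [specQ_eq]
      exact normalized_specMat_stochastic hA hm he k (by omega)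
    · rw [link_eq]
      exact genLink_last hA hm he
    · refine tail_sum_le hL ?_ hT (pow_mem hK.stochastic t).1 (hI t) j
      rw [link_eq]
      exact genLink_zero_row
    · intro Ω _ μ _ X U Xh hX hU hXh
      rw [link_eq] at hXh ⊢
      exact discrete_sample_path hP hm he h0 hX hU hXh
  · obtain ⟨θ, hm, he⟩ := hG.isBirthDeath.exists_eigenvalues
    exact ⟨fun i => -θ i, hm.neg, he.neg⟩
  · intro ν hν he
    have hA := hG.isBirthDeath
    have hK := isGenerator_spectralGenerator hG hν he
    have hI : linkGen G ν * G = spectralGenerator ν * linkGen G ν := by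
      rw [linkGen_eq, spectralGenerator_eq]
      exact genLink_intertwine hA hν.neg he.of_neg
    have hL : linkGen G ν ∈ Matrix.rowStochastic ℝ (State d) := by
      rw [linkGen_eq]
      exact genLink_stochastic hA hν.neg he.of_neg
    have hT : ∀ i j, i < j → linkGen G ν i j = 0 := by
      rw [linkGen_eq]
      exact genLink_triangular hA
    refine ⟨hG.rate_last hν he, hG.rate_pos hν he, fun k i j => ?_, hL, hT, ?_,
      fun t => matrix_exp_intertwine hI t, hK, ?_, fun t j => ?_, ?_⟩
    · rw [specPolyGen_eq]
      exact specMat_nonneg hA.toIsTridiagNonneg _ (natExt_monotone hν.neg) he.of_neg.range k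
        (by omega) i j
    · rw [linkGen_eq]
      exact genLink_last hA hν.neg he.of_neg
    · rw [spectralGenerator_eq]
      simpa using (genSpectral_hasEigenvalues 0 fun i => -ν i).neg
    · refine tail_sum_le hL ?_ hT (matrix_exp_nonneg hK.offDiag_nonneg t.2)
        (matrix_exp_intertwine hI t) j
      rw [linkGen_eq]
      exact genLink_zero_row
    · intro Ω _ μ _ X E Xh hX hE hXh
      exact cont_sample_path hG hν he hX hE hXh
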